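/- Conventions. A Waldhausen category is a category with two subcategories, of cofibrations and of weak equivalences, such that isomorphisms belong to both; weak equivalences satisfy two-out-of-three; there is a zero object and every $0\to A$ is a cofibration; every diagram $C\leftarrow A\to B$ in which $A\to B$ is a cofibration has a pushout, and $C\to B\cup_A C$ is a cofibration; and the gluing axiom holds (weak equivalences between two such diagrams induce a weak equivalence of pushouts). All Waldhausen categories are small. Let $\mathcal I=\{0\to 1\}$. An $n$-cube in $\mathcal D$ is a functor $I:\mathcal I^n\to\mathcal D$; its southern arrow is $\operatorname{colim}_{\bar\epsilon\neq(1,\dots,1)} I(\bar\epsilon)\to I(1,\dots,1)$ (if the colimit exists). A cube is good if its southern arrow exists and is a cofibration and all its faces are good. For $f_i:A_{i0}\to A_{i1}$ in $\mathcal C_i$ and $F:\mathcal C_1\times\dots\times\mathcal C_k\to\mathcal D$, let $[\bar f]_F$ be the $k$-cube $\bar\epsilon\mapsto F(A_{1\epsilon_1},\dots,A_{k\epsilon_k})$. The functor $F$ is $k$-exact (multiexact) if $F(A_1,\dots,A_k)$ is zero whenever some $A_i$ is zero; $F$ preserves pushouts along cofibrations in each variable separately; $F$ sends tuples of weak equivalences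 to weak equivalences; and $[\bar f]_F$ is good for all tuples $\bar f$ of cofibrations. (For $k=0$ these are the objects of $\mathcal D$.) Let $\mathbf{WaldCat}(\mathcal C_1,\dots,\mathcal C_k;\mathcal D)$ be the category of $k$-exact functors $\mathcal C_1\times\dots\times\mathcal C_k\to\mathcal D$ and all natural transformations. A transformation is a weak equivalence if it is one levelwise; $\alpha:F\to G$ is a cofibration if for all tuples $\bar f$ of cofibrations the $(k+1)$-cube $([\bar f]_F\Rightarrow[\bar f]_G)$ given by $\alpha$ is good. Theorem. Waldhausen categories and multiexact functors form a closed symmetric multicategory. Precisely: (1) Identity functors are $1$-exact. Multiexact functors are stable under permutation of the input variables and under composition: if $F$ is $\ell$-exact and $G_i$ is $k_i$-exact for $1\le i\le\ell$, then $F\circ(G_1\times\dots\times G_\ell)$ is $(\sum k_i)$-exact. With these operations the multiexact functors satisfy the axioms of a symmetric multicategory (right action of permutations, associativity, units, equivariance of composition in both arguments). (2) Each $\mathbf{WaldCat}(\mathcal C_1,\dots,\mathcal C_k;\mathcal D)$, with the above cofibrations and weak equivalences, is a Waldhausen category. (3) The evaluation functor $\mathrm{ev}:\mathcal C_1\times\dots\times\mathcal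 C_k\times\mathbf{WaldCat}(\mathcal C_1,\dots,\mathcal C_k;\mathcal D)\to\mathcal D$, $(A_1,\dots,A_k,F)\mapsto F(A_1,\dots,A_k)$, is $(k+1)$-exact. (4) For $\sigma\in\Sigma_k$ the functor $F\mapsto F\cdot\sigma$, from $\mathbf{WaldCat}(\mathcal C_1,\dots,\mathcal C_k;\mathcal D)$ to $\mathbf{WaldCat}(\mathcal C_{\sigma(1)},\dots,\mathcal C_{\sigma(k)};\mathcal D)$, is $1$-exact, and these functors form a right action. For all Waldhausen categories $\mathcal A_1,\dots,\mathcal A_\ell$ the assignment $\varphi(f)=\mathrm{ev}\circ(1_{\mathcal C_1},\dots,1_{\mathcal C_k},f)$ is a bijection from the $\ell$-exact functors $\mathcal A_1\times\dots\times\mathcal A_\ell\to\mathbf{WaldCat}(\mathcal C_1,\dots,\mathcal C_k;\mathcal D)$ to the $(k+\ell)$-exact functors $\mathcal C_1\times\dots\times\mathcal C_k\times\mathcal A_1\times\dots\times\mathcal A_\ell\to\mathcal D$. It is $\Sigma_k\times\Sigma_\ell$-equivariant: $\varphi(\sigma\circ(f\cdot\tau))=\varphi(f)\cdot(\sigma\times\tau)$,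 where $\sigma\circ{-}$ is postcomposition with $F\mapsto F\cdot\sigma$. (5) Composition is multiexact: the functor $(F,G_1,\dots,G_\ell)\mapsto F\circ(G_1\times\dots\times G_\ell)$, from $\mathbf{WaldCat}(\mathcal B_1,\dots,\mathcal B_\ell;\mathcal D)\times\prod_{i}\mathbf{WaldCat}(\mathcal A_{i1},\dots,\mathcal A_{ik_i};\mathcal B_i)$ to $\mathbf{WaldCat}(\mathcal A_{11},\dots,\mathcal A_{\ell k_\ell};\mathcal D)$, given on morphisms by horizontal composition, is $(\ell+1)$-exact. Here $k,\ell,k_i\ge 0$, and tuples may be indexed by arbitrary finite sets instead of $\{1,\dots,k\}$, with bijections of finite sets in place of permutations, disjoint unions in place of concatenations, and the canonical bijections between such index sets understood in the axioms. -/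

import Mathlib

open CategoryTheory CategoryTheory.Limits

universe u v w w₁

noncomputable section

namespace Waldhausen

/-! ### Waldhausen categories -/

/-- `cof` and `weq` (the morphisms of the two wide subcategories of cofibrations and of weak
equivalences) make the category `C` a Waldhausen category. -/
structure IsWaldhausen (C : Type u) [Category.{v} C] (cof weq : MorphismProperty C) : Prop where
  cof_multiplicative : cof.IsMultiplicative
  weq_multiplicative : weq.IsMultiplicative
  /-- Isomorphisms are cofibrations and weak equivalences. -/
  cof_of_isIso : ∀ {A B : C} (f : A ⟶ B), IsIso f → cof f
  weq_of_isIso : ∀ {A B : C} (f : A ⟶ B), IsIso f → weq f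
  /-- Two out of three for weak equivalences. -/
  two_out_of_three : weq.HasTwoOutOfThreeProperty
  /-- There is a zero object, and `0 ⟶ A` is a cofibration. -/
  hasZero : HasZeroObject C
  cof_from_zero : ∀ {Z A : C} (_ : IsZero Z) (f : Z ⟶ A), cof f
  /-- Pushouts along cofibrations exist, and cofibrations are stable under pushout. -/
  pushout : ∀ {A B C' : C} (f : A ⟶ B) (g : A ⟶ C'), cof f →
    ∃ (P : C) (h : B ⟶ P) (k : C' ⟶ P), IsPushout f g h k ∧ cof k
  /-- The gluing axiom. -/
  gluing : ∀ {A B C' P A₁ B₁ C₁ P₁ : C}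
    {f : A ⟶ B} {g : A ⟶ C'} {h : B ⟶ P} {k : C' ⟶ P}
    {f₁ : A₁ ⟶ B₁} {g₁ : A₁ ⟶ C₁} {h₁ : B₁ ⟶ P₁} {k₁ : C₁ ⟶ P₁}
    (a : A ⟶ A₁) (b : B ⟶ B₁) (c : C' ⟶ C₁) (p : P ⟶ P₁),
    IsPushout f g h k → IsPushout f₁ g₁ h₁ k₁ → cof f → cof f₁ →
    weq a → weq b → weq c →
    f ≫ b = a ≫ f₁ → g ≫ c = a ≫ g₁ → h ≫ p = b ≫ h₁ → k ≫ p = c ≫ k₁ →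
    weq p

/-- A (small) Waldhausen category. -/
structure WaldCat : Type (u + 1) where
  carrier : Type u
  [category : Category.{u} carrier]
  cof : MorphismProperty carrier
  weq : MorphismProperty carrier
  isWaldhausen : IsWaldhausen carrier cof weq

instance : CoeSort WaldCat.{u} (Type u) := ⟨WaldCat.carrier⟩

instance (C : WaldCat.{u}) : Category.{u} C := C.category

/-! ### Cubes -/

/-- The objects of the cube category `I^ι`: vectors of zeros and ones, ordered componentwise. -/
def Vertex (ι : Type) : Type := ι → Fin 2

instance (ι : Type) : PartialOrder (Vertex ι) := inferInstanceAs (PartialOrder (ι → Fin 2))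

/-- The functor `I^ι ⥤ I` reading the coordinate `i`. -/
def coord {ι : Type} (i : ι) : Vertex ι ⥤ Fin 2 :=
  Monotone.functor (f := fun x : Vertex ι => x i) (fun _ _ h => h i)

/-- The functor `I^(ι ⊕ κ) ⥤ I^ι` forgetting the coordinates in `κ`. -/
def forgetCoord (ι κ : Type) : Vertex (ι ⊕ κ) ⥤ Vertex ι :=
  Monotone.functor (X := Vertex (ι ⊕ κ)) (Y := Vertex ι) (f := fun x i => x (Sum.inl i))
    (fun _ _ h i => h (Sum.inl i))

/-- An `ι`-cube in `D`; for `ι` with `n` elements this is an `n`-cube. -/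
abbrev Cube (ι : Type) (D : Type u) [Category.{v} D] := Vertex ι ⥤ D

section cubes

variable {ι : Type} {D : Type u} [Category.{v} D]

/-- The (iterated) faces of a cube, the cube itself included, are its restrictions to the intervals
`{x | a ≤ x ≤ b}` for vertices `a ≤ b`: the coordinate `i` varies if `a i < b i` and is constant
otherwise. This is the face between `a` and `b` with its last vertex `b` removed. -/
def puncturedFace (X : Cube ι D) (a b : Vertex ι) : Set.Ico a b ⥤ D :=
  Monotone.functor (f := fun x : Set.Ico a b => (x : Vertex ι)) (fun _ _ h => h) ⋙ X

/-- The value of a cube at the vertex `b`, as a cocone under the punctured face. -/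
def terminalCocone (X : Cube ι D) (a b : Vertex ι) : Cocone (puncturedFace X a b) where
  pt := X.obj b
  ι :=
    { app := fun x => X.map (homOfLE x.2.2.le)
      naturality := fun x y f => by
        dsimp [puncturedFace]
        rw [← X.map_comp, Category.comp_id]
        rfl }

/-- The southern arrow of the face of `X` between `a` and `b` exists and belongs to `cof`. -/
def SouthernArrowMem (cof : MorphismProperty D) (X : Cube ι D) (a b : Vertex ι) : Prop :=
  ∃ (c : Cocone (puncturedFace X a b)) (hc : IsColimit c), cof (hc.desc (terminalCocone X a b))

/-- A cube is good if its southern arrow and those of all its iterated faces are cofibrations. -/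
def IsGood (cof : MorphismProperty D) (X : Cube ι D) : Prop :=
  ∀ a b : Vertex ι, a ≤ b → SouthernArrowMem cof X a b

/-- The cube `(X ⇒ Y)` of a natural transformation `α : X ⟶ Y` of `ι`-cubes: it has one more
coordinate, and restricts to `X` and to `Y` where that coordinate is `0` and `1`. -/
def arrowCube {X Y : Cube ι D} (α : X ⟶ Y) : Cube (ι ⊕ Unit) D :=
  Functor.prod' (coord (Sum.inr ())) (forgetCoord ι Unit) ⋙
    Functor.uncurry.obj (ComposableArrows.mk₁ α)

end cubes

/-- The product functor `I^ι ⥤ ∏ C i` of the arrows `f i : X i ⟶ Y i`. -/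
def boxCube {ι : Type} {C : ι → WaldCat.{u}} {X Y : ∀ i, C i} (f : X ⟶ Y) :
    Cube ι (∀ i, C i) :=
  Functor.pi' fun i => coord i ⋙ ComposableArrows.mk₁ (f i)

/-! ### Multiexact functors -/

section multiexact

variable {ι : Type} (C : ι → WaldCat.{u}) (D : WaldCat.{u})

/-- `F : ∏ C i ⥤ D` is multiexact (`k`-exact, if `ι` has `k` elements). -/
structure IsMultiexact (F : (∀ i, C i) ⥤ D) : Prop where
  /-- `F` is zero as soon as one variable is zero. -/
  zero : ∀ (X : ∀ i, C i) (i : ι), IsZero (X i) → IsZero (F.obj X)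
  /-- `F` preserves in each variable `i` the pushouts along cofibrations: the other variables
  are held constant, up to isomorphism. (A square all of whose arrows are isomorphisms is isomorphic
  to a constant one.) -/
  pushout : ∀ (i : ι) {A B A' P : ∀ i, C i} (f : A ⟶ B) (g : A ⟶ A') (h : B ⟶ P) (k : A' ⟶ P),
    (∀ j, IsPushout (f j) (g j) (h j) (k j)) →
    (C i).cof (f i) → (∀ j, j ≠ i → IsIso (f j) ∧ IsIso (g j)) →
    IsPushout (F.map f) (F.map g) (F.map h) (F.map k)
  /-- `F` preserves (componentwise) weak equivalences. -/
  weq : ∀ {X Y : ∀ i, C i} (f : X ⟶ Y), (∀ i, (C i).weq (f i)) → D.weq (F.map f)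
  /-- The cube `[f]_F` of a tuple `f` of cofibrations is good. -/
  cof : ∀ {X Y : ∀ i, C i} (f : X ⟶ Y), (∀ i, (C i).cof (f i)) → IsGood D.cof (boxCube f ⋙ F)

/-- The category of multiexact functors `∏ C i ⥤ D` and all natural transformations. -/
abbrev Multiexact : Type u :=
  ObjectProperty.FullSubcategory (C := (∀ i, C i) ⥤ D) (IsMultiexact C D)

variable {C D}

/-- Cofibrations of multiexact functors: the transformations `α : F ⟶ G` such that the cube
`([f]_F ⇒ [f]_G)` is good for all tuples `f` of cofibrations. -/
def homCof : MorphismProperty (Multiexact C D) := fun F G α =>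
  ∀ {X Y : ∀ i, C i} (f : X ⟶ Y), (∀ i, (C i).cof (f i)) →
    IsGood D.cof
      (arrowCube (X := boxCube f ⋙ F.obj) (Y := boxCube f ⋙ G.obj)
        (Functor.whiskerLeft (boxCube f) α.hom))

/-- Weak equivalences of multiexact functors are levelwise. -/
def homWeq : MorphismProperty (Multiexact C D) := fun _ _ α =>
  ∀ X : ∀ i, C i, D.weq (α.hom.app X)

end multiexact

/-! ### Symmetric multicategories

Tuples of objects are indexed by arbitrary finite sets `ι`; the `k`-morphisms with their
`Σ_k`-action are obtained for `ι = Fin k`. -/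

/-- The data of a symmetric multicategory: objects, multimorphisms, for every bijection `e` the
action `f ↦ f · e` permuting the input variables, units, and the composition law
`(f, (g i)) ↦ f ∘ (g i)`, whose inputs are the disjoint union of the inputs of the `g i`. -/
structure MulticategoryData where
  Obj : Type w
  Hom : ∀ {ι : Type} [Finite ι], (ι → Obj) → Obj → Type w₁
  act : ∀ {ι ι' : Type} [Finite ι] [Finite ι'] {A : ι → Obj} {B : Obj} (e : ι' ≃ ι),
    Hom A B → Hom (fun i => A (e i)) B
  one : ∀ A : Obj, Hom (fun _ : Unit => A) A
  comp : ∀ {ι : Type} [Finite ι] {J : ι → Type} [∀ i, Finite (J i)]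
    {A : (Σ i, J i) → Obj} {B : ι → Obj} {C : Obj},
    Hom B C → (∀ i, Hom (fun j => A ⟨i, j⟩) (B i)) → Hom A C

/-- `Σ _ : Unit, ι` is in bijection with `ι`. -/
def unitSigma (ι : Type) : (Σ _ : Unit, ι) ≃ ι where
  toFun p := p.2
  invFun i := ⟨(), i⟩
  left_inv _ := rfl
  right_inv _ := rfl

/-- `Σ _ : ι, Unit` is in bijection with `ι`. -/
def sigmaUnit (ι : Type) : (Σ _ : ι, Unit) ≃ ι where
  toFun p := p.1
  invFun i := ⟨i, ()⟩
  left_inv _ := rfl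
  right_inv _ := rfl

/-- The laws of a symmetric multicategory: the `act e` form a right action, units are neutral,
composition is associative, and it is equivariant in the outer and in the inner multimorphisms. -/
structure IsSymmetricMulticategory (M : MulticategoryData.{w, w₁}) : Prop where
  act_refl : ∀ {ι : Type} [Finite ι] {A : ι → M.Obj} {B : M.Obj} (f : M.Hom A B),
    M.act (Equiv.refl ι) f = f
  act_act : ∀ {ι ι' ι'' : Type} [Finite ι] [Finite ι'] [Finite ι''] {A : ι → M.Obj} {B : M.Obj}
    (e : ι' ≃ ι) (e' : ι'' ≃ ι') (f : M.Hom A B),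
    M.act e' (M.act e f) = M.act (e'.trans e) f
  one_comp : ∀ {ι : Type} [Finite ι] {A : ι → M.Obj} {B : M.Obj} (f : M.Hom A B),
    M.comp (A := fun p : (Σ _ : Unit, ι) => A p.2) (M.one B) (fun _ => f) = M.act (unitSigma ι) f
  comp_one : ∀ {ι : Type} [Finite ι] {A : ι → M.Obj} {B : M.Obj} (f : M.Hom A B),
    M.comp (A := fun p : (Σ _ : ι, Unit) => A p.1) f (fun i => M.one (A i)) =
      M.act (sigmaUnit ι) f
  assoc : ∀ {ι : Type} [Finite ι] {J : ι → Type} [∀ i, Finite (J i)]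
    {K : ∀ i, J i → Type} [∀ i j, Finite (K i j)]
    {A : (Σ i, Σ j, K i j) → M.Obj} {B : (Σ i, J i) → M.Obj} {C : ι → M.Obj} {D : M.Obj}
    (f : M.Hom C D) (g : ∀ i, M.Hom (fun j => B ⟨i, j⟩) (C i))
    (h : ∀ i j, M.Hom (fun k => A ⟨i, j, k⟩) (B ⟨i, j⟩)),
    M.comp (A := fun p : (Σ q : (Σ i, J i), K q.1 q.2) => A ⟨p.1.1, p.1.2, p.2⟩)
        (M.comp f g) (fun q => h q.1 q.2) =
      M.act (Equiv.sigmaAssoc K)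
        (M.comp f fun i =>
          M.comp (A := fun p : (Σ j, K i j) => A ⟨i, p⟩) (g i) (fun j => h i j))
  act_comp : ∀ {ι ι' : Type} [Finite ι] [Finite ι'] {J : ι → Type} [∀ i, Finite (J i)]
    {A : (Σ i, J i) → M.Obj} {B : ι → M.Obj} {C : M.Obj} (e : ι' ≃ ι)
    (f : M.Hom B C) (g : ∀ i, M.Hom (fun j => A ⟨i, j⟩) (B i)),
    M.comp (A := fun p : (Σ i', J (e i')) => A ⟨e p.1, p.2⟩) (M.act e f) (fun i' => g (e i')) =
      M.act (Equiv.sigmaCongrLeft e) (M.comp f g)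
  comp_act : ∀ {ι : Type} [Finite ι] {J J' : ι → Type} [∀ i, Finite (J i)] [∀ i, Finite (J' i)]
    {A : (Σ i, J i) → M.Obj} {B : ι → M.Obj} {C : M.Obj} (e : ∀ i, J' i ≃ J i)
    (f : M.Hom B C) (g : ∀ i, M.Hom (fun j => A ⟨i, j⟩) (B i)),
    M.comp (A := fun p : (Σ i, J' i) => A ⟨p.1, e p.1 p.2⟩) f (fun i => M.act (e i) (g i)) =
      M.act (Equiv.sigmaCongrRight e) (M.comp f g)

namespace MulticategoryData

variable (M : MulticategoryData.{w, w₁})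

/-- The composite `u ∘ f` of a multimorphism `f` with a `1`-morphism `u`, its inputs being indexed
like those of `f`. -/
def postcomp {ι : Type} [Finite ι] {A : ι → M.Obj} {B B' : M.Obj}
    (u : M.Hom (fun _ : Unit => B) B') (f : M.Hom A B) : M.Hom A B' :=
  M.act (A := fun p : (Σ _ : Unit, ι) => A p.2) (unitSigma ι).symm
    (M.comp (A := fun p : (Σ _ : Unit, ι) => A p.2) u (fun _ => f))

end MulticategoryData

/-- The data of internal homs: objects `hom A B`, evaluation morphisms `A, hom A B ⟶ B`, and the
action `hom A B ⟶ hom (A ∘ e) B` of the bijections `e`. -/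
structure HomData (M : MulticategoryData.{w, w₁}) where
  hom : ∀ {ι : Type} [Finite ι], (ι → M.Obj) → M.Obj → M.Obj
  ev : ∀ {ι : Type} [Finite ι] (A : ι → M.Obj) (B : M.Obj),
    M.Hom (Sum.elim A (fun _ : Unit => hom A B)) B
  homAct : ∀ {ι ι' : Type} [Finite ι] [Finite ι'] (A : ι → M.Obj) (B : M.Obj) (e : ι' ≃ ι),
    M.Hom (fun _ : Unit => hom A B) (hom (fun i => A (e i)) B)

/-- The inputs of `ev ∘ (1, …, 1, f)`: one input for each `1`, and the inputs of `f`. -/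
def EvInputs (ι κ : Type) : ι ⊕ Unit → Type
  | Sum.inl _ => Unit
  | Sum.inr _ => κ

instance (ι κ : Type) [Finite κ] : ∀ s : ι ⊕ Unit, Finite (EvInputs ι κ s)
  | Sum.inl _ => inferInstanceAs (Finite Unit)
  | Sum.inr _ => inferInstanceAs (Finite κ)

/-- The inputs of `ev ∘ (1, …, 1, f)` are in bijection with `ι ⊕ κ`. -/
def evInputsEquiv (ι κ : Type) : (Σ s, EvInputs ι κ s) ≃ ι ⊕ κ where
  toFun
    | ⟨Sum.inl i, _⟩ => Sum.inl i
    | ⟨Sum.inr _, k⟩ => Sum.inr k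
  invFun
    | Sum.inl i => ⟨Sum.inl i, ()⟩
    | Sum.inr k => ⟨Sum.inr (), k⟩
  left_inv := by rintro ⟨_ | _, _⟩ <;> rfl
  right_inv := by rintro (_ | _) <;> rfl

/-- The composite `ev ∘ (1, …, 1, f)`, where `X` is the concatenation of the tuple `X ∘ inl` of
arguments of `ev` and of the tuple `X ∘ inr` of inputs of `f`. -/
def HomData.evComp {M : MulticategoryData.{w, w₁}} (H : HomData M) {ι κ : Type} [Finite ι]
    [Finite κ] (X : ι ⊕ κ → M.Obj) (B : M.Obj)
    (f : M.Hom (fun k => X (Sum.inr k)) (H.hom (fun i => X (Sum.inl i)) B)) :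
    M.Hom (fun p => X (evInputsEquiv ι κ p)) B :=
  M.comp (A := fun p => X (evInputsEquiv ι κ p)) (H.ev (fun i => X (Sum.inl i)) B) fun s =>
    match s with
    | Sum.inl i => M.one (X (Sum.inl i))
    | Sum.inr _ => f

/-- The internal homs `H` make the symmetric multicategory `M` closed. -/
structure IsClosedMulticategory (M : MulticategoryData.{w, w₁}) (H : HomData M) : Prop where
  symmetric : IsSymmetricMulticategory M
  /-- `homAct` is a right action. -/
  homAct_refl : ∀ {ι : Type} [Finite ι] (A : ι → M.Obj) (B : M.Obj),
    H.homAct A B (Equiv.refl ι) = M.one (H.hom A B)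
  homAct_homAct : ∀ {ι ι' ι'' : Type} [Finite ι] [Finite ι'] [Finite ι''] (A : ι → M.Obj)
    (B : M.Obj) (e : ι' ≃ ι) (e' : ι'' ≃ ι'),
    M.postcomp (H.homAct (fun i => A (e i)) B e') (H.homAct A B e) = H.homAct A B (e'.trans e)
  /-- Sending `f` to `ev ∘ (1, …, 1, f)` (with its inputs indexed by `ι ⊕ κ`) is a bijection `φ`,
  which is equivariant: `φ (e ∘ (f · t)) = (φ f) · (e × t)`. -/
  closed : ∃ φ : ∀ {ι κ : Type} [Finite ι] [Finite κ] (X : ι ⊕ κ → M.Obj) (B : M.Obj),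
      M.Hom (fun k => X (Sum.inr k)) (H.hom (fun i => X (Sum.inl i)) B) ≃ M.Hom X B,
    (∀ {ι κ : Type} [Finite ι] [Finite κ] (X : ι ⊕ κ → M.Obj) (B : M.Obj)
      (f : M.Hom (fun k => X (Sum.inr k)) (H.hom (fun i => X (Sum.inl i)) B)),
      M.act (evInputsEquiv ι κ) (φ X B f) = H.evComp X B f) ∧
    ∀ {ι ι' κ κ' : Type} [Finite ι] [Finite ι'] [Finite κ] [Finite κ'] (X : ι ⊕ κ → M.Obj)
      (B : M.Obj) (e : ι' ≃ ι) (t : κ' ≃ κ)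
      (f : M.Hom (fun k => X (Sum.inr k)) (H.hom (fun i => X (Sum.inl i)) B)),
      φ (fun s => X (Equiv.sumCongr e t s)) B
          (M.postcomp (H.homAct (fun i => X (Sum.inl i)) B e) (M.act t f)) =
        M.act (Equiv.sumCongr e t) (φ X B f)

/-! ### The multicategory of Waldhausen categories -/

/-- The identity of `C`, as a functor of one variable. -/
def idFunctor (C : WaldCat.{u}) : (∀ _ : Unit, C) ⥤ C :=
  Pi.eval (fun _ : Unit => C.carrier) ()

/-- The isomorphism of categories `∏ C (e j) ⥤ ∏ C i` sending the tuple `(X (e j))` to `(X i)`. -/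
def permute {ι ι' : Type} (C : ι → WaldCat.{u}) (e : ι' ≃ ι) :
    (∀ j, C (e j)) ⥤ (∀ i, C i) :=
  (Pi.equivalenceOfEquiv (fun i => (C i).carrier) e).functor

/-- `permute C e` inverts the reindexing functor `(X i) ↦ (X (e j))`. -/
theorem comap_permute {ι ι' : Type} (C : ι → WaldCat.{u}) (e : ι' ≃ ι) :
    Pi.comap (fun i => (C i).carrier) e ⋙ permute C e = 𝟭 _ := by
  refine Functor.pi_ext _ _ fun i => ?_
  have key : ∀ (i' : ι) (h : i' = i),
      Pi.eval (fun i => (C i).carrier) i' ⋙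
        (Pi.eqToEquivalence (fun i => (C i).carrier) h).functor =
      Pi.eval (fun i => (C i).carrier) i := by
    rintro _ rfl; rfl
  exact key (e (e.symm i)) (by simp)

/-- The functor `F` with permuted input variables. -/
def actFunctor {ι ι' : Type} {C : ι → WaldCat.{u}} {D : WaldCat.{u}} (e : ι' ≃ ι)
    (F : (∀ i, C i) ⥤ D) : (∀ j, C (e j)) ⥤ D :=
  permute C e ⋙ F

/-- The composite `F ∘ (∏ G i)`. -/
def compFunctor {ι : Type} {J : ι → Type} {A : (Σ i, J i) → WaldCat.{u}} {B : ι → WaldCat.{u}}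
    {D : WaldCat.{u}} (F : (∀ i, B i) ⥤ D) (G : ∀ i, (∀ j, A ⟨i, j⟩) ⥤ B i) :
    (∀ p, A p) ⥤ D :=
  Functor.pi' (fun i => Pi.comap (fun p => (A p).carrier) (Sigma.mk i) ⋙ G i) ⋙ F

/-- Identity functors are multiexact, and multiexact functors are stable under permutation of the
input variables and under composition. -/
structure MultiexactStable : Prop where
  id : ∀ C : WaldCat.{u}, IsMultiexact (fun _ : Unit => C) C (idFunctor C)
  act : ∀ {ι ι' : Type} [Finite ι] [Finite ι'] {C : ι → WaldCat.{u}} {D : WaldCat.{u}}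
    (e : ι' ≃ ι) (F : (∀ i, C i) ⥤ D), IsMultiexact C D F →
    IsMultiexact (fun j => C (e j)) D (actFunctor e F)
  comp : ∀ {ι : Type} [Finite ι] {J : ι → Type} [∀ i, Finite (J i)]
    {A : (Σ i, J i) → WaldCat.{u}} {B : ι → WaldCat.{u}} {D : WaldCat.{u}}
    (F : (∀ i, B i) ⥤ D) (G : ∀ i, (∀ j, A ⟨i, j⟩) ⥤ B i), IsMultiexact B D F →
    (∀ i, IsMultiexact (fun j => A ⟨i, j⟩) (B i) (G i)) →
    IsMultiexact A D (compFunctor F G)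

/-- Waldhausen categories and multiexact functors. -/
def waldMulti (h : MultiexactStable.{u}) : MulticategoryData.{u + 1, u} where
  Obj := WaldCat.{u}
  Hom C D := Multiexact C D
  act e F := ⟨actFunctor e F.obj, h.act e F.obj F.property⟩
  one C := ⟨idFunctor C, h.id C⟩
  comp F G := ⟨compFunctor F.obj (fun i => (G i).obj),
    h.comp F.obj (fun i => (G i).obj) F.property (fun i => (G i).property)⟩

/-- The internal hom `WaldCat(C; D)`, given that it is a Waldhausen category. -/
def internalHom {ι : Type} (C : ι → WaldCat.{u}) (D : WaldCat.{u})
    (hW : IsWaldhausen (Multiexact C D) homCof homWeq) : WaldCat.{u} where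
  carrier := Multiexact C D
  cof := homCof
  weq := homWeq
  isWaldhausen := hW

theorem map_comp_app {A : Type*} [Category* A] {B : Type*} [Category* B] {F G H : A ⥤ B}
    (α : F ⟶ G) (β : G ⟶ H) {X Y Z : A} (a : X ⟶ Y) (b : Y ⟶ Z) :
    F.map (a ≫ b) ≫ (α ≫ β).app Z = (F.map a ≫ α.app Y) ≫ G.map b ≫ β.app Z := by
  simp

/-- Evaluation `(X, F) ↦ F (X)`. -/
def evFunctor {ι : Type} (C : ι → WaldCat.{u}) (D : WaldCat.{u})
    (hW : IsWaldhausen (Multiexact C D) homCof homWeq) :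
    (∀ s : ι ⊕ Unit, (Sum.elim C (fun _ => internalHom C D hW) s : WaldCat.{u})) ⥤ D where
  obj X :=
    let F : Multiexact C D := X (Sum.inr ())
    let X' : ∀ i, C i := fun i => X (Sum.inl i)
    F.obj.obj X'
  map {X Y} f :=
    let F : Multiexact C D := X (Sum.inr ())
    let G : Multiexact C D := Y (Sum.inr ())
    let α : F ⟶ G := f (Sum.inr ())
    let X' : ∀ i, C i := fun i => X (Sum.inl i)
    let Y' : ∀ i, C i := fun i => Y (Sum.inl i)
    let a : X' ⟶ Y' := fun i => f (Sum.inl i)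
    F.obj.map a ≫ α.hom.app Y'
  map_id X :=
    let F : Multiexact C D := X (Sum.inr ())
    let X' : ∀ i, C i := fun i => X (Sum.inl i)
    (congrArg₂ (· ≫ ·) (F.obj.map_id X') rfl).trans (Category.comp_id _)
  map_comp {X Y Z} f g :=
    let F : Multiexact C D := X (Sum.inr ())
    let G : Multiexact C D := Y (Sum.inr ())
    let H : Multiexact C D := Z (Sum.inr ())
    let α : F ⟶ G := f (Sum.inr ())
    let β : G ⟶ H := g (Sum.inr ())
    let X' : ∀ i, C i := fun i => X (Sum.inl i)
    let Y' : ∀ i, C i := fun i => Y (Sum.inl i)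
    let Z' : ∀ i, C i := fun i => Z (Sum.inl i)
    let a : X' ⟶ Y' := fun i => f (Sum.inl i)
    let b : Y' ⟶ Z' := fun i => g (Sum.inl i)
    map_comp_app α.hom β.hom a b

/-- The functor `F ↦ F · e` on categories of multiexact functors. -/
def homActFunctor (h : MultiexactStable.{u}) {ι ι' : Type} [Finite ι] [Finite ι']
    (C : ι → WaldCat.{u}) (D : WaldCat.{u}) (e : ι' ≃ ι) :
    (∀ _ : Unit, Multiexact C D) ⥤ Multiexact (fun j => C (e j)) D where
  obj F := ⟨actFunctor e (F ()).obj, h.act e _ (F ()).property⟩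
  map α := ObjectProperty.homMk (Functor.whiskerLeft (permute C e) (α ()).hom)

/-- The composition functor `(F, (G i)) ↦ F ∘ (∏ G i)` on categories of multiexact functors. On
morphisms it is the horizontal composition of natural transformations. -/
def compositionFunctor (h : MultiexactStable.{u})
    (hW : ∀ {ι : Type} [Finite ι] (C : ι → WaldCat.{u}) (D : WaldCat.{u}),
      IsWaldhausen (Multiexact C D) homCof homWeq)
    {ι : Type} [Finite ι] {J : ι → Type} [∀ i, Finite (J i)]
    (A : (Σ i, J i) → WaldCat.{u}) (B : ι → WaldCat.{u}) (D : WaldCat.{u}) :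
    (∀ s : Unit ⊕ ι, (Sum.elim (fun _ => internalHom B D (hW B D))
      (fun i => internalHom (fun j => A ⟨i, j⟩) (B i) (hW _ _)) s : WaldCat.{u})) ⥤
      internalHom A D (hW A D) where
  obj X :=
    let F : Multiexact B D := X (Sum.inl ())
    let G : ∀ i, Multiexact (fun j => A ⟨i, j⟩) (B i) := fun i => X (Sum.inr i)
    (⟨compFunctor F.obj (fun i => (G i).obj),
      h.comp F.obj (fun i => (G i).obj) F.property (fun i => (G i).property)⟩ : Multiexact A D)
  map {X Y} f :=
    let F : Multiexact B D := X (Sum.inl ())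
    let F' : Multiexact B D := Y (Sum.inl ())
    let G : ∀ i, Multiexact (fun j => A ⟨i, j⟩) (B i) := fun i => X (Sum.inr i)
    let G' : ∀ i, Multiexact (fun j => A ⟨i, j⟩) (B i) := fun i => Y (Sum.inr i)
    let α : F ⟶ F' := f (Sum.inl ())
    let β : ∀ i, G i ⟶ G' i := fun i => f (Sum.inr i)
    ObjectProperty.homMk
      (NatTrans.pi' (fun i => Functor.whiskerLeft
        (Pi.comap (fun p => (A p).carrier) (Sigma.mk i)) (β i).hom) ◫ α.hom)
  map_id X := by
    let F : Multiexact B D := X (Sum.inl ())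
    refine ObjectProperty.hom_ext _ (NatTrans.ext (funext fun T => ?_))
    exact (congrArg₂ (· ≫ ·) rfl (F.obj.map_id _)).trans (Category.comp_id _)
  map_comp {X Y Z} f g := by
    let F : Multiexact B D := X (Sum.inl ())
    let F' : Multiexact B D := Y (Sum.inl ())
    let F'' : Multiexact B D := Z (Sum.inl ())
    let G : ∀ i, Multiexact (fun j => A ⟨i, j⟩) (B i) := fun i => X (Sum.inr i)
    let G' : ∀ i, Multiexact (fun j => A ⟨i, j⟩) (B i) := fun i => Y (Sum.inr i)
    let G'' : ∀ i, Multiexact (fun j => A ⟨i, j⟩) (B i) := fun i => Z (Sum.inr i)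
    let α : F ⟶ F' := f (Sum.inl ())
    let α' : F' ⟶ F'' := g (Sum.inl ())
    let β : ∀ i, G i ⟶ G' i := fun i => f (Sum.inr i)
    let β' : ∀ i, G' i ⟶ G'' i := fun i => g (Sum.inr i)
    let P : ∀ i, Multiexact (fun j => A ⟨i, j⟩) (B i) → ((∀ p, A p) ⥤ B i) := fun i K =>
      Pi.comap (fun p => (A p).carrier) (Sigma.mk i) ⋙ K.obj
    let γ : Functor.pi' (fun i => P i (G i)) ⟶ Functor.pi' (fun i => P i (G' i)) :=
      NatTrans.pi' (fun i => Functor.whiskerLeft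
        (Pi.comap (fun p => (A p).carrier) (Sigma.mk i)) (β i).hom)
    let γ' : Functor.pi' (fun i => P i (G' i)) ⟶ Functor.pi' (fun i => P i (G'' i)) :=
      NatTrans.pi' (fun i => Functor.whiskerLeft
        (Pi.comap (fun p => (A p).carrier) (Sigma.mk i)) (β' i).hom)
    refine ObjectProperty.hom_ext _ ?_
    change (γ ≫ γ') ◫ (α.hom ≫ α'.hom) = (γ ◫ α.hom) ≫ (γ' ◫ α'.hom)
    exact NatTrans.exchange γ γ' α.hom α'.hom

/-- The internal homs of `waldMulti h`. -/
def waldHom (h : MultiexactStable.{u})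
    (hW : ∀ {ι : Type} [Finite ι] (C : ι → WaldCat.{u}) (D : WaldCat.{u}),
      IsWaldhausen (Multiexact C D) homCof homWeq)
    (hev : ∀ {ι : Type} [Finite ι] (C : ι → WaldCat.{u}) (D : WaldCat.{u}),
      IsMultiexact _ D (evFunctor C D (hW C D)))
    (hact : ∀ {ι ι' : Type} [Finite ι] [Finite ι'] (C : ι → WaldCat.{u}) (D : WaldCat.{u})
      (e : ι' ≃ ι),
      IsMultiexact (fun _ : Unit => internalHom C D (hW C D)) (internalHom (fun j => C (e j)) D (hW _ D))
        (homActFunctor h C D e)) :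
    HomData (waldMulti h) where
  hom C D := internalHom C D (hW C D)
  ev C D := ⟨evFunctor C D (hW C D), hev C D⟩
  homAct C D e := ⟨homActFunctor h C D e, hact C D e⟩

end Waldhausen

end

open Waldhausen

/-!
A diagram on a finite poset is called Reedy here if all its southern arrows exist and are
cofibrations. If `b` is maximal in `T`, a colimit over `T` is the pushout of the southern arrow at
`b` along the map from the colimit over the elements below `b` to the colimit over `T \ {b}`.
Induction on `T` therefore gives, for a Reedy diagram, colimits over lower sets, cofibrations
between these colimits, and their preservation by every functor that preserves pushouts along
cofibrations. Consequently pointwise left Kan extensions of Reedy diagrams are Reedy.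

A cube is good if and only if all its faces are Reedy. A transformation of diagrams on `P` is a
diagram on the cylinder of `P`, and being a cofibration means that this diagram is Reedy. Pushouts
and compositions of such transformations reduce to those of diagrams, which makes the category of
multiexact functors a Waldhausen category with levelwise pushouts.

The essential point is that a multiexact `F` sends a tuple of Reedy diagrams on posets `P i` to a
Reedy diagram on `∏ P i`: a colimit over a product of lower sets is computed one variable at a
time, and the southern arrow at a tuple is that of a cube, obtained by applying `F` to the southern
arrows of the factors. This gives stability under composition. For evaluation and for currying, the
condition on `[f]` for a functor `K` into multiexact functors is translated into goodness of the
uncurried cube, so that `K` is multiexact if and only if its uncurrying is. The remaining assertions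
follow formally: the uncurrying of `F ↦ F · σ` is a permutation of `ev`, and that of composition is
`ev ∘ (ev, …, ev, 1)` with its inputs permuted.
-/

noncomputable section

namespace Waldhausen

section Cocones

variable {P : Type*} [Preorder P] {D : Type*} [Category* D]

theorem map_homOfLE_self (X : P ⥤ D) {p : P} (h : p ≤ p) : X.map (homOfLE h) = 𝟙 _ := X.map_id p

theorem map_homOfLE_comp (X : P ⥤ D) {p q r : P} (h : p ≤ q) (h' : q ≤ r) :
    X.map (homOfLE h) ≫ X.map (homOfLE h') = X.map (homOfLE (h.trans h')) :=
  (X.map_comp _ _).symm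

theorem map_homOfLE_comp_assoc (X : P ⥤ D) {p q r : P} (h : p ≤ q) (h' : q ≤ r) {Z : D}
    (f : X.obj r ⟶ Z) :
    X.map (homOfLE h) ≫ X.map (homOfLE h') ≫ f = X.map (homOfLE (h.trans h')) ≫ f := by
  rw [← Category.assoc, map_homOfLE_comp]

/-- A cocone with vertex `E` under the restriction of the diagram `X` to the set `S`. The vertex is
a parameter, so that cocones under different restrictions can be compared without equalities of
objects. -/
@[ext]
structure CoconeOn (X : P ⥤ D) (S : Set P) (E : D) where
  app : ∀ p ∈ S, (X.obj p ⟶ E)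
  map_app : ∀ {p q : P} (hp : p ∈ S) (hq : q ∈ S) (h : p ≤ q),
    X.map (homOfLE h) ≫ app q hq = app p hp

namespace CoconeOn

variable {X : P ⥤ D} {S T : Set P} {E E' E'' : D} {b : P}

theorem map_app_assoc (c : CoconeOn X S E) {p q : P} (hp : p ∈ S) (hq : q ∈ S) (h : p ≤ q)
    (t : E ⟶ E') : X.map (homOfLE h) ≫ c.app q hq ≫ t = c.app p hp ≫ t := by
  rw [← Category.assoc, c.map_app]

/-- The cocone obtained from `c` by composition with a morphism `t` out of its vertex. -/
@[simps]
def comp (c : CoconeOn X S E) (t : E ⟶ E') : CoconeOn X S E' where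
  app p hp := c.app p hp ≫ t
  map_app hp hq h := c.map_app_assoc hp hq h t

theorem comp_comp (c : CoconeOn X S E) (t : E ⟶ E') (t' : E' ⟶ E'') :
    (c.comp t).comp t' = c.comp (t ≫ t') := by
  ext p hp
  exact Category.assoc _ _ _

@[simp]
theorem comp_id (c : CoconeOn X S E) : c.comp (𝟙 E) = c := by
  ext p hp
  exact Category.comp_id _

/-- The restriction of a cocone to a smaller set. -/
@[simps]
def restrict (c : CoconeOn X T E) (h : S ⊆ T) : CoconeOn X S E where
  app p hp := c.app p (h hp)
  map_app _ _ := c.map_app _ _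

variable (X) in
/-- The structure maps of `X` as a cocone with vertex `X.obj b`, for an upper bound `b` of `S`. -/
@[simps]
def toObj (hb : b ∈ upperBounds S) : CoconeOn X S (X.obj b) where
  app _ hp := X.map (homOfLE (hb hp))
  map_app _ _ _ := map_homOfLE_comp _ _ _

/-- The image of a cocone under a functor. -/
@[simps]
def image {B : Type*} [Category* B] (c : CoconeOn X S E) (Φ : D ⥤ B) :
    CoconeOn (X ⋙ Φ) S (Φ.obj E) where
  app p hp := Φ.map (c.app p hp)
  map_app hp hq h := by
    rw [Functor.comp_map, ← Φ.map_comp, c.map_app]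

/-- The cocone `c` is a colimit of the restriction of `X` to `S`. -/
def IsUniversal (c : CoconeOn X S E) : Prop :=
  ∀ ⦃E' : D⦄ (d : CoconeOn X S E'), ∃! t : E ⟶ E', c.comp t = d

namespace IsUniversal

variable {c : CoconeOn X S E}

/-- The morphism to the vertex of another cocone `d` induced by a universal cocone. -/
def desc (hc : c.IsUniversal) (d : CoconeOn X S E') : E ⟶ E' := (hc d).choose

theorem comp_desc (hc : c.IsUniversal) (d : CoconeOn X S E') : c.comp (hc.desc d) = d :=
  (hc d).choose_spec.1

@[simp]
theorem app_desc (hc : c.IsUniversal) (d : CoconeOn X S E') {p : P} (hp : p ∈ S) :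
    c.app p hp ≫ hc.desc d = d.app p hp :=
  congrArg (fun e : CoconeOn X S E' => e.app p hp) (hc.comp_desc d)

@[simp]
theorem app_desc_assoc (hc : c.IsUniversal) (d : CoconeOn X S E') {p : P} (hp : p ∈ S)
    (t : E' ⟶ E'') : c.app p hp ≫ hc.desc d ≫ t = d.app p hp ≫ t := by
  rw [← Category.assoc, hc.app_desc]

theorem eq_of_comp_eq (hc : c.IsUniversal) {t t' : E ⟶ E'} (h : c.comp t = c.comp t') : t = t' :=
  (hc (c.comp t')).unique h rfl

theorem hom_ext (hc : c.IsUniversal) {t t' : E ⟶ E'}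
    (h : ∀ p hp, c.app p hp ≫ t = c.app p hp ≫ t') : t = t' :=
  hc.eq_of_comp_eq (CoconeOn.ext (funext₂ h))

theorem eq_desc (hc : c.IsUniversal) {d : CoconeOn X S E'} {t : E ⟶ E'} (h : c.comp t = d) :
    t = hc.desc d :=
  hc.eq_of_comp_eq (h.trans (hc.comp_desc d).symm)

theorem desc_comp (hc : c.IsUniversal) (d : CoconeOn X S E') (t : E' ⟶ E'') :
    hc.desc d ≫ t = hc.desc (d.comp t) :=
  hc.eq_desc (by rw [← comp_comp, comp_desc])

/-- Two colimits of the same diagram are isomorphic. -/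
@[simps]
def iso (hc : c.IsUniversal) {c' : CoconeOn X S E'} (hc' : c'.IsUniversal) : E ≅ E' where
  hom := hc.desc c'
  inv := hc'.desc c
  hom_inv_id := hc.hom_ext fun p hp => by simp
  inv_hom_id := hc'.hom_ext fun p hp => by simp

theorem comp_iso (hc : c.IsUniversal) (e : E ≅ E') : (c.comp e.hom).IsUniversal := fun E'' d =>
  ⟨e.inv ≫ hc.desc d, by simp only [comp_comp, Iso.hom_inv_id_assoc, comp_desc],
    fun t (ht : (c.comp e.hom).comp t = d) => by
      rw [comp_comp] at ht
      rw [← hc.eq_desc ht, Iso.inv_hom_id_assoc]⟩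

end IsUniversal

theorem isUniversal_toObj (hb : IsGreatest S b) : (toObj X hb.2).IsUniversal := fun E' d => by
  refine ⟨d.app b hb.1, CoconeOn.ext (funext₂ fun p hp => d.map_app hp hb.1 _), fun t ht => ?_⟩
  simp [← ht]

theorem isUniversal_of_isGreatest {c : CoconeOn X S E} (hb : IsGreatest S b)
    (h : IsIso (c.app b hb.1)) : c.IsUniversal := by
  have hcomp : c = (toObj X hb.2).comp (asIso (c.app b hb.1)).hom := by
    ext p hp
    exact (c.map_app hp hb.1 (hb.2 hp)).symm
  rw [hcomp]
  exact (isUniversal_toObj hb).comp_iso _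

theorem isUniversal_of_isZero (hE : IsZero E) (c : CoconeOn X ∅ E) : c.IsUniversal :=
  fun E' _ => ⟨hE.to_ E', CoconeOn.ext (funext₂ fun _ hp => hp.elim), fun _ _ => hE.eq_of_src _ _⟩

variable (X) in
/-- The unique cocone under the empty diagram. -/
def empty (E : D) : CoconeOn X ∅ E where
  app _ hp := hp.elim
  map_app hp := hp.elim

theorem isUniversal_restrict_iff_of_eq {c : CoconeOn X T E} (h : S = T) :
    (c.restrict h.subset).IsUniversal ↔ c.IsUniversal := by
  subst h
  rfl

theorem isUniversal_iff_of_bijective {Q : Type*} [Preorder Q] {W : Q ⥤ D} {U : Set Q}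
    (Φ : ∀ {E : D}, CoconeOn X S E → CoconeOn W U E)
    (hΦ : ∀ E, Function.Bijective (Φ : CoconeOn X S E → CoconeOn W U E))
    (Φ_comp : ∀ {E E' : D} (c : CoconeOn X S E) (t : E ⟶ E'), Φ (c.comp t) = (Φ c).comp t)
    {c : CoconeOn X S E} : (Φ c).IsUniversal ↔ c.IsUniversal := by
  constructor
  · intro h E' d
    obtain ⟨t, ht, huniq⟩ := h (Φ d)
    exact ⟨t, (hΦ E').1 ((Φ_comp c t).trans ht), fun t' ht' =>
      huniq t' ((Φ_comp c t').symm.trans (congrArg Φ ht'))⟩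
  · intro h E' d
    obtain ⟨d, rfl⟩ := (hΦ E').2 d
    obtain ⟨t, ht, huniq⟩ := h d
    exact ⟨t, (Φ_comp c t).symm.trans (congrArg Φ ht),
      fun t' ht' => huniq t' ((hΦ E').1 ((Φ_comp c t').trans ht'))⟩

theorem isUniversal_restrict_iff_of_isLeast {c : CoconeOn X T E} (hST : S ⊆ T)
    (h : ∀ x ∈ T, ∃ y, IsLeast (S ∩ Set.Ici x) y) :
    (c.restrict hST).IsUniversal ↔ c.IsUniversal := by
  refine isUniversal_iff_of_bijective (fun d => d.restrict hST) (fun E => ⟨fun d d' hdd' => ?_,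
    fun d => ?_⟩) fun _ _ => rfl
  · ext x hx
    obtain ⟨y, ⟨hy, hxy⟩, -⟩ := h x hx
    rw [← d.map_app hx (hST hy) hxy, ← d'.map_app hx (hST hy) hxy]
    exact congrArg (fun e : CoconeOn X S E => X.map (homOfLE hxy) ≫ e.app y hy) hdd'
  · choose y hy hy_le using h
    have hyS (x : P) (hx : x ∈ T) : y x hx ∈ S := (hy x hx).1
    have hxy (x : P) (hx : x ∈ T) : x ≤ y x hx := (hy x hx).2
    refine ⟨⟨fun x hx => X.map (homOfLE (hxy x hx)) ≫ d.app (y x hx) (hyS x hx),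
      fun {p q} hp hq hpq => ?_⟩, CoconeOn.ext (funext₂ fun x hx => d.map_app hx _ _)⟩
    have hyy : y p hp ≤ y q hq := hy_le p hp ⟨hyS q hq, hpq.trans (hxy q hq)⟩
    rw [map_homOfLE_comp_assoc, ← d.map_app (hyS p hp) (hyS q hq) hyy, map_homOfLE_comp_assoc]

end CoconeOn

end Cocones

section SouthernArrows

open Set

variable {P : Type*} [PartialOrder P] {D : Type*} [Category* D]
  {X : P ⥤ D} {S T : Set P} {b : P} {E : D}

theorem mem_upperBounds_inter_Iio : b ∈ upperBounds (T ∩ Iio b) := fun _ hp => hp.2.le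

variable (X T b) in
/-- The cocone with vertex `X.obj b` under the part of `X` strictly below `b` in `T`; the morphism
it induces from the colimit is the southern arrow of `X` at `b`, relative to `T`. -/
abbrev southernCocone : CoconeOn X (T ∩ Iio b) (X.obj b) :=
  CoconeOn.toObj X mem_upperBounds_inter_Iio

/-- The southern arrow of `X` at `b`, relative to `T`, exists and belongs to `cof`. -/
def CofAt (cof : MorphismProperty D) (X : P ⥤ D) (T : Set P) (b : P) : Prop :=
  ∃ (E : D) (c : CoconeOn X (T ∩ Iio b) E) (hc : c.IsUniversal),
    cof (hc.desc (southernCocone X T b))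

/-- Reedy cofibrancy of the restriction of `X` to `T`. -/
def Reedy (cof : MorphismProperty D) (X : P ⥤ D) (T : Set P) : Prop :=
  ∀ b ∈ T, CofAt cof X T b

/-- Goodness of a diagram on an arbitrary partial order: as for cubes, all the faces `[a, b]` have
a southern arrow in `cof`. -/
def Good (cof : MorphismProperty D) (X : P ⥤ D) : Prop :=
  ∀ a, Reedy cof X (Ici a)

variable {cof : MorphismProperty D}

theorem CofAt.congr (hST : S ∩ Iio b = T ∩ Iio b) (h : CofAt cof X S b) : CofAt cof X T b := by
  obtain ⟨E, c, hc, hcof⟩ := h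
  have hc' := (CoconeOn.isUniversal_restrict_iff_of_eq hST.symm).2 hc
  refine ⟨E, c.restrict hST.ge, hc', ?_⟩
  convert hcof using 1
  exact hc.eq_desc (CoconeOn.ext (funext₂ fun p hp => hc'.app_desc _ (hST.le hp)))

theorem inter_Iio_eq_of_isRelLowerSet (h : IsRelLowerSet S (· ∈ T)) (hb : b ∈ S) :
    T ∩ Iio b = S ∩ Iio b :=
  Set.ext fun _ => ⟨fun hx => ⟨(h hb).2 hx.2.le hx.1, hx.2⟩, fun hx => ⟨(h hx.1).1, hx.2⟩⟩

theorem Reedy.mono (h : Reedy cof X T) (hST : IsRelLowerSet S (· ∈ T)) : Reedy cof X S :=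
  fun b hb => (h b (hST hb).1).congr (inter_Iio_eq_of_isRelLowerSet hST hb)

theorem isRelLowerSet_inter_Iio (T : Set P) (b : P) : IsRelLowerSet (T ∩ Iio b) (· ∈ T) :=
  fun _ hx => ⟨hx.1, fun _ hyx hy => ⟨hy, hyx.trans_lt hx.2⟩⟩

theorem isRelLowerSet_inter_Iic (T : Set P) (b : P) : IsRelLowerSet (T ∩ Iic b) (· ∈ T) :=
  fun _ hx => ⟨hx.1, fun _ hyx hy => ⟨hy, hyx.trans hx.2⟩⟩

theorem isRelLowerSet_diff_singleton (hb : Maximal (· ∈ T) b) :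
    IsRelLowerSet (T \ {b}) (· ∈ T) :=
  fun _ hx => ⟨hx.1, fun _ hyx hy =>
    ⟨hy, fun hyb => hx.2 (hb.eq_of_ge hx.1 (hyb.symm.trans_le hyx))⟩⟩

theorem inter_Iio_subset_diff_singleton : T ∩ Iio b ⊆ T \ {b} := fun _ hp => ⟨hp.1, hp.2.ne⟩

end SouthernArrows

section MaximalElement

open Set

theorem isPushout_iff_existsUnique {D : Type*} [Category* D] {A B C Q : D} {f : A ⟶ B} {g : A ⟶ C}
    {h : B ⟶ Q} {k : C ⟶ Q} :
    IsPushout f g h k ↔ f ≫ h = g ≫ k ∧ ∀ ⦃Z : D⦄ (y : B ⟶ Z) (z : C ⟶ Z), f ≫ y = g ≫ z →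
      ∃! t : Q ⟶ Z, h ≫ t = y ∧ k ≫ t = z := by
  constructor
  · refine fun sq => ⟨sq.w, fun Z y z hyz => ⟨sq.desc y z hyz, by simp, fun t ht => ?_⟩⟩
    exact sq.hom_ext (by simp [ht.1]) (by simp [ht.2])
  · rintro ⟨w, huniv⟩
    refine ⟨⟨w⟩, ⟨PushoutCocone.IsColimit.mk _ (fun s => (huniv _ _ s.condition).choose)
      (fun s => (huniv _ _ s.condition).choose_spec.1.1)
      (fun s => (huniv _ _ s.condition).choose_spec.1.2)
      fun s t ht ht' => (huniv _ _ s.condition).choose_spec.2 t ⟨ht, ht'⟩⟩⟩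

namespace CoconeOn

variable {P : Type*} [PartialOrder P] {D : Type*} [Category* D]
  {X : P ⥤ D} {T : Set P} {b : P} (hb : Maximal (· ∈ T) b)

include hb in
theorem exists_app_eq_restrict_eq {Z : D} (y : X.obj b ⟶ Z) (e : CoconeOn X (T \ {b}) Z)
    (h : (southernCocone X T b).comp y = e.restrict inter_Iio_subset_diff_singleton) :
    ∃ d : CoconeOn X T Z, d.app b hb.1 = y ∧ d.restrict sdiff_subset = e := by
  classical
  have happ {p : P} (hp : p ∈ T) (hlt : p < b) :
      X.map (homOfLE hlt.le) ≫ y = e.app p ⟨hp, hlt.ne⟩ :=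
    congrArg (fun d : CoconeOn X (T ∩ Iio b) Z => d.app p ⟨hp, hlt⟩) h
  refine ⟨⟨fun p hp => if hpb : p ≤ b then X.map (homOfLE hpb) ≫ y else
    e.app p ⟨hp, fun h : p = b => hpb h.le⟩, fun {p q} hp hq hpq => ?_⟩, ?_, ?_⟩
  · by_cases hqb : q ≤ b
    · rw [dif_pos hqb, dif_pos (hpq.trans hqb), map_homOfLE_comp_assoc]
    · rw [dif_neg hqb]
      split_ifs with hpb
      · have hlt : p < b := hpb.lt_of_ne fun h => hqb (hb.2 hq (h.symm.trans_le hpq))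
        exact (e.map_app ⟨hp, hlt.ne⟩ ⟨hq, fun h : q = b => hqb h.le⟩ hpq).trans (happ hp hlt).symm
      · exact e.map_app _ _ _
  · simp
  · ext p hp
    by_cases hpb : p ≤ b
    · simp [hpb, happ hp.1 (hpb.lt_of_ne hp.2)]
    · simp [hpb]

variable {A E E' : D} {cA : CoconeOn X (T ∩ Iio b) A} (hA : cA.IsUniversal)
  {c' : CoconeOn X (T \ {b}) E'} (h' : c'.IsUniversal)

theorem southernArrow_comp_app (d : CoconeOn X T E) :
    hA.desc (southernCocone X T b) ≫ d.app b hb.1 =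
      hA.desc (c'.restrict inter_Iio_subset_diff_singleton) ≫
        h'.desc (d.restrict sdiff_subset) := by
  rw [hA.desc_comp, hA.desc_comp]
  congr 1
  ext p hp
  simp [d.map_app hp.1 hb.1]

include h' in
theorem comp_eq_iff_of_maximal {c : CoconeOn X T E} {k : E' ⟶ E}
    (hk : c'.comp k = c.restrict sdiff_subset) {Z : D} {d : CoconeOn X T Z} {t : E ⟶ Z} :
    c.comp t = d ↔ c.app b hb.1 ≫ t = d.app b hb.1 ∧ k ≫ t = h'.desc (d.restrict sdiff_subset) := by
  have hk' {p : P} (hp : p ∈ T \ {b}) : c'.app p hp ≫ k = c.app p hp.1 :=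
    congrArg (fun e : CoconeOn X (T \ {b}) E => e.app p hp) hk
  constructor
  · rintro rfl
    refine ⟨rfl, h'.eq_desc ?_⟩
    rw [← comp_comp, hk]
    rfl
  · rintro ⟨htop, hrest⟩
    ext p hp
    by_cases hpb : p = b
    · subst hpb
      exact htop
    · have hp' : p ∈ T \ {b} := ⟨hp, hpb⟩
      rw [comp_app, ← hk' hp', Category.assoc, hrest, h'.app_desc]
      rfl

include h' in
theorem isUniversal_iff_isPushout {c : CoconeOn X T E} {k : E' ⟶ E}
    (hk : c'.comp k = c.restrict sdiff_subset) :
    c.IsUniversal ↔ IsPushout (hA.desc (southernCocone X T b))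
      (hA.desc (c'.restrict inter_Iio_subset_diff_singleton)) (c.app b hb.1) k := by
  have hk_desc : k = h'.desc (c.restrict sdiff_subset) := h'.eq_desc hk
  rw [isPushout_iff_existsUnique]
  constructor
  · refine fun hc => ⟨hk_desc ▸ southernArrow_comp_app hb hA h' c, fun Z y z hyz => ?_⟩
    obtain ⟨d, rfl, hd⟩ := exists_app_eq_restrict_eq hb y (c'.comp z) (by
      rw [← hA.comp_desc (southernCocone X T b), comp_comp, hyz, ← comp_comp, hA.comp_desc]
      rfl)
    obtain rfl : z = h'.desc (d.restrict sdiff_subset) := h'.eq_desc hd.symm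
    simpa only [comp_eq_iff_of_maximal hb h' hk] using hc d
  · rintro ⟨-, huniv⟩ Z d
    simpa only [comp_eq_iff_of_maximal hb h' hk] using
      huniv _ _ (southernArrow_comp_app hb hA h' d)

end CoconeOn

end MaximalElement

section Waldhausen

open Set

variable {P : Type*} [PartialOrder P] {D : Type u} [Category.{v} D] {cof weq : MorphismProperty D}
  {X : P ⥤ D} {S T : Set P} {E E' : D}

theorem IsWaldhausen.cof_comp (hD : IsWaldhausen D cof weq) {A B C : D} {f : A ⟶ B} {g : B ⟶ C}
    (hf : cof f) (hg : cof g) : cof (f ≫ g) :=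
  haveI := hD.cof_multiplicative
  cof.comp_mem f g hf hg

theorem IsWaldhausen.weq_comp (hD : IsWaldhausen D cof weq) {A B C : D} {f : A ⟶ B} {g : B ⟶ C}
    (hf : weq f) (hg : weq g) : weq (f ≫ g) :=
  haveI := hD.weq_multiplicative
  weq.comp_mem f g hf hg

theorem IsWaldhausen.respectsIso_cof (hD : IsWaldhausen D cof weq) : cof.RespectsIso :=
  haveI := hD.cof_multiplicative
  MorphismProperty.respectsIso_of_isStableUnderComposition fun _ _ f hf => hD.cof_of_isIso f hf

theorem IsWaldhausen.cof_inr (hD : IsWaldhausen D cof weq) {A B C Q : D} {f : A ⟶ B} {g : A ⟶ C}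
    {h : B ⟶ Q} {k : C ⟶ Q} (sq : IsPushout f g h k) (hf : cof f) : cof k := by
  obtain ⟨Q', h', k', sq', hk'⟩ := hD.pushout f g hf
  have hk : k = k' ≫ (sq'.isoIsPushout _ _ sq).hom := by simp
  rw [hk]
  exact hD.cof_comp hk' (hD.cof_of_isIso _ inferInstance)

theorem exists_cof_extension [Finite P] (hD : IsWaldhausen D cof weq)
    (hST : IsRelLowerSet S (· ∈ T)) (hcof : ∀ b ∈ T \ S, CofAt cof X T b)
    {c : CoconeOn X S E} (hc : c.IsUniversal) :
    ∃ (E' : D) (c' : CoconeOn X T E') (t : E ⟶ E'), c'.IsUniversal ∧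
      c.comp t = c'.restrict (fun _ hx => (hST hx).1) ∧ cof t := by
  induction T using WellFoundedLT.induction with
  | ind T ih =>
  obtain hTS | hTS := (T \ S).eq_empty_or_nonempty
  · obtain rfl : S = T := (Subset.antisymm (fun _ hx => (hST hx).1) (sdiff_eq_empty.1 hTS))
    exact ⟨E, c, 𝟙 E, hc, c.comp_id, hD.cof_of_isIso _ inferInstance⟩
  obtain ⟨b, hb'⟩ := (toFinite (T \ S)).exists_maximal hTS
  have hb : Maximal (· ∈ T) b := ⟨hb'.1.1, fun x hx hbx =>
    hb'.2 ⟨hx, fun hxS => hb'.1.2 ((hST hxS).2 hbx hb'.1.1)⟩ hbx⟩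
  have hSb : S ⊆ T \ {b} := fun x hx => ⟨(hST hx).1, fun hxb => hb'.1.2 (hxb ▸ hx)⟩
  obtain ⟨E₁, c₁, t₁, hc₁, ht₁, hcof₁⟩ := ih (T \ {b}) (sdiff_singleton_ssubset.2 hb.1)
    (fun x hx => ⟨hSb hx, fun y hyx hy => (hST hx).2 hyx hy.1⟩)
    (fun x hx => (hcof x ⟨hx.1.1, hx.2⟩).congr
      (inter_Iio_eq_of_isRelLowerSet (isRelLowerSet_diff_singleton hb) hx.1))
  obtain ⟨A, cA, hA, hcofA⟩ := hcof b hb'.1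
  obtain ⟨Q, h, k, sq, hk⟩ := hD.pushout _
    (hA.desc (c₁.restrict inter_Iio_subset_diff_singleton)) hcofA
  obtain ⟨c', rfl, hc'⟩ := CoconeOn.exists_app_eq_restrict_eq hb h (c₁.comp k) (by
    rw [← hA.comp_desc (southernCocone X T b), CoconeOn.comp_comp, sq.w, ← CoconeOn.comp_comp,
      hA.comp_desc]
    rfl)
  refine ⟨Q, c', t₁ ≫ k, (CoconeOn.isUniversal_iff_isPushout hb hA hc₁ hc'.symm).2 sq, ?_,
    hD.cof_comp hcof₁ hk⟩
  rw [← CoconeOn.comp_comp, ht₁]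
  exact congrArg (CoconeOn.restrict · hSb) hc'.symm

theorem Reedy.exists_isUniversal [Finite P] (hD : IsWaldhausen D cof weq) (h : Reedy cof X T) :
    ∃ (E : D) (c : CoconeOn X T E), c.IsUniversal := by
  obtain ⟨Z, hZ⟩ := hD.hasZero.zero
  obtain ⟨E, c, -, hc, -⟩ := exists_cof_extension hD isRelLowerSet_empty (fun b hb => h b hb.1)
    (CoconeOn.isUniversal_of_isZero hZ (CoconeOn.empty X Z))
  exact ⟨E, c, hc⟩

theorem Reedy.cof_of_comp_eq_restrict [Finite P] (hD : IsWaldhausen D cof weq)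
    (h : Reedy cof X T) (hST : IsRelLowerSet S (· ∈ T)) {c : CoconeOn X S E} (hc : c.IsUniversal)
    {c' : CoconeOn X T E'} (hc' : c'.IsUniversal) {t : E ⟶ E'}
    (ht : c.comp t = c'.restrict (fun _ hx => (hST hx).1)) : cof t := by
  obtain ⟨E₁, c₁, t₁, hc₁, ht₁, hcof⟩ := exists_cof_extension hD hST (fun b hb => h b hb.1) hc
  have t_eq : t = t₁ ≫ (hc₁.iso hc').hom := hc.eq_of_comp_eq (by
    rw [ht, ← CoconeOn.comp_comp, ht₁, CoconeOn.IsUniversal.iso_hom]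
    conv_lhs => rw [← hc₁.comp_desc c']
    rfl)
  rw [t_eq]
  exact hD.cof_comp hcof (hD.cof_of_isIso _ inferInstance)

theorem Good.cof_map [Finite P] (hD : IsWaldhausen D cof weq) (h : Good cof X) {a b : P}
    (hab : a ≤ b) : cof (X.map (homOfLE hab)) := by
  have ha : IsRelLowerSet {a} (· ∈ Ici a ∩ Iic b) := by
    rintro _ rfl
    exact ⟨⟨le_rfl, hab⟩, fun y hya hy => le_antisymm hya hy.1⟩
  have hb : IsGreatest (Ici a ∩ Iic b) b := ⟨⟨hab, le_rfl⟩, fun _ hp => hp.2⟩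
  refine ((h a).mono (isRelLowerSet_inter_Iic _ b)).cof_of_comp_eq_restrict hD ha
    (CoconeOn.isUniversal_toObj isGreatest_singleton)
    (CoconeOn.isUniversal_toObj hb) ?_
  ext p hp
  exact map_homOfLE_comp _ _ _

/-- A functor that preserves zero objects and pushouts along cofibrations. -/
structure PreservesCof {B : Type*} [Category* B] (cof : MorphismProperty D) (Φ : D ⥤ B) : Prop where
  zero : ∀ Z, IsZero Z → IsZero (Φ.obj Z)
  pushout : ∀ {A A₁ A₂ A₃ : D} (f : A ⟶ A₁) (g : A ⟶ A₂) (h : A₁ ⟶ A₃) (k : A₂ ⟶ A₃),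
    IsPushout f g h k → cof f → IsPushout (Φ.map f) (Φ.map g) (Φ.map h) (Φ.map k)

theorem PreservesCof.map_desc {B : Type*} [Category* B] {Φ : D ⥤ B} {c : CoconeOn X T E}
    (hc : c.IsUniversal) (hΦc : (c.image Φ).IsUniversal) (d : CoconeOn X T E') :
    Φ.map (hc.desc d) = hΦc.desc (d.image Φ) :=
  hΦc.eq_desc (CoconeOn.ext (funext₂ fun p hp => by
    rw [CoconeOn.comp_app, CoconeOn.image_app, ← Φ.map_comp, hc.app_desc]
    rfl))

theorem PreservesCof.isUniversal_image {B : Type*} [Category* B] [Finite P] {Φ : D ⥤ B}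
    (hΦ : PreservesCof cof Φ) (hD : IsWaldhausen D cof weq) (hT : Reedy cof X T)
    {c : CoconeOn X T E} (hc : c.IsUniversal) : (c.image Φ).IsUniversal := by
  induction T using WellFoundedLT.induction generalizing E with
  | ind T ih =>
  obtain rfl | hTne := T.eq_empty_or_nonempty
  · obtain ⟨Z, hZ⟩ := hD.hasZero.zero
    have e : Z ≅ E := (CoconeOn.isUniversal_of_isZero hZ (CoconeOn.empty X Z)).iso hc
    exact CoconeOn.isUniversal_of_isZero (hΦ.zero E (hZ.of_iso e.symm)) _
  obtain ⟨b, hb⟩ := (toFinite T).exists_maximal hTne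
  have hlow := isRelLowerSet_diff_singleton hb
  obtain ⟨A, cA, hA, hcofA⟩ := hT b hb.1
  obtain ⟨E₁, c₁, hc₁⟩ := (hT.mono hlow).exists_isUniversal hD
  have hΦA := ih (T ∩ Iio b) (inter_Iio_subset_diff_singleton.trans_ssubset
    (sdiff_singleton_ssubset.2 hb.1)) (hT.mono (isRelLowerSet_inter_Iio T b)) hA
  have hΦc₁ := ih (T \ {b}) (sdiff_singleton_ssubset.2 hb.1) (hT.mono hlow) hc₁
  have sq := hΦ.pushout _ _ _ _
    ((CoconeOn.isUniversal_iff_isPushout hb hA hc₁ (hc₁.comp_desc _)).1 hc) hcofA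
  rw [PreservesCof.map_desc hA hΦA, PreservesCof.map_desc hA hΦA, PreservesCof.map_desc hc₁ hΦc₁]
    at sq
  exact (CoconeOn.isUniversal_iff_isPushout hb hΦA hΦc₁ (hΦc₁.comp_desc _)).2 sq

end Waldhausen

section KanExtension

open Set

/-- A morphism of diagrams `Y ⟶ W` over a monotone map `m` of the indexing posets, that is, a
natural transformation `Y ⟶ W ∘ m`. -/
structure HomOver {P Q : Type*} [Preorder P] [Preorder Q] {D : Type*} [Category* D] (m : P →o Q)
    (Y : P ⥤ D) (W : Q ⥤ D) where
  app : ∀ p, Y.obj p ⟶ W.obj (m p)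
  naturality : ∀ {p q : P} (h : p ≤ q),
    Y.map (homOfLE h) ≫ app q = app p ≫ W.map (homOfLE (m.monotone h))

variable {P Q : Type*} [PartialOrder P] [PartialOrder Q] {D : Type u} [Category.{v} D]
  {Y : P ⥤ D} {W : Q ⥤ D} {m : P →o Q} (η : HomOver m Y W)
  {T : Set P} {U V : Set Q} {E E' : D}

/-- The pullback of a cocone along a morphism of diagrams. -/
@[simps]
def CoconeOn.pullback (d : CoconeOn W U E) (hTU : MapsTo m T U) : CoconeOn Y T E where
  app p hp := η.app p ≫ d.app (m p) (hTU hp)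
  map_app hp hq h := by
    rw [← Category.assoc, η.naturality, Category.assoc, d.map_app]

/-- The cocone with vertex `W.obj q` under the part of `Y` that lies in `T` and over `q`. -/
def kanCocone (T : Set P) (q : Q) : CoconeOn Y (T ∩ m ⁻¹' Iic q) (W.obj q) :=
  (CoconeOn.toObj W isGreatest_Iic.2).pullback η fun _ hp => hp.2

theorem kanCocone_app {q : Q} {p : P} (hp : p ∈ T ∩ m ⁻¹' Iic q) (hpq : m p ≤ q) :
    (kanCocone η T q).app p hp = η.app p ≫ W.map (homOfLE hpq) := rfl

theorem isRelLowerSet_inter_preimage_Iic (T : Set P) (q : Q) :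
    IsRelLowerSet (T ∩ m ⁻¹' Iic q) (· ∈ T) :=
  fun _ hx => ⟨hx.1, fun _ hyx hy => ⟨hy, (m.monotone hyx).trans hx.2⟩⟩

/-- On `U`, the diagram `W` is the pointwise left Kan extension along `m` of the restriction of `Y`
to `T`. -/
structure IsKan (T : Set P) (U : Set Q) : Prop where
  mapsTo : MapsTo m T U
  isUniversal : ∀ q ∈ U, (kanCocone η T q).IsUniversal

namespace IsKan

variable {η}

theorem of_isGreatest (mapsTo : MapsTo m T U)
    (h : ∀ q ∈ U, ∃ (r : P) (_ : IsGreatest (T ∩ m ⁻¹' Iic q) r) (hr : m r ≤ q),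
      IsIso (η.app r ≫ W.map (homOfLE hr))) : IsKan η T U where
  mapsTo := mapsTo
  isUniversal q hq := by
    obtain ⟨r, hr, _, hiso⟩ := h q hq
    exact CoconeOn.isUniversal_of_isGreatest hr hiso

theorem comp_map_kanCocone {q q' : Q} (h : q ≤ q') :
    (kanCocone η T q).comp (W.map (homOfLE h)) =
      (kanCocone η T q').restrict fun _ hp => ⟨hp.1, le_trans hp.2 h⟩ := by
  ext p hp
  exact (Category.assoc _ _ _).trans (congrArg (η.app p ≫ ·) (map_homOfLE_comp _ _ _))

theorem comp_kanCocone_app (d : CoconeOn W U E) (hTU : MapsTo m T U) {q : Q} (hq : q ∈ U) :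
    (kanCocone η T q).comp (d.app q hq) = (d.pullback η hTU).restrict inter_subset_left := by
  ext p hp
  exact (Category.assoc _ _ _).trans (congrArg (η.app p ≫ ·) (d.map_app (hTU hp.1) hq hp.2))

theorem bijective_pullback (h : IsKan η T U) (E : D) :
    Function.Bijective fun d : CoconeOn W U E => d.pullback η h.mapsTo := by
  constructor
  · intro d d' hdd'
    ext q hq
    refine (h.isUniversal q hq).eq_of_comp_eq ?_
    rw [comp_kanCocone_app d h.mapsTo, comp_kanCocone_app d' h.mapsTo]
    exact congrArg (CoconeOn.restrict · inter_subset_left) hdd'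
  · intro c
    refine ⟨⟨fun q hq => (h.isUniversal q hq).desc (c.restrict inter_subset_left),
      fun {q q'} hq hq' hqq' => (h.isUniversal q hq).eq_desc ?_⟩, ?_⟩
    · rw [← CoconeOn.comp_comp, comp_map_kanCocone hqq']
      ext p hp
      exact (h.isUniversal q' hq').app_desc _ ⟨hp.1, le_trans hp.2 hqq'⟩
    · ext p hp
      have hp' : p ∈ T ∩ m ⁻¹' Iic (m p) := ⟨hp, le_rfl⟩
      have happ := (h.isUniversal (m p) (h.mapsTo hp)).app_desc (c.restrict inter_subset_left) hp'
      rwa [kanCocone_app η hp' le_rfl, map_homOfLE_self, Category.comp_id] at happ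

theorem isUniversal_pullback_iff (h : IsKan η T U) {d : CoconeOn W U E} :
    (d.pullback η h.mapsTo).IsUniversal ↔ d.IsUniversal :=
  CoconeOn.isUniversal_iff_of_bijective (fun d => d.pullback η h.mapsTo) h.bijective_pullback
    fun _ _ => CoconeOn.ext (funext₂ fun _ _ => (Category.assoc _ _ _).symm)

theorem exists_isUniversal_of_pullback (h : IsKan η T U) {c : CoconeOn Y T E}
    (hc : c.IsUniversal) : ∃ d : CoconeOn W U E, d.IsUniversal ∧ d.pullback η h.mapsTo = c := by
  obtain ⟨d, rfl⟩ := (h.bijective_pullback E).2 c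
  exact ⟨d, h.isUniversal_pullback_iff.1 hc, rfl⟩

theorem restrict (h : IsKan η T U) (hV : IsRelLowerSet V (· ∈ U)) :
    IsKan η (T ∩ m ⁻¹' V) V where
  mapsTo _ hx := hx.2
  isUniversal q hq := by
    have hset : T ∩ m ⁻¹' V ∩ m ⁻¹' Iic q = T ∩ m ⁻¹' Iic q := Set.ext fun x =>
      ⟨fun hx => ⟨hx.1.1, hx.2⟩, fun hx => ⟨⟨hx.1, (hV hq).2 hx.2 (h.mapsTo hx.1)⟩, hx.2⟩⟩
    exact (CoconeOn.isUniversal_restrict_iff_of_eq hset).2 (h.isUniversal q (hV hq).1)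

theorem reedy {cof weq : MorphismProperty D} [Finite P] (hD : IsWaldhausen D cof weq)
    (h : IsKan η T U) (hY : Reedy cof Y T) : Reedy cof W U := by
  -- The southern arrow of `W` at `b` is the morphism between the colimits of `Y` over the lower
  -- sets `{x ∈ T | m x < b} ⊆ {x ∈ T | m x ≤ b}`.
  intro b hb
  have hlt : IsRelLowerSet (T ∩ m ⁻¹' (U ∩ Iio b)) (· ∈ T) := fun x hx =>
    ⟨hx.1, fun y hyx hy => ⟨hy, h.mapsTo hy, (m.monotone hyx).trans_lt hx.2.2⟩⟩
  obtain ⟨E, c, hc⟩ := (hY.mono hlt).exists_isUniversal hD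
  obtain ⟨d, hd, rfl⟩ :=
    (h.restrict (isRelLowerSet_inter_Iio U b)).exists_isUniversal_of_pullback hc
  refine ⟨E, d, hd, (hY.mono (isRelLowerSet_inter_preimage_Iic T b)).cof_of_comp_eq_restrict hD
    (fun x hx => ⟨⟨hx.1, le_of_lt hx.2.2⟩, fun y hyx hy => (hlt hx).2 hyx hy.1⟩) hc
    (h.isUniversal b hb) ?_⟩
  ext p hp
  exact (Category.assoc _ _ _).trans (congrArg (η.app p ≫ ·) (hd.app_desc _ hp.2))

theorem cofAt_iff {cof weq : MorphismProperty D} (hD : IsWaldhausen D cof weq) {b : P}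
    [IsIso (η.app b)] (h : IsKan η (T ∩ Iio b) (U ∩ Iio (m b))) :
    CofAt cof W U (m b) ↔ CofAt cof Y T b := by
  have := hD.respectsIso_cof
  have southernArrow_comp {E : D} {d : CoconeOn W (U ∩ Iio (m b)) E} (hd : d.IsUniversal)
      (hd' : (d.pullback η h.mapsTo).IsUniversal) :
      hd'.desc (southernCocone Y T b) ≫ η.app b = hd.desc (southernCocone W U (m b)) := by
    refine hd'.hom_ext fun p hp => ?_
    rw [hd'.app_desc_assoc, CoconeOn.pullback_app, Category.assoc, hd.app_desc]
    exact η.naturality _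
  constructor
  · rintro ⟨E, d, hd, hcof⟩
    refine ⟨E, _, h.isUniversal_pullback_iff.2 hd, ?_⟩
    rwa [← southernArrow_comp hd, cof.cancel_right_of_respectsIso] at hcof
  · rintro ⟨E, c, hc, hcof⟩
    obtain ⟨d, hd, rfl⟩ := h.exists_isUniversal_of_pullback hc
    refine ⟨E, d, hd, ?_⟩
    rwa [← southernArrow_comp hd hc, cof.cancel_right_of_respectsIso]

end IsKan

section Embedding

variable {cof weq : MorphismProperty D} {b : P} (hm : ∀ ⦃x y⦄, m x ≤ m y → x ≤ y)

include hm in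
theorem image_inter_Iio_eq (T : Set P) (b : P) : m '' T ∩ Iio (m b) = m '' (T ∩ Iio b) := by
  ext q
  constructor
  · rintro ⟨⟨x, hx, rfl⟩, hxb⟩
    exact ⟨x, ⟨hx, lt_of_le_not_ge (hm hxb.le) fun h => hxb.not_ge (m.monotone h)⟩, rfl⟩
  · rintro ⟨x, hx, rfl⟩
    exact ⟨⟨x, hx.1, rfl⟩, (m.monotone hx.2.le).lt_of_not_ge fun h => hx.2.not_ge (hm h)⟩

include hm in
theorem Ici_inter_Iio_eq_image (hord : (range m).OrdConnected) (a b : P) :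
    Ici (m a) ∩ Iio (m b) = m '' (Ici a ∩ Iio b) := by
  rw [← image_inter_Iio_eq hm]
  ext q
  refine and_congr_left fun hqb => ⟨fun haq => ?_, ?_⟩
  · obtain ⟨x, rfl⟩ := hord.out (mem_range_self a) (mem_range_self b) ⟨haq, le_of_lt hqb⟩
    exact ⟨x, hm haq, rfl⟩
  · rintro ⟨x, hx, rfl⟩
    exact m.monotone hx

variable [∀ p, IsIso (η.app p)]

include η hm

theorem isKan_of_isIso (S : Set P) : IsKan η S (m '' S) := by
  refine .of_isGreatest (mapsTo_image m S) ?_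
  rintro _ ⟨x, hx, rfl⟩
  refine ⟨x, ⟨⟨hx, le_rfl⟩, fun y hy => hm hy.2⟩, le_rfl, ?_⟩
  rw [map_homOfLE_self, Category.comp_id]
  infer_instance

theorem cofAt_iff_of_isIso (hD : IsWaldhausen D cof weq)
    (hTU : U ∩ Iio (m b) = m '' (T ∩ Iio b)) : CofAt cof W U (m b) ↔ CofAt cof Y T b :=
  IsKan.cofAt_iff hD (hTU ▸ isKan_of_isIso η hm (T ∩ Iio b))

theorem reedy_image_iff_of_isIso (hD : IsWaldhausen D cof weq) :
    Reedy cof W (m '' T) ↔ Reedy cof Y T := by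
  rw [Reedy, forall_mem_image]
  exact forall₂_congr fun b _ => cofAt_iff_of_isIso η hm hD (image_inter_Iio_eq hm T b)

theorem Good.of_isIso (hD : IsWaldhausen D cof weq) (hord : (range m).OrdConnected)
    (h : Good cof W) : Good cof Y := fun a b hab =>
  (cofAt_iff_of_isIso η hm hD (Ici_inter_Iio_eq_image hm hord a b)).1
    (h (m a) (m b) (m.monotone hab))

theorem good_iff_of_isIso (hD : IsWaldhausen D cof weq) (hsurj : Function.Surjective m) :
    Good cof W ↔ Good cof Y := by
  have hord : (range m).OrdConnected := hsurj.range_eq ▸ ordConnected_univ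
  refine ⟨Good.of_isIso η hm hD hord, fun h => ?_⟩
  exact hsurj.forall.2 fun a => hsurj.forall.2 fun b hab =>
    (cofAt_iff_of_isIso η hm hD (Ici_inter_Iio_eq_image hm hord a b)).2 (h a b (hm hab))

end Embedding

end KanExtension

section Cubes

open Set

variable {ι : Type} {D : Type u} [Category.{v} D] {cof : MorphismProperty D} {X : Cube ι D}
  {a b : Vertex ι}

/-- A cocone under a punctured face of a cube, as a cocone under the restriction of the cube. -/
def CoconeOn.ofCocone (c : Cocone (puncturedFace X a b)) :
    CoconeOn X (Ici a ∩ Iio b) c.pt where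
  app p hp := c.ι.app ⟨p, hp⟩
  map_app hp hq h := c.w (j := ⟨_, hq⟩) (j' := ⟨_, hp⟩) (homOfLE h)

/-- The inverse of `CoconeOn.ofCocone`. -/
def CoconeOn.toCocone {E : D} (c : CoconeOn X (Ici a ∩ Iio b) E) :
    Cocone (puncturedFace X a b) where
  pt := E
  ι :=
    { app := fun p => c.app p p.2
      naturality := fun p q f =>
        (c.map_app p.2 q.2 (leOfHom f)).trans (Category.comp_id _).symm }

theorem CoconeOn.isUniversal_ofCocone {c : Cocone (puncturedFace X a b)} (hc : IsColimit c) :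
    (ofCocone c).IsUniversal := fun _ d =>
  ⟨hc.desc d.toCocone, CoconeOn.ext (funext₂ fun p hp => hc.fac d.toCocone ⟨p, hp⟩),
    fun _ ht => hc.uniq d.toCocone _ fun p =>
      congrArg (fun e : CoconeOn X (Ici a ∩ Iio b) _ => e.app p p.2) ht⟩

/-- A universal cocone as a colimit cocone under a punctured face. -/
def CoconeOn.IsUniversal.isColimit {E : D} {c : CoconeOn X (Ici a ∩ Iio b) E}
    (hc : c.IsUniversal) : IsColimit c.toCocone where
  desc s := hc.desc (ofCocone s)
  fac s p := hc.app_desc (ofCocone s) p.2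
  uniq s _ ht := hc.eq_desc (d := ofCocone s) (CoconeOn.ext (funext₂ fun p hp => ht ⟨p, hp⟩))

theorem southernArrowMem_iff : SouthernArrowMem cof X a b ↔ CofAt cof X (Ici a) b := by
  constructor
  · rintro ⟨c, hc, hcof⟩
    refine ⟨c.pt, .ofCocone c, CoconeOn.isUniversal_ofCocone hc, ?_⟩
    rwa [← (CoconeOn.isUniversal_ofCocone hc).eq_desc (d := southernCocone X (Ici a) b)
      (CoconeOn.ext (funext₂ fun p hp => hc.fac (terminalCocone X a b) ⟨p, hp⟩))]
  · rintro ⟨E, c, hc, hcof⟩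
    exact ⟨c.toCocone, hc.isColimit, hcof⟩

theorem isGood_iff : IsGood cof X ↔ Good cof X :=
  forall₂_congr fun _ _ => imp_congr_right fun _ => southernArrowMem_iff

end Cubes

section Cylinders

open Set

/-- The cylinder on `P`, the product of `P` with the arrow `0 → 1`. It indexes the morphisms between
two diagrams indexed by `P`. -/
inductive Cyl (P : Type*) : Type _
  | lo : P → Cyl P
  | hi : P → Cyl P

namespace Cyl

variable {P : Type*} [PartialOrder P]

/-- The order of the cylinder. -/
protected def le : Cyl P → Cyl P → Prop
  | lo x, lo y => x ≤ y
  | lo x, hi y => x ≤ y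
  | hi _, lo _ => False
  | hi x, hi y => x ≤ y

instance : PartialOrder (Cyl P) where
  le := Cyl.le
  le_refl := by rintro (x | x) <;> exact le_refl x
  le_trans := by
    rintro (x | x) (y | y) (z | z) h h'
    all_goals first | exact h.elim | exact h'.elim | exact le_trans (α := P) h h'
  le_antisymm := by
    rintro (x | x) (y | y) h h'
    all_goals first | exact h.elim | exact h'.elim | exact congrArg _ (le_antisymm (α := P) h h')

@[simp] theorem lo_le_lo {x y : P} : lo x ≤ lo y ↔ x ≤ y := Iff.rfl
@[simp] theorem lo_le_hi {x y : P} : lo x ≤ hi y ↔ x ≤ y := Iff.rfl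
@[simp] theorem hi_le_hi {x y : P} : hi x ≤ hi y ↔ x ≤ y := Iff.rfl
@[simp] theorem not_hi_le_lo {x y : P} : ¬ hi x ≤ lo y := fun h => h
@[simp] theorem hi_lt_hi {x y : P} : hi x < hi y ↔ x < y := by simp [lt_iff_le_not_ge]
@[simp] theorem lo_lt_hi {x y : P} : lo x < hi y ↔ x ≤ y := by simp [lt_iff_le_not_ge]

instance [Finite P] : Finite (Cyl P) :=
  Finite.of_surjective (Sum.elim lo hi) fun
    | lo x => ⟨Sum.inl x, rfl⟩
    | hi x => ⟨Sum.inr x, rfl⟩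

/-- The inclusion of the bottom of the cylinder. -/
def loHom : P →o Cyl P := ⟨lo, fun _ _ h => h⟩

/-- The inclusion of the top of the cylinder. -/
def hiHom : P →o Cyl P := ⟨hi, fun _ _ h => h⟩

/-- The projection of the cylinder onto its top. -/
def toHi : Cyl P →o Cyl P where
  toFun
    | lo x => hi x
    | hi x => hi x
  monotone' := by
    rintro (x | x) (y | y) h
    all_goals first | exact h.elim | exact h

theorem le_toHi : ∀ q : Cyl P, q ≤ toHi q
  | lo x => le_refl x
  | hi x => le_refl x

theorem ordConnected_range_loHom : (range (loHom : P →o Cyl P)).OrdConnected := by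
  refine ⟨?_⟩
  rintro _ ⟨x, rfl⟩ _ ⟨y, rfl⟩ (z | z) ⟨-, hz⟩
  · exact ⟨z, rfl⟩
  · exact (not_hi_le_lo hz).elim

theorem ordConnected_range_hiHom : (range (hiHom : P →o Cyl P)).OrdConnected := by
  refine ⟨?_⟩
  rintro _ ⟨x, rfl⟩ _ ⟨y, rfl⟩ (z | z) ⟨hz, -⟩
  · exact (not_hi_le_lo hz).elim
  · exact ⟨z, rfl⟩

end Cyl

open Cyl

variable {P : Type*} [PartialOrder P] {D : Type u} [Category.{v} D] {X Y Z X' Y' : P ⥤ D}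

/-- The objects of the diagram on the cylinder given by `X` and `Y`. -/
def cylObj (X Y : P ⥤ D) : Cyl P → D
  | lo x => X.obj x
  | hi x => Y.obj x

/-- The morphisms of the diagram on the cylinder given by `α : X ⟶ Y`. -/
def cylMap (α : X ⟶ Y) : ∀ q q' : Cyl P, q ≤ q' → (cylObj X Y q ⟶ cylObj X Y q')
  | lo _, lo _, h => X.map (homOfLE (lo_le_lo.1 h))
  | lo x, hi _, h => α.app x ≫ Y.map (homOfLE (lo_le_hi.1 h))
  | hi _, hi _, h => Y.map (homOfLE (hi_le_hi.1 h))
  | hi _, lo _, h => (not_hi_le_lo h).elim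

/-- The diagram on the cylinder given by `α : X ⟶ Y`. -/
def cyl (α : X ⟶ Y) : Cyl P ⥤ D where
  obj := cylObj X Y
  map {q q'} f := cylMap α q q' (leOfHom f)
  map_id
    | lo x => X.map_id x
    | hi x => Y.map_id x
  map_comp {q q' q''} f g := by
    have hf := leOfHom f
    have hg := leOfHom g
    rcases q with x | x <;> rcases q' with y | y <;> rcases q'' with z | z
    all_goals first
      | exact hf.elim
      | exact hg.elim
      | skip
    · exact (map_homOfLE_comp X _ _).symm
    · change _ = X.map _ ≫ α.app y ≫ Y.map _
      rw [← Category.assoc, α.naturality, Category.assoc, map_homOfLE_comp]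
      rfl
    · change _ = (α.app x ≫ Y.map _) ≫ Y.map _
      rw [Category.assoc, map_homOfLE_comp]
      rfl
    · exact (map_homOfLE_comp Y _ _).symm

variable {α : X ⟶ Y}

theorem cyl_map_lo_hi_self (x : P) :
    (cyl α).map (homOfLE (lo_le_hi.2 (le_refl x))) = α.app x :=
  (congrArg (α.app x ≫ ·) (map_homOfLE_self Y _)).trans (Category.comp_id _)

/-- The morphism of cylinder diagrams given by a commutative square. -/
def cylHom {β : X' ⟶ Y'} (f : X ⟶ X') (g : Y ⟶ Y') (w : α ≫ g = f ≫ β) : cyl α ⟶ cyl β where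
  app
    | lo x => f.app x
    | hi x => g.app x
  naturality := by
    have w' (x : P) : α.app x ≫ g.app x = f.app x ≫ β.app x := NatTrans.congr_app w x
    rintro (x | x) (y | y) h
    · exact f.naturality _
    · change (α.app x ≫ Y.map _) ≫ g.app y = f.app x ≫ β.app x ≫ Y'.map _
      rw [Category.assoc, g.naturality, ← Category.assoc, w', Category.assoc]
    · exact (not_hi_le_lo (leOfHom h)).elim
    · exact g.naturality _

variable (α) in
/-- The inclusion of `X` at the bottom of `cyl α`. -/
def homOverLo : HomOver loHom X (cyl α) where
  app x := 𝟙 (X.obj x)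
  naturality _ := (Category.comp_id _).trans (Category.id_comp _).symm

variable (α) in
/-- The inclusion of `Y` at the top of `cyl α`. -/
def homOverHi : HomOver hiHom Y (cyl α) where
  app x := 𝟙 (Y.obj x)
  naturality _ := (Category.comp_id _).trans (Category.id_comp _).symm

instance (x : P) : IsIso ((homOverLo α).app x) := inferInstanceAs (IsIso (𝟙 (X.obj x)))

instance (x : P) : IsIso ((homOverHi α).app x) := inferInstanceAs (IsIso (𝟙 (Y.obj x)))

variable (α) in
/-- The projection of `cyl α` onto its top. -/
def homOverToHi : HomOver toHi (cyl α) (cyl α) where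
  app q := (cyl α).map (homOfLE (le_toHi q))
  naturality _ := (map_homOfLE_comp _ _ _).trans (map_homOfLE_comp _ _ _).symm

/-- A transformation of diagrams is a cofibration if the diagram it defines on the cylinder
is good. -/
def CofTrans (cof : MorphismProperty D) (α : X ⟶ Y) : Prop := Good cof (cyl α)

variable {cof weq : MorphismProperty D}

theorem cofAt_lo_iff [Finite P] (hD : IsWaldhausen D cof weq) {a b : P} :
    CofAt cof (cyl α) (Ici (lo a)) (lo b) ↔ CofAt cof X (Ici a) b :=
  cofAt_iff_of_isIso (homOverLo α) (fun _ _ h => h) hD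
    (Ici_inter_Iio_eq_image (fun _ _ h => h) ordConnected_range_loHom a b)

theorem CofTrans.source [Finite P] (hD : IsWaldhausen D cof weq) (h : CofTrans cof α) :
    Good cof X :=
  Good.of_isIso (homOverLo α) (fun _ _ h => h) hD ordConnected_range_loHom h

theorem CofTrans.target [Finite P] (hD : IsWaldhausen D cof weq) (h : CofTrans cof α) :
    Good cof Y :=
  Good.of_isIso (homOverHi α) (fun _ _ h => h) hD ordConnected_range_hiHom h

theorem CofTrans.cof_app [Finite P] (hD : IsWaldhausen D cof weq) (h : CofTrans cof α) (x : P) :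
    cof (α.app x) := by
  have hcof := Good.cof_map hD h (lo_le_hi.2 (le_refl x))
  rwa [cyl_map_lo_hi_self] at hcof

theorem reedy_Ici_hi [Finite P] (hD : IsWaldhausen D cof weq) {a : P}
    (h : Reedy cof (cyl α) (Ici (lo a))) : Reedy cof (cyl α) (Ici (hi a)) := by
  refine (IsKan.of_isGreatest (η := homOverToHi α) (T := Ici (lo a)) ?_ ?_).reedy hD h
  · rintro (x | x) (hx : a ≤ x)
    · exact hx
    · exact hx
  · rintro (x | x) hx
    · exact absurd (mem_Ici.1 hx) not_hi_le_lo
    · refine ⟨hi x, ⟨⟨hx, le_refl x⟩, ?_⟩, le_refl x, ?_⟩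
      · rintro (y | y) ⟨-, hy⟩ <;> exact hy
      · exact inferInstanceAs (IsIso ((cyl α).map (𝟙 (hi x)) ≫ (cyl α).map (𝟙 (hi x))))

theorem CofTrans.of_reedy [Finite P] (hD : IsWaldhausen D cof weq)
    (h : ∀ a, Reedy cof (cyl α) (Ici (lo a))) : CofTrans cof α
  | lo a => h a
  | hi a => reedy_Ici_hi hD (h a)

theorem CofTrans.of_isIso [Finite P] (hD : IsWaldhausen D cof weq) (hα : ∀ p, IsIso (α.app p))
    (hX : Good cof X) : CofTrans cof α := by
  refine CofTrans.of_reedy hD fun a =>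
    (IsKan.of_isGreatest (η := homOverLo α) (fun _ hx => hx) ?_).reedy hD (hX a)
  rintro (x | x) hx
  · exact ⟨x, ⟨⟨hx, le_refl x⟩, fun y hy => hy.2⟩, le_refl x,
      inferInstanceAs (IsIso (𝟙 (X.obj x) ≫ X.map (𝟙 x)))⟩
  · exact ⟨x, ⟨⟨hx, le_refl x⟩, fun y hy => hy.2⟩, lo_le_hi.2 (le_refl x),
      inferInstanceAs (IsIso (𝟙 (X.obj x) ≫ α.app x ≫ Y.map (𝟙 x)))⟩

theorem CofTrans.of_isZero [Finite P] (hD : IsWaldhausen D cof weq) (hX : ∀ p, IsZero (X.obj p))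
    (hY : Good cof Y) : CofTrans cof α := by
  refine CofTrans.of_reedy hD fun a =>
    IsKan.reedy (η := homOverHi α) hD ⟨fun _ hx => hx, ?_⟩ (hY a)
  rintro (x | x) hx
  · have hempty : Ici a ∩ hiHom ⁻¹' Iic (lo x) = ∅ :=
      eq_empty_of_forall_notMem fun y (hy : a ≤ y ∧ hi y ≤ lo x) => not_hi_le_lo hy.2
    exact (CoconeOn.isUniversal_restrict_iff_of_eq hempty.symm).1
      (CoconeOn.isUniversal_of_isZero (hX x) _)
  · exact CoconeOn.isUniversal_of_isGreatest ⟨⟨hx, le_refl x⟩, fun y hy => hy.2⟩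
      (inferInstanceAs (IsIso (𝟙 (Y.obj x) ≫ Y.map (𝟙 x))))

namespace CoconeOn

variable {S : Set P} {E E' : D} {a b : P}

/-- The cocone obtained from `c` by precomposition with a morphism of diagrams. -/
@[simps]
def precomp (c : CoconeOn Y S E) (α : X ⟶ Y) : CoconeOn X S E where
  app p hp := α.app p ≫ c.app p hp
  map_app hp hq h := by rw [← Category.assoc, α.naturality, Category.assoc, c.map_app]

/-- The component at `lo b` of a cocone under the face of `cyl α` between `lo a` and `hi b`, with
its last vertex removed. Together with `CoconeOn.upper`, it determines the cocone. -/
def lower (hab : a ≤ b) (c : CoconeOn (cyl α) (Ici (lo a) ∩ Iio (hi b)) E) : X.obj b ⟶ E :=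
  c.app (lo b) ⟨hab, lo_lt_hi.2 le_rfl⟩

/-- The restriction to `Y` of a cocone under the face of `cyl α` between `lo a` and `hi b`, with its
last vertex removed. -/
def upper (c : CoconeOn (cyl α) (Ici (lo a) ∩ Iio (hi b)) E) : CoconeOn Y (Ici a ∩ Iio b) E where
  app x hx := c.app (hi x) ⟨hx.1, hi_lt_hi.2 hx.2⟩
  map_app {x y} hx hy h :=
    c.map_app (p := hi x) (q := hi y) ⟨hx.1, hi_lt_hi.2 hx.2⟩ ⟨hy.1, hi_lt_hi.2 hy.2⟩ h

variable {c d : CoconeOn (cyl α) (Ici (lo a) ∩ Iio (hi b)) E} (hab : a ≤ b)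

theorem map_lower {x : P} (hx : x ∈ Ici a ∩ Iio b) :
    X.map (homOfLE hx.2.le) ≫ c.lower hab = α.app x ≫ c.upper.app x hx := by
  have hlo : lo x ∈ Ici (lo a) ∩ Iio (hi b) := ⟨hx.1, lo_lt_hi.2 hx.2.le⟩
  rw [← cyl_map_lo_hi_self]
  exact (c.map_app (q := lo b) hlo _ hx.2.le).trans
    (c.map_app (q := hi x) hlo _ (le_refl x)).symm

theorem map_lower_assoc {x : P} (hx : x ∈ Ici a ∩ Iio b) (t : E ⟶ E') :
    X.map (homOfLE hx.2.le) ≫ c.lower hab ≫ t = α.app x ≫ c.upper.app x hx ≫ t := by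
  rw [← Category.assoc, map_lower, Category.assoc]

theorem ext_lower_upper (hlo : c.lower hab = d.lower hab) (hhi : c.upper = d.upper) : c = d := by
  ext (x | x) hx
  · have hxb : lo x ≤ lo b := lo_lt_hi.1 hx.2
    rw [← c.map_app hx ⟨hab, lo_lt_hi.2 le_rfl⟩ hxb, ← d.map_app hx ⟨hab, lo_lt_hi.2 le_rfl⟩ hxb]
    exact congrArg (X.map (homOfLE hxb) ≫ ·) hlo
  · exact congrArg (fun e : CoconeOn Y (Ici a ∩ Iio b) E => e.app x ⟨hx.1, hi_lt_hi.1 hx.2⟩) hhi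

theorem exists_lower_eq_upper_eq (u : X.obj b ⟶ E) (v : CoconeOn Y (Ici a ∩ Iio b) E)
    (w : ∀ x (hx : x ∈ Ici a ∩ Iio b), X.map (homOfLE hx.2.le) ≫ u = α.app x ≫ v.app x hx) :
    ∃ c : CoconeOn (cyl α) (Ici (lo a) ∩ Iio (hi b)) E, c.lower hab = u ∧ c.upper = v := by
  refine ⟨⟨fun
    | lo _, hq => X.map (homOfLE (lo_lt_hi.1 hq.2)) ≫ u
    | hi x, hq => v.app x ⟨hq.1, hi_lt_hi.1 hq.2⟩, ?_⟩, ?_, rfl⟩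
  · rintro (p | p) (q | q) hp hq hpq
    · exact map_homOfLE_comp_assoc X _ _ _
    · have hqb : q ∈ Ici a ∩ Iio b := ⟨hq.1, hi_lt_hi.1 hq.2⟩
      have hpq' : p ≤ q := hpq
      change (α.app p ≫ Y.map (homOfLE hpq')) ≫ v.app q hqb = X.map _ ≫ u
      rw [← α.naturality, Category.assoc, ← w q hqb, map_homOfLE_comp_assoc]
    · exact (not_hi_le_lo hpq).elim
    · exact v.map_app _ _ _
  · exact (congrArg (· ≫ u) (map_homOfLE_self X _)).trans (Category.id_comp _)

@[simp]
theorem lower_precomp {β : X' ⟶ Y'} (c : CoconeOn (cyl β) (Ici (lo a) ∩ Iio (hi b)) E)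
    (f : X ⟶ X') (g : Y ⟶ Y') (w : α ≫ g = f ≫ β) :
    (c.precomp (cylHom f g w)).lower hab = f.app b ≫ c.lower hab := rfl

@[simp]
theorem upper_precomp_app {β : X' ⟶ Y'} (c : CoconeOn (cyl β) (Ici (lo a) ∩ Iio (hi b)) E)
    (f : X ⟶ X') (g : Y ⟶ Y') (w : α ≫ g = f ≫ β) {x : P} (hx : x ∈ Ici a ∩ Iio b) :
    (c.precomp (cylHom f g w)).upper.app x hx = g.app x ≫ c.upper.app x hx := rfl

@[simp]
theorem IsUniversal.lower_desc (hc : c.IsUniversal)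
    (e : CoconeOn (cyl α) (Ici (lo a) ∩ Iio (hi b)) E') :
    c.lower hab ≫ hc.desc e = e.lower hab :=
  hc.app_desc e _

@[simp]
theorem IsUniversal.lower_desc_assoc (hc : c.IsUniversal)
    (e : CoconeOn (cyl α) (Ici (lo a) ∩ Iio (hi b)) E') {T : D} (t : E' ⟶ T) :
    c.lower hab ≫ hc.desc e ≫ t = e.lower hab ≫ t :=
  hc.app_desc_assoc e _ t

@[simp]
theorem IsUniversal.upper_app_desc (hc : c.IsUniversal)
    (e : CoconeOn (cyl α) (Ici (lo a) ∩ Iio (hi b)) E') {x : P} (hx : x ∈ Ici a ∩ Iio b) :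
    c.upper.app x hx ≫ hc.desc e = e.upper.app x hx :=
  hc.app_desc (p := hi x) e _

@[simp]
theorem IsUniversal.upper_app_desc_assoc (hc : c.IsUniversal)
    (e : CoconeOn (cyl α) (Ici (lo a) ∩ Iio (hi b)) E') {x : P} (hx : x ∈ Ici a ∩ Iio b) {T : D}
    (t : E' ⟶ T) : c.upper.app x hx ≫ hc.desc e ≫ t = e.upper.app x hx ≫ t :=
  hc.app_desc_assoc (p := hi x) e _ t

/-- The southern arrow of the face of `cyl α` between `lo a` and `hi b`. -/
def IsUniversal.southernArrow (hc : c.IsUniversal) : E ⟶ Y.obj b :=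
  hc.desc (southernCocone (cyl α) (Ici (lo a)) (hi b))

@[simp]
theorem IsUniversal.lower_southernArrow (hc : c.IsUniversal) :
    c.lower hab ≫ hc.southernArrow = α.app b :=
  (hc.app_desc _ _).trans (cyl_map_lo_hi_self b)

@[simp]
theorem IsUniversal.lower_southernArrow_assoc (hc : c.IsUniversal) {T : D} (t : Y.obj b ⟶ T) :
    c.lower hab ≫ hc.southernArrow ≫ t = α.app b ≫ t := by
  rw [← Category.assoc, hc.lower_southernArrow]

@[simp]
theorem IsUniversal.upper_app_southernArrow (hc : c.IsUniversal) {x : P}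
    (hx : x ∈ Ici a ∩ Iio b) :
    c.upper.app x hx ≫ hc.southernArrow = Y.map (homOfLE hx.2.le) :=
  hc.app_desc (p := hi x) _ _

@[simp]
theorem IsUniversal.upper_app_southernArrow_assoc (hc : c.IsUniversal) {x : P}
    (hx : x ∈ Ici a ∩ Iio b) {T : D} (t : Y.obj b ⟶ T) :
    c.upper.app x hx ≫ hc.southernArrow ≫ t = Y.map (homOfLE hx.2.le) ≫ t := by
  rw [← Category.assoc, hc.upper_app_southernArrow]

theorem IsUniversal.hom_ext_lower_upper (hc : c.IsUniversal) {t t' : E ⟶ E'}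
    (hlo : c.lower hab ≫ t = c.lower hab ≫ t')
    (hhi : ∀ x hx, c.upper.app x hx ≫ t = c.upper.app x hx ≫ t') : t = t' :=
  hc.eq_of_comp_eq (ext_lower_upper hab hlo (CoconeOn.ext (funext₂ hhi)))

end CoconeOn

/-- By induction on the upper vertex, only the southern arrows of the faces of `cyl α` that lie
neither in `X` nor in `Y` matter, and their sources may be assumed to exist. -/
theorem CofTrans.of_mixed [Finite P] (hD : IsWaldhausen D cof weq) (hX : Good cof X)
    (h : ∀ ⦃a b⦄, a ≤ b → ∀ ⦃E⦄ ⦃c : CoconeOn (cyl α) (Ici (lo a) ∩ Iio (hi b)) E⦄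
      (hc : c.IsUniversal), cof hc.southernArrow) :
    CofTrans cof α := by
  refine CofTrans.of_reedy hD fun a => ?_
  have hlo (b) (hab : a ≤ b) : CofAt cof (cyl α) (Ici (lo a)) (lo b) :=
    (cofAt_lo_iff hD).2 (hX a b hab)
  have hhi (b) (hab : a ≤ b) : CofAt cof (cyl α) (Ici (lo a)) (hi b) := by
    induction b using WellFoundedLT.induction with
    | ind b ih =>
      have hreedy : Reedy cof (cyl α) (Ici (lo a) ∩ Iio (hi b)) := by
        rintro (x | x) hx
        · exact (hlo x hx.1).congr
            (inter_Iio_eq_of_isRelLowerSet (isRelLowerSet_inter_Iio _ _) hx)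
        · exact (ih x (hi_lt_hi.1 hx.2) hx.1).congr
            (inter_Iio_eq_of_isRelLowerSet (isRelLowerSet_inter_Iio _ _) hx)
      obtain ⟨E, c, hc⟩ := hreedy.exists_isUniversal hD
      exact ⟨E, c, hc, h hab hc⟩
  rintro (x | x) hx
  · exact hlo x hx
  · exact hhi x hx

theorem isPushout_desc_cyl_comp {β : Y ⟶ Z} {a b : P} (hab : a ≤ b) {A B C : D}
    {cA : CoconeOn (cyl α) (Ici (lo a) ∩ Iio (hi b)) A} (hA : cA.IsUniversal)
    {cB : CoconeOn (cyl (α ≫ β)) (Ici (lo a) ∩ Iio (hi b)) B} (hB : cB.IsUniversal)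
    {cC : CoconeOn (cyl β) (Ici (lo a) ∩ Iio (hi b)) C} (hC : cC.IsUniversal) :
    IsPushout hA.southernArrow
      (hA.desc (cB.precomp (cylHom (𝟙 X) β (Category.id_comp _).symm)))
      (cC.lower hab)
      (hB.desc (cC.precomp (cylHom α (𝟙 Z) (Category.comp_id _)))) := by
  refine isPushout_iff_existsUnique.2 ⟨hA.hom_ext_lower_upper hab ?_ ?_, fun T y z hyz => ?_⟩
  · simp
  · intro x hx
    simp [CoconeOn.map_lower hab hx]
  · have hlower : α.app b ≫ y = cB.lower hab ≫ z := by
      simpa using congrArg (cA.lower hab ≫ ·) hyz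
    have hupper (x) (hx : x ∈ Ici a ∩ Iio b) :
        Y.map (homOfLE hx.2.le) ≫ y = β.app x ≫ cB.upper.app x hx ≫ z := by
      simpa using congrArg (cA.upper.app x hx ≫ ·) hyz
    obtain ⟨d, rfl, hd⟩ := CoconeOn.exists_lower_eq_upper_eq hab y (cB.upper.comp z) hupper
    have hd' (x) (hx : x ∈ Ici a ∩ Iio b) : d.upper.app x hx = cB.upper.app x hx ≫ z := by
      rw [hd, CoconeOn.comp_app]
    refine ⟨hC.desc d, ⟨hC.lower_desc hab d, hB.hom_ext_lower_upper hab ?_ ?_⟩, ?_⟩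
    · simp [hlower]
    · intro x hx
      simp [hd']
    · rintro t ⟨ht, rfl⟩
      refine hC.hom_ext_lower_upper hab (by simp [ht]) fun x hx => ?_
      simp [hd']

theorem CofTrans.comp [Finite P] (hD : IsWaldhausen D cof weq) {β : Y ⟶ Z} (hα : CofTrans cof α)
    (hβ : CofTrans cof β) : CofTrans cof (α ≫ β) := by
  refine CofTrans.of_mixed hD (hα.source hD) fun a b hab B cB hB => ?_
  obtain ⟨A, cA, hA, hsα⟩ := hα (lo a) (hi b) hab
  obtain ⟨C, cC, hC, hsβ⟩ := hβ (lo a) (hi b) hab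
  have hfac : hB.southernArrow =
      hB.desc (cC.precomp (cylHom α (𝟙 Z) (Category.comp_id _))) ≫
        hC.southernArrow :=
    hB.hom_ext_lower_upper hab (by simp) (by simp)
  rw [hfac]
  exact hD.cof_comp (hD.cof_inr (isPushout_desc_cyl_comp hab hA hB hC) hsα) hsβ

theorem isPushout_desc_cyl_of_isPushout {Q : P ⥤ D} {γ : X ⟶ Z} {h : Y ⟶ Q} {k : Z ⟶ Q}
    (w : α ≫ h = γ ≫ k) (sq : ∀ p, IsPushout (α.app p) (γ.app p) (h.app p) (k.app p))
    {a b : P} (hab : a ≤ b) {A B : D}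
    {cA : CoconeOn (cyl α) (Ici (lo a) ∩ Iio (hi b)) A} (hA : cA.IsUniversal)
    {cB : CoconeOn (cyl k) (Ici (lo a) ∩ Iio (hi b)) B} (hB : cB.IsUniversal) :
    IsPushout hA.southernArrow
      (hA.desc (cB.precomp (cylHom γ h w))) (h.app b)
      hB.southernArrow := by
  refine isPushout_iff_existsUnique.2 ⟨hA.hom_ext_lower_upper hab ?_ ?_, fun T y z hyz => ?_⟩
  · simp [(sq b).w]
  · simp
  · have hlower : α.app b ≫ y = γ.app b ≫ cB.lower hab ≫ z := by
      simpa using congrArg (cA.lower hab ≫ ·) hyz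
    have hupper (x) (hx : x ∈ Ici a ∩ Iio b) :
        Y.map (homOfLE hx.2.le) ≫ y = h.app x ≫ cB.upper.app x hx ≫ z := by
      simpa using congrArg (cA.upper.app x hx ≫ ·) hyz
    refine ⟨(sq b).desc y _ hlower, ⟨(sq b).inl_desc _ _ _, ?_⟩, ?_⟩
    · refine hB.hom_ext_lower_upper hab (by simp) fun x hx => (sq x).hom_ext ?_ ?_
      · simpa [← h.naturality_assoc] using hupper x hx
      · simp [← k.naturality_assoc, CoconeOn.map_lower_assoc hab hx]
    · rintro t ⟨rfl, rfl⟩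
      exact (sq b).hom_ext (by simp) (by simp)

theorem CofTrans.of_isPushout [Finite P] (hD : IsWaldhausen D cof weq) {Q : P ⥤ D} {γ : X ⟶ Z}
    {h : Y ⟶ Q} {k : Z ⟶ Q} (sq : ∀ p, IsPushout (α.app p) (γ.app p) (h.app p) (k.app p))
    (hα : CofTrans cof α) (hZ : Good cof Z) : CofTrans cof k := by
  refine CofTrans.of_mixed hD hZ fun a b hab B cB hB => ?_
  obtain ⟨A, cA, hA, hs⟩ := hα (lo a) (hi b) hab
  have w : α ≫ h = γ ≫ k := NatTrans.ext (funext fun p => (sq p).w)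
  exact hD.cof_inr (isPushout_desc_cyl_of_isPushout w sq hab hA hB) hs

end Cylinders

section ArrowCubes

open Cyl

variable {ι : Type} {D : Type u} [Category.{v} D] {cof weq : MorphismProperty D}

instance [Finite ι] : Finite (Vertex ι) := inferInstanceAs (Finite (ι → Fin 2))

/-- The identification of the cylinder on `I^ι` with `I^(ι ⊕ Unit)`. -/
def cylVertexHom (ι : Type) : Cyl (Vertex ι) →o Vertex (ι ⊕ Unit) where
  toFun
    | lo x => Sum.elim x fun _ => 0
    | hi x => Sum.elim x fun _ => 1
  monotone' := by
    rintro (x | x) (y | y) h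
    · exact Sum.rec h fun _ => le_rfl
    · exact Sum.rec h fun _ => zero_le_one (α := Fin 2)
    · exact (not_hi_le_lo h).elim
    · exact Sum.rec h fun _ => le_rfl

theorem le_of_cylVertexHom_le ⦃x y : Cyl (Vertex ι)⦄ (h : cylVertexHom ι x ≤ cylVertexHom ι y) :
    x ≤ y := by
  rcases x with x | x <;> rcases y with y | y
  · exact fun i => h (Sum.inl i)
  · exact fun i => h (Sum.inl i)
  · exact absurd (h (Sum.inr ())) (show ¬ (1 : Fin 2) ≤ 0 by decide)
  · exact fun i => h (Sum.inl i)

theorem cylVertexHom_surjective : Function.Surjective (cylVertexHom ι) := fun q =>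
  match h : q (Sum.inr ()) with
  | 0 => ⟨lo fun i => q (Sum.inl i), funext (Sum.rec (fun _ => rfl) fun _ => h.symm)⟩
  | 1 => ⟨hi fun i => q (Sum.inl i), funext (Sum.rec (fun _ => rfl) fun _ => h.symm)⟩

/-- The diagrams `cyl α` and `arrowCube α` have the same values. -/
def homOverArrowCube {X Y : Cube ι D} (α : X ⟶ Y) :
    HomOver (cylVertexHom ι) (cyl α) (arrowCube α) where
  app
    | lo x => 𝟙 (X.obj x)
    | hi x => 𝟙 (Y.obj x)
  naturality {p q} h := by
    rcases p with x | x <;> rcases q with y | y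
    · exact (Category.comp_id _).trans ((Category.id_comp _).trans (Category.id_comp _)).symm
    · exact (Category.comp_id _).trans (Category.id_comp _).symm
    · exact (not_hi_le_lo h).elim
    · exact (Category.comp_id _).trans ((Category.id_comp _).trans (Category.id_comp _)).symm

instance {X Y : Cube ι D} (α : X ⟶ Y) : ∀ p, IsIso ((homOverArrowCube α).app p)
  | lo x => inferInstanceAs (IsIso (𝟙 (X.obj x)))
  | hi x => inferInstanceAs (IsIso (𝟙 (Y.obj x)))

theorem isGood_arrowCube_iff [Finite ι] (hD : IsWaldhausen D cof weq) {X Y : Cube ι D}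
    (α : X ⟶ Y) : IsGood cof (arrowCube α) ↔ CofTrans cof α :=
  isGood_iff.trans
    (good_iff_of_isIso (homOverArrowCube α) le_of_cylVertexHom_le hD cylVertexHom_surjective)

end ArrowCubes

section LevelwisePushouts

variable {A B : Type*} [Category* A] [Category* B] {F G H K : A ⥤ B}

theorem isZero_of_isPushout {X Y Z W : A} {f : X ⟶ Y} {g : X ⟶ Z} {h : Y ⟶ W} {k : Z ⟶ W}
    (sq : IsPushout f g h k) (hX : IsZero X) (hY : IsZero Y) (hZ : IsZero Z) : IsZero W :=
  haveI := hX.isIso hY f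
  haveI := sq.isIso_inr_of_isIso
  hZ.of_iso (asIso k).symm

theorem exists_functor_isPushout_app (f : F ⟶ G) (g : F ⟶ H)
    (hex : ∀ X, ∃ (Q : B) (h : G.obj X ⟶ Q) (k : H.obj X ⟶ Q), IsPushout (f.app X) (g.app X) h k) :
    ∃ (K : A ⥤ B) (h : G ⟶ K) (k : H ⟶ K),
      ∀ X, IsPushout (f.app X) (g.app X) (h.app X) (k.app X) := by
  choose Q h k sq using hex
  have w {X Y : A} (m : X ⟶ Y) : f.app X ≫ G.map m ≫ h Y = g.app X ≫ H.map m ≫ k Y := by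
    rw [← f.naturality_assoc, (sq Y).w, g.naturality_assoc]
  exact ⟨{ obj := Q
           map := fun {X Y} m => (sq X).desc (G.map m ≫ h Y) (H.map m ≫ k Y) (w m)
           map_id := fun X => (sq X).hom_ext (by simp) (by simp)
           map_comp := fun {X Y Z} m n => (sq X).hom_ext (by simp) (by simp) },
    { app := h, naturality := fun X Y m => ((sq X).inl_desc _ _ _).symm },
    { app := k, naturality := fun X Y m => ((sq X).inr_desc _ _ _).symm }, sq⟩

theorem isPushout_map_of_isPushout_app {f : F ⟶ G} {g : F ⟶ H} {h : G ⟶ K} {k : H ⟶ K}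
    (sq : ∀ X, IsPushout (f.app X) (g.app X) (h.app X) (k.app X)) {X Y Z W : A}
    {a : X ⟶ Y} {b : X ⟶ Z} {c : Y ⟶ W} {d : Z ⟶ W}
    (hF : IsPushout (F.map a) (F.map b) (F.map c) (F.map d))
    (hG : IsPushout (G.map a) (G.map b) (G.map c) (G.map d))
    (hH : IsPushout (H.map a) (H.map b) (H.map c) (H.map d)) :
    IsPushout (K.map a) (K.map b) (K.map c) (K.map d) := by
  refine isPushout_iff_existsUnique.2 ⟨(sq X).hom_ext ?_ ?_, fun T y z hyz => ?_⟩
  · rw [← h.naturality_assoc, ← h.naturality_assoc, ← h.naturality, ← h.naturality, hG.w_assoc]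
  · rw [← k.naturality_assoc, ← k.naturality_assoc, ← k.naturality, ← k.naturality, hH.w_assoc]
  have hGyz : G.map a ≫ h.app Y ≫ y = G.map b ≫ h.app Z ≫ z := by
    rw [h.naturality_assoc, hyz, h.naturality_assoc]
  have hHyz : H.map a ≫ k.app Y ≫ y = H.map b ≫ k.app Z ≫ z := by
    rw [k.naturality_assoc, hyz, k.naturality_assoc]
  have hfg : f.app W ≫ hG.desc _ _ hGyz = g.app W ≫ hH.desc _ _ hHyz := by
    refine hF.hom_ext ?_ ?_
    · rw [f.naturality_assoc, hG.inl_desc, g.naturality_assoc, hH.inl_desc, (sq Y).w_assoc]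
    · rw [f.naturality_assoc, hG.inr_desc, g.naturality_assoc, hH.inr_desc, (sq Z).w_assoc]
  refine ⟨(sq W).desc _ _ hfg, ⟨(sq Y).hom_ext ?_ ?_, (sq Z).hom_ext ?_ ?_⟩, fun t ht =>
    (sq W).hom_ext (hG.hom_ext ?_ ?_) (hH.hom_ext ?_ ?_)⟩
  · rw [← h.naturality_assoc, (sq W).inl_desc, hG.inl_desc]
  · rw [← k.naturality_assoc, (sq W).inr_desc, hH.inl_desc]
  · rw [← h.naturality_assoc, (sq W).inl_desc, hG.inr_desc]
  · rw [← k.naturality_assoc, (sq W).inr_desc, hH.inr_desc]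
  · rw [h.naturality_assoc, ht.1, (sq W).inl_desc, hG.inl_desc]
  · rw [h.naturality_assoc, ht.2, (sq W).inl_desc, hG.inr_desc]
  · rw [k.naturality_assoc, ht.1, (sq W).inr_desc, hH.inl_desc]
  · rw [k.naturality_assoc, ht.2, (sq W).inr_desc, hH.inr_desc]

end LevelwisePushouts

section MultiexactFunctors

open Cyl

variable {ι : Type} {C : ι → WaldCat.{u}} {D : WaldCat.{u}}

theorem WaldCat.cof_id (X : D) : D.cof (𝟙 X) := D.isWaldhausen.cof_of_isIso _ inferInstance

theorem WaldCat.weq_id (X : D) : D.weq (𝟙 X) := D.isWaldhausen.weq_of_isIso _ inferInstance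

theorem good_of_isZero {A : Type u} [Category.{v} A] {cof weq : MorphismProperty A}
    (h : IsWaldhausen A cof weq) {P : Type*} [PartialOrder P] {X : P ⥤ A}
    (hX : ∀ p, IsZero (X.obj p)) : Good cof X := fun _ b _ =>
  have hc : (southernCocone X _ b).IsUniversal := fun E' _ =>
    ⟨(hX b).to_ E', CoconeOn.ext (funext₂ fun p _ => (hX p).eq_of_src _ _),
      fun _ _ => (hX b).eq_of_src _ _⟩
  ⟨X.obj b, _, hc, h.cof_from_zero (hX b) _⟩

theorem IsMultiexact.good {F : (∀ i, C i) ⥤ D} (hF : IsMultiexact C D F) {X Y : ∀ i, C i}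
    (f : X ⟶ Y) (hf : ∀ i, (C i).cof (f i)) : Good D.cof (boxCube f ⋙ F) :=
  isGood_iff.1 (hF.cof f hf)

theorem isMultiexact_const {Z : D} (hZ : IsZero Z) :
    IsMultiexact C D ((Functor.const _).obj Z) where
  zero _ _ _ := hZ
  pushout _ _ _ _ _ _ _ _ _ _ _ _ := IsPushout.of_id_fst
  weq _ _ := WaldCat.weq_id _
  cof _ _ := isGood_iff.2 (good_of_isZero D.isWaldhausen fun _ => hZ)

theorem isZero_of_app {F : Multiexact C D} (h : ∀ X, IsZero (F.obj.obj X)) : IsZero F :=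
  IsZero.of_full_of_faithful_of_isZero (ObjectProperty.ι _) _ (Functor.isZero _ h)

theorem isPushout_of_app {F G H K : Multiexact C D} {f : F ⟶ G} {g : F ⟶ H} {h : G ⟶ K}
    {k : H ⟶ K} (sq : ∀ X, IsPushout (f.hom.app X) (g.hom.app X) (h.hom.app X) (k.hom.app X)) :
    IsPushout f g h k :=
  IsPushout.of_map_of_faithful (ObjectProperty.ι _) (IsPushout.of_forall_isPushout_app sq)

/-- Evaluation of multiexact functors at an object. -/
abbrev evalAt (X : ∀ i, C i) : Multiexact C D ⥤ D :=
  ObjectProperty.ι _ ⋙ (evaluation _ _).obj X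

theorem hasTwoOutOfThreeProperty_homWeq :
    (homWeq : MorphismProperty (Multiexact C D)).HasTwoOutOfThreeProperty :=
  have := D.isWaldhausen.two_out_of_three
  { comp_mem := fun _ _ hf hg X => D.weq.comp_mem _ _ (hf X) (hg X)
    of_postcomp := fun _ _ hg hfg X => D.weq.of_postcomp _ _ (hg X) (hfg X)
    of_precomp := fun _ _ hf hfg X => D.weq.of_precomp _ _ (hf X) (hfg X) }

theorem isZero_app {F : Multiexact C D} (h : IsZero F) (X : ∀ i, C i) : IsZero (F.obj.obj X) := by
  obtain ⟨Z, hZ⟩ := D.isWaldhausen.hasZero.zero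
  have hconst : IsZero (⟨_, isMultiexact_const hZ⟩ : Multiexact C D) := isZero_of_app fun _ => hZ
  exact hZ.of_iso ((evalAt X).mapIso (h.iso hconst))

variable [Finite ι]

theorem homCof_iff {F G : Multiexact C D} (α : F ⟶ G) :
    homCof α ↔ ∀ {X Y : ∀ i, C i} (f : X ⟶ Y), (∀ i, (C i).cof (f i)) →
      CofTrans D.cof (Functor.whiskerLeft (boxCube f) α.hom) :=
  ⟨fun h _ _ f hf => (isGood_arrowCube_iff D.isWaldhausen _).1 (h f hf),
    fun h _ _ f hf => (isGood_arrowCube_iff D.isWaldhausen _).2 (h f hf)⟩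

theorem IsMultiexact.map_cof {F : (∀ i, C i) ⥤ D} (hF : IsMultiexact C D F) {X Y : ∀ i, C i}
    (f : X ⟶ Y) (hf : ∀ i, (C i).cof (f i)) : D.cof (F.map f) :=
  have h : (fun _ => 0 : Vertex ι) ≤ (fun _ => 1) := fun _ => zero_le_one (α := Fin 2)
  (hF.good f hf).cof_map D.isWaldhausen h

theorem homCof.app {F G : Multiexact C D} {α : F ⟶ G} (h : homCof α) (X : ∀ i, C i) :
    D.cof (α.hom.app X) :=
  ((homCof_iff α).1 h (𝟙 X) fun _ => WaldCat.cof_id _).cof_app D.isWaldhausen fun _ => 0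

theorem homCof.cofTrans_of_isPushout_app {F G H : Multiexact C D} {f : F ⟶ G} {g : F ⟶ H}
    (hf : homCof f) {K : (∀ i, C i) ⥤ D} {h : G.obj ⟶ K} {k : H.obj ⟶ K}
    (sq : ∀ X, IsPushout (f.hom.app X) (g.hom.app X) (h.app X) (k.app X)) {X Y : ∀ i, C i}
    (m : X ⟶ Y) (hm : ∀ i, (C i).cof (m i)) :
    CofTrans D.cof (Functor.whiskerLeft (boxCube m) k) :=
  CofTrans.of_isPushout (Q := boxCube m ⋙ K) (γ := Functor.whiskerLeft (boxCube m) g.hom)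
    (h := Functor.whiskerLeft (boxCube m) h) D.isWaldhausen (fun p => sq ((boxCube m).obj p))
    ((homCof_iff f).1 hf m hm) (H.property.good m hm)

theorem isMultiexact_of_isPushout_app {F G H : Multiexact C D} {f : F ⟶ G} {g : F ⟶ H}
    (hf : homCof f) {K : (∀ i, C i) ⥤ D} {h : G.obj ⟶ K} {k : H.obj ⟶ K}
    (sq : ∀ X, IsPushout (f.hom.app X) (g.hom.app X) (h.app X) (k.app X)) :
    IsMultiexact C D K where
  zero X i hX := isZero_of_isPushout (sq X) (F.property.zero X i hX) (G.property.zero X i hX)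
    (H.property.zero X i hX)
  pushout i _ _ _ _ a b c d hsq hcof hiso :=
    isPushout_map_of_isPushout_app sq (F.property.pushout i a b c d hsq hcof hiso)
      (G.property.pushout i a b c d hsq hcof hiso) (H.property.pushout i a b c d hsq hcof hiso)
  weq {X Y} m hm := D.isWaldhausen.gluing (F.obj.map m) (G.obj.map m) (H.obj.map m) (K.map m)
    (sq X) (sq Y) (hf.app X) (hf.app Y) (F.property.weq m hm)
    (G.property.weq m hm) (H.property.weq m hm) (f.hom.naturality m).symm
    (g.hom.naturality m).symm (h.naturality m).symm (k.naturality m).symm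
  cof _ hm := isGood_iff.2 ((hf.cofTrans_of_isPushout_app sq _ hm).target D.isWaldhausen)

theorem homCof.exists_isPushout_app {F G H : Multiexact C D} {f : F ⟶ G} (hf : homCof f)
    (g : F ⟶ H) : ∃ (K : Multiexact C D) (h : G ⟶ K) (k : H ⟶ K),
      (∀ X, IsPushout (f.hom.app X) (g.hom.app X) (h.hom.app X) (k.hom.app X)) ∧ homCof k := by
  obtain ⟨K, h, k, sq⟩ := exists_functor_isPushout_app f.hom g.hom fun X => by
    obtain ⟨Q, h, k, sq, -⟩ := D.isWaldhausen.pushout (f.hom.app X) (g.hom.app X) (hf.app X)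
    exact ⟨Q, h, k, sq⟩
  exact ⟨⟨K, isMultiexact_of_isPushout_app hf sq⟩, ObjectProperty.homMk h,
    ObjectProperty.homMk k, sq, (homCof_iff _).2 (hf.cofTrans_of_isPushout_app sq)⟩

theorem homCof.isPushout_app {F G H K : Multiexact C D} {f : F ⟶ G} {g : F ⟶ H} {h : G ⟶ K}
    {k : H ⟶ K} (hf : homCof f) (sq : IsPushout f g h k) (X : ∀ i, C i) :
    IsPushout (f.hom.app X) (g.hom.app X) (h.hom.app X) (k.hom.app X) := by
  obtain ⟨K', h', k', sq', -⟩ := hf.exists_isPushout_app g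
  let e : K' ≅ K := (isPushout_of_app sq').isoIsPushout _ _ sq
  refine (sq' X).of_iso (Iso.refl _) (Iso.refl _) (Iso.refl _) ((evalAt X).mapIso e)
    (by simp) (by simp) ?_ ?_
  · exact ((evalAt X).congr_map (IsPushout.inl_isoIsPushout_hom _ _ _ sq)).trans
      (Category.id_comp _).symm
  · exact ((evalAt X).congr_map (IsPushout.inr_isoIsPushout_hom _ _ _ sq)).trans
      (Category.id_comp _).symm

theorem preservesCof_evalAt (X : ∀ i, C i) :
    PreservesCof homCof (evalAt X : Multiexact C D ⥤ D) where
  zero _ hZ := isZero_app hZ X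
  pushout _ _ _ _ sq hf := homCof.isPushout_app hf sq X

theorem homCof_of_isIso {F G : Multiexact C D} (f : F ⟶ G) [IsIso f] : homCof f :=
  (homCof_iff _).2 fun m hm => CofTrans.of_isIso D.isWaldhausen
    (fun p => inferInstanceAs (IsIso ((evalAt ((boxCube m).obj p)).map f))) (F.property.good m hm)

theorem isWaldhausen_multiexact : IsWaldhausen (Multiexact C D) homCof homWeq where
  cof_multiplicative :=
    { id_mem := fun _ => homCof_of_isIso _
      comp_mem := fun _ _ hf hg => (homCof_iff _).2 fun m hm => CofTrans.comp D.isWaldhausen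
        ((homCof_iff _).1 hf m hm) ((homCof_iff _).1 hg m hm) }
  weq_multiplicative :=
    { id_mem := fun _ _ => WaldCat.weq_id _
      comp_mem := hasTwoOutOfThreeProperty_homWeq.comp_mem }
  cof_of_isIso f _ := homCof_of_isIso f
  weq_of_isIso f _ X :=
    D.isWaldhausen.weq_of_isIso _ (inferInstanceAs (IsIso ((evalAt X).map f)))
  two_out_of_three := hasTwoOutOfThreeProperty_homWeq
  hasZero := by
    obtain ⟨Z, hZ⟩ := D.isWaldhausen.hasZero.zero
    exact ⟨⟨⟨_, isMultiexact_const hZ⟩, isZero_of_app fun _ => hZ⟩⟩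
  cof_from_zero {Z A} hZ f := (homCof_iff _).2 fun m hm => CofTrans.of_isZero D.isWaldhausen
    (fun p => isZero_app hZ _) (A.property.good m hm)
  pushout f g hf := by
    obtain ⟨K, h, k, sq, hk⟩ := homCof.exists_isPushout_app hf g
    exact ⟨K, h, k, isPushout_of_app sq, hk⟩
  gluing a b c p sq sq₁ hf hf₁ ha hb hc hfb hgc hhp hkp X :=
    D.isWaldhausen.gluing _ _ _ _ (homCof.isPushout_app hf sq X) (homCof.isPushout_app hf₁ sq₁ X)
      (homCof.app hf X) (homCof.app hf₁ X) (ha X) (hb X) (hc X)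
      ((evalAt X).congr_map hfb) ((evalAt X).congr_map hgc) ((evalAt X).congr_map hhp)
      ((evalAt X).congr_map hkp)

end MultiexactFunctors

section ProductDiagrams

open Set

/-- The product of a family of partial orders. It is a type of its own because the category
structure of a partially ordered set and that of a product of categories do not agree by unfolding
instances on `∀ i, P i`. -/
@[ext]
structure PiOrder {ι : Type} (P : ι → Type) where
  val : ∀ i, P i

namespace PiOrder

variable {ι : Type} {P Q : ι → Type}

instance [∀ i, PartialOrder (P i)] : PartialOrder (PiOrder P) :=
  PartialOrder.lift PiOrder.val fun _ _ h => PiOrder.ext h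

instance [∀ i, PartialOrder (P i)] [∀ i, OrderTop (P i)] : OrderTop (PiOrder P) where
  top := ⟨fun _ => ⊤⟩
  le_top x := fun i => (le_top : x.val i ≤ ⊤)

/-- The product of subsets of the factors. -/
def box (T : ∀ i, Set (P i)) : Set (PiOrder P) := {x | ∀ i, x.val i ∈ T i}

theorem box_univ : (box fun i => (univ : Set (P i))) = univ :=
  eq_univ_of_forall fun _ _ => mem_univ _

variable [∀ i, PartialOrder (P i)] [∀ i, PartialOrder (Q i)]

/-- The product of monotone maps. -/
def map (m : ∀ i, P i →o Q i) : PiOrder P →o PiOrder Q where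
  toFun x := ⟨fun i => m i (x.val i)⟩
  monotone' _ _ h := fun i => (m i).monotone (h i)

theorem le_of_map_le {m : ∀ i, P i →o Q i} (hm : ∀ i ⦃x y⦄, m i x ≤ m i y → x ≤ y)
    ⦃x y : PiOrder P⦄ (h : map m x ≤ map m y) : x ≤ y := fun i => hm i (h i)

theorem range_map (m : ∀ i, P i →o Q i) : range (map m) = box fun i => range (m i) := by
  ext q
  constructor
  · rintro ⟨x, rfl⟩ i
    exact mem_range_self _
  · intro hq
    choose x hx using hq
    exact ⟨⟨x⟩, PiOrder.ext (funext hx)⟩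

open Classical in
/-- The inclusion of `P i` as the slice through `q`, the set of tuples that differ from `q` at most
in the coordinate `i`. -/
def slice (q : PiOrder P) (i : ι) : P i →o PiOrder P where
  toFun p := ⟨Function.update q.val i p⟩
  monotone' _ _ h := fun j => update_le_update_iff.2 ⟨h, fun _ _ => le_rfl⟩ j

variable {q x : PiOrder P} {i j : ι} {p p' : P i}

@[simp]
theorem slice_val_self : (slice q i p).val i = p := by
  classical exact Function.update_self i p q.val

@[simp]
theorem slice_val_of_ne (h : j ≠ i) : (slice q i p).val j = q.val j := by
  classical exact Function.update_of_ne h p q.val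

theorem slice_val_eq_self : slice q i (q.val i) = q := by
  classical exact PiOrder.ext (Function.update_eq_self i q.val)

theorem le_slice_iff : x ≤ slice q i p ↔ x.val i ≤ p ∧ ∀ j ≠ i, x.val j ≤ q.val j := by
  classical exact le_update_iff

theorem le_of_slice_le ⦃p p' : P i⦄ (h : slice q i p ≤ slice q i p') : p ≤ p' := by
  simpa using (le_slice_iff.1 h).1

end PiOrder

variable {ι : Type} {C : ι → Type u} [∀ i, Category.{v} (C i)] {P Q : ι → Type}
  [∀ i, PartialOrder (P i)] [∀ i, PartialOrder (Q i)] {T U : ∀ i, Set (P i)}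

/-- The product of diagrams. -/
def prodDiagram (X : ∀ i, P i ⥤ C i) : PiOrder P ⥤ (∀ i, C i) where
  obj x i := (X i).obj (x.val i)
  map f i := (X i).map (homOfLE (leOfHom f i))
  map_id x := funext fun i => (X i).map_id (x.val i)
  map_comp f g := funext fun i => (map_homOfLE_comp (X i) (leOfHom f i) (leOfHom g i)).symm

variable {X : ∀ i, P i ⥤ C i} {Y : ∀ i, Q i ⥤ C i} {m : ∀ i, P i →o Q i}

/-- The product of cocones. -/
def CoconeOn.prod {E : ∀ i, C i} (c : ∀ i, CoconeOn (X i) (T i) (E i)) :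
    CoconeOn (prodDiagram X) (PiOrder.box T) E where
  app x hx i := (c i).app (x.val i) (hx i)
  map_app hp hq h := funext fun i => (c i).map_app (hp i) (hq i) (h i)

/-- The product of morphisms of diagrams. -/
def HomOver.prod (η : ∀ i, HomOver (m i) (X i) (Y i)) :
    HomOver (PiOrder.map m) (prodDiagram X) (prodDiagram Y) where
  app x i := (η i).app (x.val i)
  naturality h := funext fun i => (η i).naturality (h i)

instance (η : ∀ i, HomOver (m i) (X i) (Y i)) (x : PiOrder P)
    [∀ i, IsIso ((η i).app (x.val i))] : IsIso ((HomOver.prod η).app x) :=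
  (isIso_pi_iff ((HomOver.prod η).app x)).2 fun i =>
    inferInstanceAs (IsIso ((η i).app (x.val i)))

/-- The image of a morphism of diagrams under a functor. -/
def HomOver.image {P Q : Type*} [Preorder P] [Preorder Q] {A B : Type*} [Category* A] [Category* B]
    {m : P →o Q} {X : P ⥤ A} {Y : Q ⥤ A} (η : HomOver m X Y) (F : A ⥤ B) :
    HomOver m (X ⋙ F) (Y ⋙ F) where
  app p := F.map (η.app p)
  naturality h := by
    rw [Functor.comp_map, Functor.comp_map, ← F.map_comp, ← F.map_comp, η.naturality]

instance {P Q : Type*} [Preorder P] [Preorder Q] {A B : Type*} [Category* A] [Category* B]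
    {m : P →o Q} {X : P ⥤ A} {Y : Q ⥤ A} (η : HomOver m X Y) (F : A ⥤ B) (p : P)
    [IsIso (η.app p)] : IsIso ((η.image F).app p) :=
  inferInstanceAs (IsIso (F.map (η.app p)))

end ProductDiagrams

section Slices

open Set PiOrder

variable {ι : Type} {C : ι → Type u} [∀ i, Category.{v} (C i)] {P : ι → Type}
  [∀ i, PartialOrder (P i)]

open Classical in
/-- The functor `C i ⥤ ∏ C j` that is the identity in the coordinate `i` and constant with value
`A j` in the other coordinates `j`. -/
def insertFunctor (i : ι) (A : ∀ j, C j) : C i ⥤ (∀ j, C j) :=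
  Functor.pi' fun j => if h : i = j then (Pi.eqToEquivalence C h).functor
    else (Functor.const _).obj (A j)

theorem insertFunctor_self (i : ι) (A : ∀ j, C j) : insertFunctor i A ⋙ Pi.eval C i = 𝟭 _ := by
  refine (Functor.pi'_eval _ _).trans ?_
  rw [dif_pos rfl]
  rfl

theorem insertFunctor_of_ne {i j : ι} (h : i ≠ j) (A : ∀ j, C j) :
    insertFunctor i A ⋙ Pi.eval C j = (Functor.const _).obj (A j) := by
  refine (Functor.pi'_eval _ _).trans ?_
  rw [dif_neg h]

theorem nonempty_insertFunctor_iso_slice (X : ∀ i, P i ⥤ C i) (q : PiOrder P) (i : ι) :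
    Nonempty (X i ⋙ insertFunctor i ((prodDiagram X).obj q) ≅
      (slice q i).monotone.functor ⋙ prodDiagram X) := by
  suffices ∀ j, Nonempty ((X i ⋙ insertFunctor i ((prodDiagram X).obj q)) ⋙ Pi.eval C j ≅
      ((slice q i).monotone.functor ⋙ prodDiagram X) ⋙ Pi.eval C j) from
    ⟨NatIso.pi' fun j => (this j).some⟩
  intro j
  obtain rfl | hij := eq_or_ne i j
  · refine ⟨Functor.isoWhiskerLeft (X i) (eqToIso (insertFunctor_self i _)) ≪≫
      NatIso.ofComponents (fun p => (X i).mapIso (eqToIso slice_val_self.symm)) fun _ => ?_⟩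
    exact (map_homOfLE_comp (X i) _ _).trans (map_homOfLE_comp (X i) _ _).symm
  · refine ⟨Functor.isoWhiskerLeft (X i) (eqToIso (insertFunctor_of_ne hij _)) ≪≫
      NatIso.ofComponents (fun p => (X j).mapIso (eqToIso (slice_val_of_ne hij.symm).symm))
        fun _ => ?_⟩
    exact (Category.id_comp _).trans (map_homOfLE_comp (X j) _ _).symm

end Slices

section UniversalProducts

open Set PiOrder

variable {ι : Type} {C : ι → WaldCat.{u}} {D : WaldCat.{u}} {P Q : ι → Type}
  [∀ i, PartialOrder (P i)] [∀ i, PartialOrder (Q i)] {F : (∀ i, C i) ⥤ D}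
  {X : ∀ i, P i ⥤ C i} {Y : ∀ i, Q i ⥤ C i} {T : ∀ i, Set (P i)} {U : ∀ i, Set (Q i)}

theorem IsMultiexact.preservesCof (hF : IsMultiexact C D F) (i : ι) (A : ∀ j, C j) :
    PreservesCof (C i).cof (insertFunctor i A ⋙ F) where
  zero Z hZ := hF.zero _ i (hZ.of_iso (eqToIso (Functor.congr_obj (insertFunctor_self i A) Z)))
  pushout f g h k sq hf := by
    let Φ (j : ι) : C i ⥤ C j := insertFunctor i A ⋙ Pi.eval (fun j => (C j).carrier) j
    have hself : Φ i = 𝟭 _ := insertFunctor_self i A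
    have hne {j : ι} (hij : i ≠ j) : Φ j = (Functor.const _).obj (A j) := insertFunctor_of_ne hij A
    refine hF.pushout i _ _ _ _ (fun j => ?_) ?_ fun j hji => ?_
    · change IsPushout ((Φ j).map f) ((Φ j).map g) ((Φ j).map h) ((Φ j).map k)
      obtain rfl | hij := eq_or_ne i j
      · rwa [hself]
      · rw [hne hij]
        exact IsPushout.of_id_fst
    · change (C i).cof ((Φ i).map f)
      rwa [hself]
    · change IsIso ((Φ j).map f) ∧ IsIso ((Φ j).map g)
      rw [hne hji.symm]
      exact ⟨inferInstanceAs (IsIso (𝟙 _)), inferInstanceAs (IsIso (𝟙 _))⟩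

theorem slice_mem_upperBounds {q : PiOrder P} {i : ι} {S : Set (P i)} {b : P i}
    (hb : b ∈ upperBounds S) : slice q i b ∈ upperBounds (slice q i '' S) := by
  rintro _ ⟨p, hp, rfl⟩
  exact (slice q i).monotone (hb hp)

theorem IsMultiexact.isUniversal_slice (hF : IsMultiexact C D F) (q : PiOrder P) {i : ι}
    [Finite (P i)] {S : Set (P i)} {b : P i} (hR : Reedy (C i).cof (X i) S)
    {hb : b ∈ upperBounds S} (hS : (CoconeOn.toObj (X i) hb).IsUniversal) :
    (CoconeOn.toObj (prodDiagram X ⋙ F) (slice_mem_upperBounds (q := q) hb)).IsUniversal := by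
  obtain ⟨e⟩ := nonempty_insertFunctor_iso_slice X q i
  let η : HomOver (slice q i) (X i ⋙ insertFunctor i ((prodDiagram X).obj q)) (prodDiagram X) :=
    ⟨e.hom.app, fun _ => e.hom.naturality _⟩
  have (p : P i) : IsIso (η.app p) := inferInstanceAs (IsIso (e.hom.app p))
  have hK := isKan_of_isIso (η.image F) le_of_slice_le S
  have himage :=
    (hF.preservesCof i ((prodDiagram X).obj q)).isUniversal_image (C i).isWaldhausen hR hS
  rw [← hK.isUniversal_pullback_iff]
  refine (congrArg CoconeOn.IsUniversal ?_).mp (himage.comp_iso (F.mapIso (asIso (η.app b))))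
  ext p hp
  exact (η.image F).naturality (hb hp)

section OrderTop

variable [∀ i, OrderTop (P i)]

variable (P) in
/-- The endomorphism of `PiOrder P` that replaces the coordinate `i` by `⊤`. -/
def raise (i : ι) : PiOrder P →o PiOrder P where
  toFun x := slice x i ⊤
  monotone' x y h := le_slice_iff.2
    ⟨le_top, fun j hj => (slice_val_of_ne hj).le.trans ((h : ∀ j, x.val j ≤ y.val j) j)⟩

theorem le_raise (x : PiOrder P) (i : ι) : x ≤ raise P i x :=
  le_slice_iff.2 ⟨le_top, fun j _ => (le_rfl : x.val j ≤ x.val j)⟩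

theorem raise_val_of_ne {x : PiOrder P} {i j : ι} (h : j ≠ i) :
    (raise P i x).val j = x.val j := slice_val_of_ne h

theorem raise_le_iff {x y : PiOrder P} {i : ι} :
    raise P i x ≤ slice y i ⊤ ↔ ∀ j ≠ i, x.val j ≤ y.val j := by
  refine le_slice_iff.trans ((and_iff_right le_top).trans (forall₂_congr fun j hj => ?_))
  rw [raise_val_of_ne hj]

/-- The comparison of a diagram with itself along `raise`. -/
def homOverRaise {A : Type*} [Category* A] (Z : PiOrder P ⥤ A) (i : ι) :
    HomOver (raise P i) Z Z where
  app x := Z.map (homOfLE (le_raise x i))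
  naturality _ := (map_homOfLE_comp _ _ _).trans (map_homOfLE_comp _ _ _).symm

open Classical in
theorem IsMultiexact.isKan_homOverRaise (hF : IsMultiexact C D F) {i : ι} [Finite (P i)]
    (hR : Reedy (C i).cof (X i) (T i)) {hb : ⊤ ∈ upperBounds (T i)}
    (hT : (CoconeOn.toObj (X i) hb).IsUniversal) :
    IsKan (homOverRaise (prodDiagram X ⋙ F) i) (box T) (box (Function.update T i {⊤})) where
  mapsTo x hx j := by
    obtain rfl | hj := eq_or_ne j i
    · rw [Function.update_self]
      exact slice_val_self
    · rw [Function.update_of_ne hj, raise_val_of_ne hj]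
      exact hx j
  isUniversal q hq := by
    obtain ⟨q, hq', rfl⟩ : ∃ r : PiOrder P, (∀ j ≠ i, r.val j ∈ T j) ∧ slice r i ⊤ = q := by
      have hqi := hq i
      rw [Function.update_self, mem_singleton_iff] at hqi
      refine ⟨q, fun j hj => ?_, hqi ▸ slice_val_eq_self⟩
      have hqj := hq j
      rwa [Function.update_of_ne hj] at hqj
    have hS : slice q i '' T i ⊆ box T ∩ raise P i ⁻¹' Iic (slice q i ⊤) := by
      rintro _ ⟨p, hp, rfl⟩
      refine ⟨fun j => ?_, raise_le_iff.2 fun j hj => (slice_val_of_ne hj).le⟩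
      obtain rfl | hj := eq_or_ne j i
      · rwa [slice_val_self]
      · rw [slice_val_of_ne hj]
        exact hq' j hj
    refine (CoconeOn.isUniversal_restrict_iff_of_isLeast hS fun x hx => ?_).1 ?_
    · refine ⟨slice q i (x.val i), ⟨mem_image_of_mem _ (hx.1 i),
        le_slice_iff.2 ⟨le_rfl, raise_le_iff.1 hx.2⟩⟩, ?_⟩
      rintro _ ⟨⟨p, -, rfl⟩, hxp⟩
      exact (slice q i).monotone (le_slice_iff.1 hxp).1
    · refine (congrArg CoconeOn.IsUniversal ?_).mp (hF.isUniversal_slice q hR hT)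
      ext x hx
      exact (map_homOfLE_comp (prodDiagram X ⋙ F) (le_raise x i) _).symm

open Classical in
theorem IsMultiexact.isUniversal_toObj_box [Finite ι] [∀ i, Finite (P i)]
    (hF : IsMultiexact C D F) (hR : ∀ i, Reedy (C i).cof (X i) (T i))
    (hT : ∀ i, (CoconeOn.toObj (X i) (S := T i) (b := ⊤) fun _ _ => le_top).IsUniversal) :
    (CoconeOn.toObj (prodDiagram X ⋙ F) (S := box T) (b := ⊤) fun _ _ => le_top).IsUniversal := by
  suffices ∀ (s : Finset ι) (T : ∀ i, Set (P i)), (∀ i ∈ s, Reedy (C i).cof (X i) (T i) ∧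
      (CoconeOn.toObj (X i) (S := T i) (b := ⊤) fun _ _ => le_top).IsUniversal) →
      (∀ i ∉ s, T i = {⊤}) →
      (CoconeOn.toObj (prodDiagram X ⋙ F) (S := box T) (b := ⊤) fun _ _ => le_top).IsUniversal by
    cases nonempty_fintype ι
    exact this Finset.univ T (fun i _ => ⟨hR i, hT i⟩) fun i hi => (hi (Finset.mem_univ i)).elim
  intro s
  induction s using Finset.induction_on with
  | empty =>
    intro T _ hs
    refine CoconeOn.isUniversal_toObj ⟨fun i => ?_, fun _ _ => le_top⟩
    rw [hs i (Finset.notMem_empty i)]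
    rfl
  | insert i s his ih =>
    intro T hs hs'
    have hK := hF.isKan_homOverRaise (hs i (s.mem_insert_self i)).1 (hs i (s.mem_insert_self i)).2
    have hcone := ih (Function.update T i {⊤}) (fun j hj => ?_) fun j hj => ?_
    · refine (congrArg CoconeOn.IsUniversal ?_).mp (hK.isUniversal_pullback_iff.2 hcone)
      ext x hx
      exact map_homOfLE_comp (prodDiagram X ⋙ F) (le_raise x i) _
    · rw [Function.update_of_ne (ne_of_mem_of_not_mem hj his)]
      exact hs j (Finset.mem_insert_of_mem hj)
    · obtain rfl | hji := eq_or_ne j i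
      · exact Function.update_self ..
      · rw [Function.update_of_ne hji]
        exact hs' j (by simp [hji, hj])

end OrderTop
end UniversalProducts

section ExtendedDiagrams

open Set

variable {P : Type} [PartialOrder P] {D : Type u} [Category.{v} D] {X : P ⥤ D} {T : Set P} {E : D}

/-- The diagram on `T` with a top element added whose value there is the vertex `E` of the cocone
`c`. -/
def CoconeOn.extend (c : CoconeOn X T E) : WithTop T ⥤ D where
  obj
    | ⊤ => E
    | (p : T) => X.obj p
  map {x y} f :=
    match x, y, leOfHom f with
    | (_ : T), (_ : T), h => X.map (homOfLE ((WithTop.coe_le_coe (α := T)).1 h))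
    | (p : T), ⊤, _ => c.app p p.2
    | ⊤, ⊤, _ => 𝟙 E
    | ⊤, (_ : T), h => (WithTop.not_top_le_coe _ h).elim
  map_id
    | ⊤ => rfl
    | (p : T) => X.map_id p
  map_comp {x y z} f g :=
    match x, y, z, leOfHom f, leOfHom g with
    | (_ : T), (_ : T), (_ : T), h, h' =>
      (map_homOfLE_comp X ((WithTop.coe_le_coe (α := T)).1 h)
        ((WithTop.coe_le_coe (α := T)).1 h')).symm
    | (p : T), (q : T), ⊤, h, _ => (c.map_app p.2 q.2 ((WithTop.coe_le_coe (α := T)).1 h)).symm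
    | (_ : T), ⊤, ⊤, _, _ => (Category.comp_id _).symm
    | ⊤, ⊤, ⊤, _, _ => (Category.comp_id _).symm
    | ⊤, (_ : T), _, h, _ => (WithTop.not_top_le_coe _ h).elim
    | _, ⊤, (_ : T), _, h => (WithTop.not_top_le_coe _ h).elim

/-- The comparison of the restriction of a diagram along a monotone map with the diagram. -/
def HomOver.precomp {P Q : Type*} [Preorder P] [Preorder Q] (m : P →o Q) (W : Q ⥤ D) :
    HomOver m (m.monotone.functor ⋙ W) W where
  app _ := 𝟙 _
  naturality _ := (Category.comp_id _).trans (Category.id_comp _).symm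

instance {P Q : Type*} [Preorder P] [Preorder Q] (m : P →o Q) (W : Q ⥤ D) (p : P) :
    IsIso ((HomOver.precomp m W).app p) :=
  inferInstanceAs (IsIso (𝟙 _))

variable (T) in
/-- The inclusion of a subset `T` into `T` with a top element added. -/
def withTopSome : T →o WithTop T := ⟨WithTop.some, WithTop.coe_mono⟩

theorem le_of_withTopSome_le ⦃p q : T⦄ (h : withTopSome T p ≤ withTopSome T q) : p ≤ q :=
  WithTop.coe_le_coe.1 h

/-- The comparison of the base of `c.extend` with `c.extend`. -/
def CoconeOn.homOverExtend (c : CoconeOn X T E) : HomOver (withTopSome T)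
    ((OrderHom.Subtype.val (· ∈ T)).monotone.functor ⋙ X) c.extend where
  app _ := 𝟙 _
  naturality _ := (Category.comp_id _).trans (Category.id_comp _).symm

instance (c : CoconeOn X T E) (p : T) : IsIso (c.homOverExtend.app p) :=
  inferInstanceAs (IsIso (𝟙 _))

variable {cof weq : MorphismProperty D} {c : CoconeOn X T E}

theorem image_subtypeVal_univ : OrderHom.Subtype.val (· ∈ T) '' univ = T :=
  Subtype.coe_image_univ T

theorem isKan_precomp_subtypeVal (X : P ⥤ D) (T : Set P) :
    IsKan (HomOver.precomp (OrderHom.Subtype.val (· ∈ T)) X) univ T := by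
  have := isKan_of_isIso (HomOver.precomp (OrderHom.Subtype.val (· ∈ T)) X) (fun _ _ h => h) univ
  rwa [image_subtypeVal_univ] at this

theorem CoconeOn.isKan_homOverExtend : IsKan c.homOverExtend univ (range (withTopSome T)) := by
  simpa only [image_univ] using isKan_of_isIso c.homOverExtend le_of_withTopSome_le univ

theorem CoconeOn.reedy_extend [Finite P] (hD : IsWaldhausen D cof weq) (hX : Reedy cof X T) :
    Reedy cof c.extend (range (withTopSome T)) := by
  refine isKan_homOverExtend.reedy hD ?_
  rwa [← reedy_image_iff_of_isIso (HomOver.precomp (OrderHom.Subtype.val (· ∈ T)) X)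
    (fun _ _ h => h) hD, image_subtypeVal_univ]

theorem CoconeOn.isUniversal_toObj_extend (hc : c.IsUniversal) :
    (toObj c.extend (S := range (withTopSome T)) (b := ⊤) fun _ _ => le_top).IsUniversal := by
  rw [← isKan_homOverExtend.isUniversal_pullback_iff]
  exact (isKan_precomp_subtypeVal X T).isUniversal_pullback_iff.2 hc

end ExtendedDiagrams

section ProductCocones

open Set PiOrder

variable {ι : Type} {C : ι → WaldCat.{u}} {D : WaldCat.{u}} {P Q : ι → Type}
  [∀ i, PartialOrder (P i)] [∀ i, PartialOrder (Q i)] {F : (∀ i, C i) ⥤ D}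
  {X : ∀ i, P i ⥤ C i} {Y : ∀ i, Q i ⥤ C i} {T : ∀ i, Set (P i)} {U : ∀ i, Set (Q i)}

theorem isKan_prod_of_isIso {m : ∀ i, P i →o Q i} (hm : ∀ i ⦃x y⦄, m i x ≤ m i y → x ≤ y)
    (hU : ∀ i, range (m i) = U i) (η : ∀ i, HomOver (m i) (X i) (Y i))
    [∀ i p, IsIso ((η i).app p)] (F : (∀ i, C i) ⥤ D) :
    IsKan ((HomOver.prod η).image F) univ (box U) := by
  have := isKan_of_isIso ((HomOver.prod η).image F) (le_of_map_le hm) univ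
  rwa [image_univ, range_map, funext hU] at this

variable [Finite ι] [∀ i, Finite (P i)]

theorem IsMultiexact.isUniversal_prod (hF : IsMultiexact C D F)
    (hR : ∀ i, Reedy (C i).cof (X i) (T i)) {E : ∀ i, C i} {c : ∀ i, CoconeOn (X i) (T i) (E i)}
    (hc : ∀ i, (c i).IsUniversal) : ((CoconeOn.prod c).image F).IsUniversal := by
  have hη := isKan_prod_of_isIso (fun _ _ _ h => h) (fun _ => Subtype.range_val)
    (fun i => HomOver.precomp (OrderHom.Subtype.val (· ∈ T i)) (X i)) F
  have hθ := isKan_prod_of_isIso (fun _ => le_of_withTopSome_le) (fun _ => rfl)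
    (fun i => (c i).homOverExtend) F
  rw [← hη.isUniversal_pullback_iff]
  exact hθ.isUniversal_pullback_iff.2 (hF.isUniversal_toObj_box
    (fun i => CoconeOn.reedy_extend (C i).isWaldhausen (hR i))
    fun i => CoconeOn.isUniversal_toObj_extend (hc i))

end ProductCocones

section GoodProducts

open Set PiOrder

variable {ι : Type} [Finite ι] {C : ι → WaldCat.{u}} {D : WaldCat.{u}} {P Q : ι → Type}
  [∀ i, PartialOrder (P i)] [∀ i, PartialOrder (Q i)] [∀ i, Finite (P i)] {F : (∀ i, C i) ⥤ D}
  {X : ∀ i, P i ⥤ C i} {Y : ∀ i, Q i ⥤ C i} {T : ∀ i, Set (P i)} {U : ∀ i, Set (Q i)}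

theorem IsMultiexact.isKan_prod (hF : IsMultiexact C D F) {m : ∀ i, P i →o Q i}
    {η : ∀ i, HomOver (m i) (X i) (Y i)} (hR : ∀ i, Reedy (C i).cof (X i) (T i))
    (hη : ∀ i, IsKan (η i) (T i) (U i)) : IsKan ((HomOver.prod η).image F) (box T) (box U) where
  mapsTo _ hx i := (hη i).mapsTo (hx i)
  isUniversal q hq := by
    have hset : box T ∩ PiOrder.map m ⁻¹' Iic q = box fun i => T i ∩ m i ⁻¹' Iic (q.val i) :=
      Set.ext fun x =>
        ⟨fun hx i => ⟨hx.1 i, hx.2 i⟩, fun hx => ⟨fun i => (hx i).1, fun i => (hx i).2⟩⟩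
    refine (CoconeOn.isUniversal_restrict_iff_of_eq hset.symm).1 ?_
    refine (congrArg CoconeOn.IsUniversal ?_).mp (hF.isUniversal_prod
      (fun i => (hR i).mono (isRelLowerSet_inter_preimage_Iic (T i) (q.val i)))
      fun i => (hη i).isUniversal (q.val i) (hq i))
    ext x hx
    exact F.map_comp ((HomOver.prod η).app x) ((prodDiagram Y).map (homOfLE fun i => (hx i).2))

end GoodProducts

section SouthernKan

open Set

variable {P : Type} [PartialOrder P] [OrderTop P] {D : Type u} [Category.{v} D] {X : P ⥤ D} {E : D}

open Classical in
variable (P) in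
/-- The monotone map that contracts everything below the top element to `0`. -/
def contractBelowTop : P →o Fin 2 where
  toFun p := if p < ⊤ then 0 else 1
  monotone' p q h := by
    dsimp only
    split_ifs with hp hq hq
    exacts [le_rfl, Fin.zero_le _, (hp (h.trans_lt hq)).elim, le_rfl]

theorem contractBelowTop_eq_zero_iff {p : P} : contractBelowTop P p = 0 ↔ p < ⊤ := by
  classical exact ite_eq_left_iff.trans (by simp)

theorem top_le_of_contractBelowTop_le {p : P}
    (h : contractBelowTop P ⊤ ≤ contractBelowTop P p) : ⊤ ≤ p := by
  by_contra hp
  rw [contractBelowTop_eq_zero_iff.2 (lt_top_iff_ne_top.2 fun h => hp h.ge), Fin.le_zero_iff,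
    contractBelowTop_eq_zero_iff] at h
  exact lt_irrefl _ h

variable {c : CoconeOn X (univ ∩ Iio ⊤) E} (hc : c.IsUniversal)

/-- The southern arrow at the top element, as a diagram. -/
abbrev southernDiagram : Fin 2 ⥤ D := ComposableArrows.mk₁ (hc.desc (southernCocone X univ ⊤))

/-- The morphisms from the values of the diagram `X` to the source and to the target of its southern
arrow at the top element. -/
def toSouthern (p : P) : ∀ ε : Fin 2, (ε = 0 → p < ⊤) → (X.obj p ⟶ (southernDiagram hc).obj ε)
  | 0, h => c.app p ⟨mem_univ p, h rfl⟩
  | 1, _ => X.map (homOfLE le_top)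

theorem map_toSouthern {p q : P} (h : p ≤ q) : ∀ {ε ε' : Fin 2} (hε : ε ≤ ε')
    (hp : ε = 0 → p < ⊤) (hq : ε' = 0 → q < ⊤),
    X.map (homOfLE h) ≫ toSouthern hc q ε' hq =
      toSouthern hc p ε hp ≫ (southernDiagram hc).map (homOfLE hε)
  | 0, 0, _, _, hq => (c.map_app ⟨mem_univ p, h.trans_lt (hq rfl)⟩ ⟨mem_univ q, hq rfl⟩ h).trans
      (Category.comp_id _).symm
  | 0, 1, _, hp, _ =>
      (map_homOfLE_comp X _ _).trans
        (hc.app_desc (southernCocone X univ ⊤) ⟨mem_univ p, hp rfl⟩).symm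
  | 1, 1, _, _, _ => (map_homOfLE_comp X _ _).trans (Category.comp_id _).symm

instance isIso_toSouthern_top : ∀ (ε : Fin 2) (h : ε = 0 → ⊤ < ⊤), IsIso (toSouthern hc ⊤ ε h)
  | 0, h => (lt_irrefl _ (h rfl)).elim
  | 1, _ => inferInstanceAs (IsIso (X.map (𝟙 ⊤)))

/-- The comparison of a diagram with its southern arrow at the top element. -/
def homOverSouthern : HomOver (contractBelowTop P) X (southernDiagram hc) where
  app p := toSouthern hc p _ contractBelowTop_eq_zero_iff.1
  naturality h := map_toSouthern hc h _ _ _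

instance : IsIso ((homOverSouthern hc).app ⊤) := isIso_toSouthern_top hc _ _

theorem kanCocone_homOverSouthern_app {p : P} {ε : Fin 2} (hp : contractBelowTop P p ≤ ε)
    (hε : ε = 0 → p < ⊤) :
    (kanCocone (homOverSouthern hc) univ ε).app p ⟨mem_univ p, hp⟩ = toSouthern hc p ε hε := by
  have := map_toSouthern hc le_rfl hp contractBelowTop_eq_zero_iff.1 hε
  rw [map_homOfLE_self, Category.id_comp] at this
  exact this.symm

theorem isKan_homOverSouthern : IsKan (homOverSouthern hc) univ univ where
  mapsTo := mapsTo_univ _ _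
  isUniversal
    | 0, _ => by
      have hset : univ ∩ contractBelowTop P ⁻¹' Iic 0 = univ ∩ Iio ⊤ := Set.ext fun p =>
        and_congr_right fun _ => Fin.le_zero_iff.trans contractBelowTop_eq_zero_iff
      refine (CoconeOn.isUniversal_restrict_iff_of_eq hset.symm).1 ?_
      refine (congrArg CoconeOn.IsUniversal ?_).mp hc
      ext p hp
      have hp' : contractBelowTop P p ≤ 0 := Fin.le_zero_iff.2 (contractBelowTop_eq_zero_iff.2 hp.2)
      exact (kanCocone_homOverSouthern_app hc hp' fun _ => hp.2).symm
    | 1, _ => by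
      have hle : contractBelowTop P ⊤ ≤ 1 := Fin.le_last _
      refine CoconeOn.isUniversal_of_isGreatest (b := ⊤) ⟨⟨mem_univ _, hle⟩, fun _ _ => le_top⟩ ?_
      rw [kanCocone_homOverSouthern_app hc hle fun h => (one_ne_zero h).elim]
      exact isIso_toSouthern_top hc 1 _

end SouthernKan

section CofAtProduct

open Set PiOrder

variable {ι : Type} {C : ι → WaldCat.{u}} {D : WaldCat.{u}} {P : ι → Type}
  [∀ i, PartialOrder (P i)] {F : (∀ i, C i) ⥤ D} {X : ∀ i, P i ⥤ C i}

theorem IsMultiexact.good_prod_mk₁ (hF : IsMultiexact C D F) {A B : ∀ i, C i} {f : ∀ i, A i ⟶ B i}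
    (hf : ∀ i, (C i).cof (f i)) :
    Good D.cof (prodDiagram (fun i => ComposableArrows.mk₁ (f i)) ⋙ F) := by
  let m : PiOrder (fun _ : ι => Fin 2) →o Vertex ι := ⟨PiOrder.val, fun _ _ h => h⟩
  have hm : Function.Surjective m := fun x => ⟨⟨x⟩, rfl⟩
  exact (good_iff_of_isIso (HomOver.precomp m (boxCube f ⋙ F)) (fun _ _ h => h) D.isWaldhausen
    hm).1 (hF.good f hf)

variable [Finite ι] [∀ i, Finite (P i)]

theorem IsMultiexact.cofAt_prod_top [∀ i, OrderTop (P i)] (hF : IsMultiexact C D F)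
    (hX : ∀ i, Reedy (C i).cof (X i) univ) : CofAt D.cof (prodDiagram X ⋙ F) univ ⊤ := by
  choose E c hc hcof using fun i => hX i ⊤ (mem_univ ⊤)
  let η := (HomOver.prod fun i => homOverSouthern (hc i)).image F
  let m := PiOrder.map fun i => contractBelowTop (P i)
  have hη : IsKan η univ univ := by
    simpa only [box_univ] using hF.isKan_prod hX fun i => isKan_homOverSouthern (hc i)
  have hset : univ ∩ m ⁻¹' (univ ∩ Iio (m ⊤)) = univ ∩ Iio ⊤ := by
    ext x
    refine and_congr_right fun _ => ⟨fun h => ?_, fun h => ⟨mem_univ _, ?_⟩⟩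
    · exact lt_of_le_not_ge le_top fun hx => h.2.not_ge (m.monotone hx)
    · exact lt_of_le_not_ge (m.monotone le_top) fun h' => h.not_ge
        (show ⊤ ≤ x from fun i => top_le_of_contractBelowTop_le (h' i))
  have (i : ι) : IsIso ((homOverSouthern (hc i)).app ((⊤ : PiOrder P).val i)) :=
    inferInstanceAs (IsIso ((homOverSouthern (hc i)).app ⊤))
  have : IsIso (η.app ⊤) := inferInstanceAs (IsIso (((HomOver.prod _).image F).app ⊤))
  refine (IsKan.cofAt_iff D.isWaldhausen
    (hset ▸ hη.restrict (isRelLowerSet_inter_Iio univ (m ⊤)))).1 ?_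
  have hgood := hF.good_prod_mk₁ hcof ⟨fun _ => 0⟩ (m ⊤) fun _ => Fin.zero_le _
  refine hgood.congr (congrArg (· ∩ Iio (m ⊤)) ?_)
  exact eq_univ_of_forall fun x i => Fin.zero_le (x.val i)

theorem IsMultiexact.good_prod (hF : IsMultiexact C D F) (hX : ∀ i, Good (C i).cof (X i)) :
    Good D.cof (prodDiagram X ⋙ F) := by
  intro a b hab
  have := fun i => Fact.mk (hab i)
  let m (i : ι) : Icc (a.val i) (b.val i) →o P i := OrderHom.Subtype.val _
  let η := HomOver.precomp (PiOrder.map m) (prodDiagram X ⋙ F)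
  have h : CofAt D.cof (prodDiagram (fun i => (m i).monotone.functor ⋙ X i) ⋙ F) univ ⊤ := by
    refine hF.cofAt_prod_top fun i => ?_
    rw [← reedy_image_iff_of_isIso (HomOver.precomp (m i) (X i)) (fun _ _ h => h)
      (C i).isWaldhausen, image_subtypeVal_univ]
    exact (hX i (a.val i)).mono (isRelLowerSet_inter_Iic _ _)
  refine (cofAt_iff_of_isIso η (le_of_map_le fun _ _ _ h => h) D.isWaldhausen ?_).2 h
  rw [← image_inter_Iio_eq (le_of_map_le fun _ _ _ h => h), image_univ, range_map]
  ext x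
  refine and_congr_left fun hxb => ⟨fun hax i => ?_, fun hx i => ?_⟩
  · have hxb : ∀ i, x.val i ≤ b.val i := (le_of_lt hxb : x ≤ b)
    exact ⟨⟨x.val i, hax i, hxb i⟩, rfl⟩
  · obtain ⟨p, hp⟩ := hx i
    exact hp ▸ p.2.1

end CofAtProduct

section Identity

open Set

theorem good_of_cof_map {D : Type u} [Category.{v} D] {cof weq : MorphismProperty D}
    (hD : IsWaldhausen D cof weq) {P : Type*} [PartialOrder P] {X : P ⥤ D}
    (hP : ∀ a p b : P, a ≤ p → p < b → p = a)
    (hX : ∀ (a b : P) (hab : a ≤ b), cof (X.map (homOfLE hab))) : Good cof X := by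
  intro a b hab
  obtain rfl | hlt := hab.eq_or_lt
  · obtain ⟨Z, hZ⟩ := hD.hasZero.zero
    have hempty : Ici a ∩ Iio a = ∅ := eq_empty_of_forall_notMem fun p hp => hp.2.not_ge hp.1
    have hc := (CoconeOn.isUniversal_restrict_iff_of_eq hempty).2
      (CoconeOn.isUniversal_of_isZero hZ (CoconeOn.empty X Z))
    exact ⟨Z, _, hc, hD.cof_from_zero hZ _⟩
  · have ha : IsGreatest (Ici a ∩ Iio b) a :=
      ⟨⟨le_rfl, hlt⟩, fun p hp => (hP a p b hp.1 hp.2).le⟩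
    have hc := CoconeOn.isUniversal_toObj (X := X) ha
    refine ⟨X.obj a, _, hc, ?_⟩
    have hdesc : X.map (homOfLE hab) = hc.desc (southernCocone X (Ici a) b) := by
      refine hc.eq_desc ?_
      ext p hp
      exact map_homOfLE_comp X _ _
    exact hdesc ▸ hX a b hab

theorem isMultiexact_idFunctor (C : WaldCat.{u}) :
    IsMultiexact (fun _ : Unit => C) C (idFunctor C) where
  zero _ _ h := h
  pushout _ _ _ _ _ _ _ _ _ sq _ _ := sq ()
  weq _ h := h ()
  cof f h := by
    have hfin : ∀ x y z : Fin 2, x ≤ y → y < z → y = x := by decide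
    have hcof : ∀ (x y : Fin 2) (hxy : x ≤ y),
        C.cof ((ComposableArrows.mk₁ (f ())).map (homOfLE hxy))
      | 0, 0, _ => WaldCat.cof_id _
      | 0, 1, _ => h ()
      | 1, 1, _ => WaldCat.cof_id _
    refine isGood_iff.2 <| good_of_cof_map C.isWaldhausen (fun a p b hap hpb => ?_)
      fun a b hab => hcof _ _ (hab ())
    obtain ⟨-, i, hi⟩ := Pi.lt_def.1 hpb
    exact funext fun _ => hfin _ _ (b i) (hap _) hi

end Identity

section Reindexing

variable {ι ι' : Type} {C : ι → WaldCat.{u}} {D : WaldCat.{u}}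

theorem permute_comap (C : ι → WaldCat.{u}) (e : ι' ≃ ι) :
    permute C e ⋙ Pi.comap (fun i => (C i).carrier) e = 𝟭 _ := by
  have eval_comp_eqToEquivalence (j j' : ι') (h : e j' = e j) :
      Pi.eval (fun j => (C (e j)).carrier) j' ⋙
        (Pi.eqToEquivalence (fun i => (C i).carrier) h).functor =
      Pi.eval (fun j => (C (e j)).carrier) j := by
    obtain rfl := e.injective h
    rfl
  exact Functor.pi_ext _ _ fun j => eval_comp_eqToEquivalence j (e.symm (e j)) (by simp)

theorem eq_actFunctor {e : ι' ≃ ι} {F : (∀ i, C i) ⥤ D} {H : (∀ j, C (e j)) ⥤ D}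
    (h : Pi.comap (fun i => (C i).carrier) e ⋙ H = F) : H = actFunctor e F := by
  subst h
  change H = (permute C e ⋙ Pi.comap (fun i => (C i).carrier) e) ⋙ H
  rw [permute_comap, Functor.id_comp]

theorem comap_actFunctor (e : ι' ≃ ι) (F : (∀ i, C i) ⥤ D) :
    Pi.comap (fun i => (C i).carrier) e ⋙ actFunctor e F = F := by
  change (Pi.comap (fun i => (C i).carrier) e ⋙ permute C e) ⋙ F = F
  rw [comap_permute, Functor.id_comp]

/-- Reindexing of the vertices of a cube along a map of index sets. -/
def reindexVertex (e : ι' → ι) : Vertex ι →o Vertex ι' :=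
  ⟨fun x j => x (e j), fun _ _ h j => h (e j)⟩

theorem good_comap_iff [Finite ι] (e : ι' ≃ ι) (H : (∀ j, C (e j)) ⥤ D) {X Y : ∀ i, C i}
    (f : X ⟶ Y) : Good D.cof (boxCube f ⋙ Pi.comap (fun i => (C i).carrier) e ⋙ H) ↔
      Good D.cof (boxCube (C := fun j => C (e j)) (X := fun j => X (e j)) (Y := fun j => Y (e j))
        (fun j => f (e j)) ⋙ H) :=
  (good_iff_of_isIso (HomOver.precomp (reindexVertex e)
      (boxCube (C := fun j => C (e j)) (X := fun j => X (e j)) (Y := fun j => Y (e j))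
        (fun j => f (e j)) ⋙ H))
    (fun _ _ h i => e.apply_symm_apply i ▸ h (e.symm i)) D.isWaldhausen
    (Equiv.piCongrLeft (fun _ => Fin 2) e).symm.surjective).symm

theorem IsMultiexact.comap [Finite ι] {e : ι' ≃ ι} {H : (∀ j, C (e j)) ⥤ D}
    (h : IsMultiexact (fun j => C (e j)) D H) :
    IsMultiexact C D (Pi.comap (fun i => (C i).carrier) e ⋙ H) where
  zero X i hX := by
    obtain ⟨j, rfl⟩ := e.surjective i
    exact h.zero (fun j => X (e j)) j hX
  pushout i _ _ _ _ a b c d sq hc hiso := by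
    obtain ⟨j, rfl⟩ := e.surjective i
    exact h.pushout j _ _ _ _ (fun j => sq (e j)) hc fun j' hj => hiso _ (e.injective.ne hj)
  weq f hf := h.weq (fun j => f (e j)) fun j => hf (e j)
  cof {X Y} f hf := isGood_iff.2 <| (good_comap_iff e H f).2 <|
    h.good (X := fun j => X (e j)) (Y := fun j => Y (e j)) (fun j => f (e j)) fun j => hf (e j)

theorem exists_reindex_eq {A : ι → Type*} (e : ι' ≃ ι) (x : ∀ j, A (e j)) :
    ∃ y : ∀ i, A i, (fun j => y (e j)) = x :=
  (Equiv.piCongrLeft A e).symm.surjective x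

theorem IsMultiexact.of_comap [Finite ι] {e : ι' ≃ ι} {H : (∀ j, C (e j)) ⥤ D}
    (h : IsMultiexact C D (Pi.comap (fun i => (C i).carrier) e ⋙ H)) :
    IsMultiexact (fun j => C (e j)) D H where
  zero X j hX := by
    obtain ⟨X, rfl⟩ := exists_reindex_eq (A := fun i => C i) e X
    exact h.zero X (e j) hX
  pushout j A₀ A₁ A₂ A₃ a b c d sq hc hiso := by
    obtain ⟨A₀, rfl⟩ := exists_reindex_eq (A := fun i => C i) e A₀
    obtain ⟨A₁, rfl⟩ := exists_reindex_eq (A := fun i => C i) e A₁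
    obtain ⟨A₂, rfl⟩ := exists_reindex_eq (A := fun i => C i) e A₂
    obtain ⟨A₃, rfl⟩ := exists_reindex_eq (A := fun i => C i) e A₃
    obtain ⟨a, rfl⟩ := exists_reindex_eq (A := fun i => A₀ i ⟶ A₁ i) e a
    obtain ⟨b, rfl⟩ := exists_reindex_eq (A := fun i => A₀ i ⟶ A₂ i) e b
    obtain ⟨c, rfl⟩ := exists_reindex_eq (A := fun i => A₁ i ⟶ A₃ i) e c
    obtain ⟨d, rfl⟩ := exists_reindex_eq (A := fun i => A₂ i ⟶ A₃ i) e d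
    exact h.pushout (e j) a b c d (e.surjective.forall.2 sq) hc
      (e.surjective.forall.2 fun j' hj => hiso j' fun h => hj (congrArg e h))
  weq {X Y} f hf := by
    obtain ⟨X, rfl⟩ := exists_reindex_eq (A := fun i => C i) e X
    obtain ⟨Y, rfl⟩ := exists_reindex_eq (A := fun i => C i) e Y
    obtain ⟨f, rfl⟩ := exists_reindex_eq (A := fun i => X i ⟶ Y i) e f
    exact h.weq f (e.surjective.forall.2 hf)
  cof {X Y} f hf := by
    obtain ⟨X, rfl⟩ := exists_reindex_eq (A := fun i => C i) e X
    obtain ⟨Y, rfl⟩ := exists_reindex_eq (A := fun i => C i) e Y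
    obtain ⟨f, rfl⟩ := exists_reindex_eq (A := fun i => X i ⟶ Y i) e f
    exact isGood_iff.2 <| (good_comap_iff e H f).1 <| h.good f (e.surjective.forall.2 hf)

theorem IsMultiexact.act [Finite ι] (e : ι' ≃ ι) {F : (∀ i, C i) ⥤ D} (hF : IsMultiexact C D F) :
    IsMultiexact (fun j => C (e j)) D (actFunctor e F) :=
  IsMultiexact.of_comap (by rwa [comap_actFunctor])

end Reindexing

section Composition

variable {ι : Type} {J : ι → Type} {A : (Σ i, J i) → WaldCat.{u}} {B : ι → WaldCat.{u}}
  {D : WaldCat.{u}} {F : (∀ i, B i) ⥤ D} {G : ∀ i, (∀ j, A ⟨i, j⟩) ⥤ B i}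

variable (J) in
/-- A tuple of vertices of cubes, concatenated to a vertex of the product cube. -/
def sigmaVertex : PiOrder (fun i => Vertex (J i)) →o Vertex (Σ i, J i) :=
  ⟨fun x p => x.val p.1 p.2, fun _ _ h p => h p.1 p.2⟩

theorem isIso_map_of_forall {C : ι → WaldCat.{u}} (G : (∀ i, C i) ⥤ D) {X Y : ∀ i, C i}
    {f : X ⟶ Y} (hf : ∀ i, IsIso (f i)) : IsIso (G.map f) :=
  have := (isIso_pi_iff f).2 hf
  G.map_isIso f

theorem isPushout_map_of_isIso {C : ι → WaldCat.{u}} {G : (∀ i, C i) ⥤ D} {X₀ X₁ X₂ X₃ : ∀ i, C i}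
    {a : X₀ ⟶ X₁} {b : X₀ ⟶ X₂} {c : X₁ ⟶ X₃} {d : X₂ ⟶ X₃}
    (sq : ∀ i, IsPushout (a i) (b i) (c i) (d i)) (ha : ∀ i, IsIso (a i)) :
    IsPushout (G.map a) (G.map b) (G.map c) (G.map d) := by
  have := isIso_map_of_forall G ha
  have := isIso_map_of_forall G fun i => (sq i).isIso_inr_of_isIso
  have hw : a ≫ c = b ≫ d := funext fun i => (sq i).w
  exact IsPushout.of_horiz_isIso ⟨by rw [← G.map_comp, hw, G.map_comp]⟩

theorem IsMultiexact.isPushout_map_comp [∀ i, Finite (J i)] (hF : IsMultiexact B D F)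
    (hG : ∀ i, IsMultiexact (fun j => A ⟨i, j⟩) (B i) (G i)) (i : ι) (j : J i)
    {X₀ X₁ X₂ X₃ : ∀ p, A p} {a : X₀ ⟶ X₁} {b : X₀ ⟶ X₂} {c : X₁ ⟶ X₃} {d : X₂ ⟶ X₃}
    (sq : ∀ p, IsPushout (a p) (b p) (c p) (d p)) (hcof : (A ⟨i, j⟩).cof (a ⟨i, j⟩))
    (hiso : ∀ p, p ≠ ⟨i, j⟩ → IsIso (a p) ∧ IsIso (b p)) :
    IsPushout ((compFunctor F G).map a) ((compFunctor F G).map b) ((compFunctor F G).map c)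
      ((compFunctor F G).map d) := by
  have hcof_i (j') : (A ⟨i, j'⟩).cof (a ⟨i, j'⟩) := by
    obtain rfl | hj := eq_or_ne j' j
    · exact hcof
    · have := (hiso ⟨i, j'⟩ fun h => hj (eq_of_heq (Sigma.mk.inj h).2)).1
      exact (A _).isWaldhausen.cof_of_isIso _ this
  have hiso_ne (i') (hi : i' ≠ i) (j') : IsIso (a ⟨i', j'⟩) ∧ IsIso (b ⟨i', j'⟩) :=
    hiso _ fun h => hi (congrArg Sigma.fst h)
  refine hF.pushout i _ _ _ _ (fun i' => ?_) ((hG i).map_cof _ hcof_i) fun i' hi => ?_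
  · obtain rfl | hi := eq_or_ne i' i
    · exact (hG i').pushout j _ _ _ _ (fun j' => sq ⟨i', j'⟩) hcof fun j' hj =>
        hiso _ fun h => hj (eq_of_heq (Sigma.mk.inj h).2)
    · exact isPushout_map_of_isIso (C := fun j' => A ⟨i', j'⟩) (fun j' => sq ⟨i', j'⟩)
        fun j' => (hiso_ne i' hi j').1
  · exact ⟨isIso_map_of_forall (C := fun j' => A ⟨i', j'⟩) (G i') fun j' => (hiso_ne i' hi j').1,
      isIso_map_of_forall (C := fun j' => A ⟨i', j'⟩) (G i') fun j' => (hiso_ne i' hi j').2⟩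

theorem IsMultiexact.comp [Finite ι] [∀ i, Finite (J i)] (hF : IsMultiexact B D F)
    (hG : ∀ i, IsMultiexact (fun j => A ⟨i, j⟩) (B i) (G i)) :
    IsMultiexact A D (compFunctor F G) where
  zero X p hX := hF.zero _ p.1 ((hG p.1).zero _ p.2 hX)
  pushout p _ _ _ _ _ _ _ _ sq hc hiso := hF.isPushout_map_comp hG p.1 p.2 sq hc hiso
  weq f hf := hF.weq _ fun i => (hG i).weq _ fun j => hf _
  cof {X Y} f hf := by
    have hgood := hF.good_prod fun i => (hG i).good (X := fun j => X ⟨i, j⟩)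
      (Y := fun j => Y ⟨i, j⟩) (fun j => f ⟨i, j⟩) fun j => hf ⟨i, j⟩
    have hsurj : Function.Surjective (sigmaVertex J) := fun y => ⟨⟨fun i j => y ⟨i, j⟩⟩, rfl⟩
    exact isGood_iff.2 <| (good_iff_of_isIso
      (HomOver.precomp (sigmaVertex J) (boxCube f ⋙ compFunctor F G))
      (fun _ _ h i j => h ⟨i, j⟩) D.isWaldhausen hsurj).2 hgood

end Composition

theorem multiexactStable : MultiexactStable.{u} where
  id := isMultiexact_idFunctor
  act e _ hF := hF.act e
  comp _ _ hF hG := hF.comp hG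

section EvaluationPushouts

variable {A B : Type*} [Category* A] [Category* B] {F₀ F₁ F₂ F₃ : A ⥤ B}
  {α : F₀ ⟶ F₁} {β : F₀ ⟶ F₂} {γ : F₁ ⟶ F₃} {δ : F₂ ⟶ F₃}
  {A₀ A₁ A₂ A₃ : A} {a : A₀ ⟶ A₁} {b : A₀ ⟶ A₂} {c : A₁ ⟶ A₃} {d : A₂ ⟶ A₃}

theorem isPushout_map_comp_app_of_isIso_app (w : α ≫ γ = β ≫ δ) (hα : IsIso α) (hβ : IsIso β)
    (hγ : IsIso γ) (sq : IsPushout (F₀.map a) (F₀.map b) (F₀.map c) (F₀.map d)) :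
    IsPushout (F₀.map a ≫ α.app A₁) (F₀.map b ≫ β.app A₂)
      (F₁.map c ≫ γ.app A₃) (F₂.map d ≫ δ.app A₃) := by
  refine sq.of_iso (Iso.refl _) (asIso (α.app A₁)) (asIso (β.app A₂))
    (asIso ((α ≫ γ).app A₃)) ?_ ?_ ?_ ?_
  · simp
  · simp
  · simp
  · simp [w]

theorem isPushout_map_comp_app_of_isIso_map (w : a ≫ c = b ≫ d) (ha : IsIso a) (hb : IsIso b)
    (hc : IsIso c) (sq : IsPushout (α.app A₃) (β.app A₃) (γ.app A₃) (δ.app A₃)) :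
    IsPushout (F₀.map a ≫ α.app A₁) (F₀.map b ≫ β.app A₂)
      (F₁.map c ≫ γ.app A₃) (F₂.map d ≫ δ.app A₃) := by
  have : IsIso d := IsIso.of_isIso_fac_left w.symm
  refine sq.of_iso (asIso (F₀.map (a ≫ c))).symm (asIso (F₁.map c)).symm (asIso (F₂.map d)).symm
    (Iso.refl _) ?_ ?_ ?_ ?_
  · simp
  · simp [w]
  · simp
  · simp

end EvaluationPushouts

section Evaluation

open Cyl

variable {ι : Type} {C : ι → WaldCat.{u}} {D : WaldCat.{u}}

theorem isIso_hom {F G : Multiexact C D} {α : F ⟶ G} (hα : IsIso α) : IsIso α.hom :=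
  have := hα
  inferInstanceAs (IsIso ((ObjectProperty.ι _).map α))

section EvCube

variable (hW : IsWaldhausen (Multiexact C D) homCof homWeq)
  {X Y : ∀ s : ι ⊕ Unit, (Sum.elim C (fun _ => internalHom C D hW) s : WaldCat.{u})} (f : X ⟶ Y)

/-- The morphism of cubes `[a]_F ⟶ [a]_G` given by a morphism `f = (a, α : F ⟶ G)` of the source
of the evaluation functor. -/
def evCubeHom : (boxCube (X := fun i => X (Sum.inl i)) (Y := fun i => Y (Sum.inl i))
    fun i => f (Sum.inl i)) ⋙ (show Multiexact C D from X (Sum.inr ())).obj ⟶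
      boxCube (fun i => f (Sum.inl i)) ⋙ (show Multiexact C D from Y (Sum.inr ())).obj :=
  let α : (X (Sum.inr ()) : Multiexact C D) ⟶ Y (Sum.inr ()) := f (Sum.inr ())
  Functor.whiskerLeft (boxCube fun i => f (Sum.inl i)) α.hom

/-- The cube `[(a, α)]_ev` has the same values as the cylinder of `[a]_F ⟶ [a]_G`. -/
def homOverEvCube :
    HomOver (cylVertexHom ι) (cyl (evCubeHom hW f)) (boxCube f ⋙ evFunctor C D hW) where
  app
    | lo _ => 𝟙 _
    | hi _ => 𝟙 _
  naturality {p q} h := by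
    rcases p with x | x <;> rcases q with y | y
    · exact (Category.comp_id _).trans ((Category.id_comp _).trans (Category.comp_id _)).symm
    · exact (Category.comp_id _).trans ((Category.id_comp _).trans
        (NatTrans.naturality _ _)).symm
    · exact (not_hi_le_lo h).elim
    · exact (Category.comp_id _).trans ((Category.id_comp _).trans (Category.comp_id _)).symm

instance : ∀ p, IsIso ((homOverEvCube hW f).app p)
  | lo x => inferInstanceAs (IsIso (𝟙 ((boxCube (fun i => f (Sum.inl i)) ⋙
      (show Multiexact C D from X (Sum.inr ())).obj).obj x)))
  | hi x => inferInstanceAs (IsIso (𝟙 ((boxCube (fun i => f (Sum.inl i)) ⋙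
      (show Multiexact C D from Y (Sum.inr ())).obj).obj x)))

end EvCube

theorem isMultiexact_evFunctor [Finite ι] (hW : IsWaldhausen (Multiexact C D) homCof homWeq) :
    IsMultiexact (Sum.elim C (fun _ : Unit => internalHom C D hW)) D (evFunctor C D hW) where
  zero X s hX := by
    let F : Multiexact C D := X (Sum.inr ())
    rcases s with i | ⟨⟩
    · exact F.property.zero (fun i => X (Sum.inl i)) i hX
    · exact isZero_app (F := F) hX _
  pushout s A₀ A₁ A₂ A₃ a b c d sq hc hiso := by
    let F : Multiexact C D := A₀ (Sum.inr ())
    have sqF : IsPushout (C := Multiexact C D) (a (Sum.inr ())) (b (Sum.inr ())) (c (Sum.inr ()))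
      (d (Sum.inr ())) := sq (Sum.inr ())
    rcases s with i | ⟨⟩
    · obtain ⟨hα, hβ⟩ : IsIso (C := Multiexact C D) (a (Sum.inr ())) ∧
        IsIso (C := Multiexact C D) (b (Sum.inr ())) := hiso (Sum.inr ()) (by simp)
      exact isPushout_map_comp_app_of_isIso_app (congrArg (·.hom) sqF.w) (isIso_hom hα)
        (isIso_hom hβ) (isIso_hom sqF.isIso_inl_of_isIso)
        (F.property.pushout i (fun i => a (Sum.inl i)) (fun i => b (Sum.inl i))
          (fun i => c (Sum.inl i)) (fun i => d (Sum.inl i)) (fun i => sq (Sum.inl i)) hc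
          fun j hj => hiso _ (by simpa using hj))
    · have ha i := (hiso (Sum.inl i) (by simp)).1
      have hb i := (hiso (Sum.inl i) (by simp)).2
      exact isPushout_map_comp_app_of_isIso_map (funext fun i => (sq (Sum.inl i)).w)
        ((isIso_pi_iff _).2 ha) ((isIso_pi_iff _).2 hb)
        ((isIso_pi_iff _).2 fun i => (sq (Sum.inl i)).isIso_inl_of_isIso)
        (homCof.isPushout_app hc sqF fun i => A₃ (Sum.inl i))
  weq {X Y} f hf := by
    let F : Multiexact C D := X (Sum.inr ())
    have hα : homWeq (C := C) (D := D) (f (Sum.inr ())) := hf (Sum.inr ())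
    exact D.isWaldhausen.weq_comp (F.property.weq (fun i => f (Sum.inl i)) fun i => hf (Sum.inl i))
      (hα _)
  cof f hf := isGood_iff.2 <|
    (good_iff_of_isIso (homOverEvCube hW f) le_of_cylVertexHom_le D.isWaldhausen
      cylVertexHom_surjective).2 ((homCof_iff _).1 (hf (Sum.inr ())) _ fun i => hf (Sum.inl i))

end Evaluation

section Currying

open Set Cyl

variable {P Q : Type*} [PartialOrder P] [PartialOrder Q] {D : Type u} [Category.{v} D]

-- `Q × P` is a category both as a partial order and as a product; the order is meant here.
local instance : Category (Q × P) := Preorder.smallCategory (Q × P)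

/-- The diagram on `Q × P` that corresponds to a diagram `W` on `Q` of diagrams on `P`. -/
def uncurryDiagram (W : Q ⥤ P ⥤ D) : Q × P ⥤ D where
  obj p := (W.obj p.1).obj p.2
  map {p q} h := (W.obj p.1).map (homOfLE (leOfHom h).2) ≫ (W.map (homOfLE (leOfHom h).1)).app q.2
  map_id p := (congrArg₂ (fun f α => f ≫ NatTrans.app α p.2) (map_homOfLE_self (W.obj p.1) _)
    (map_homOfLE_self W _)).trans (Category.comp_id _)
  map_comp {p q r} h h' := by
    rw [← map_comp_app, map_homOfLE_comp]
    rfl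

section CylOfProd

variable [OrderTop Q]

open Classical in
variable (P Q) in
/-- The monotone map that contracts everything below the top element of `Q` to `0 → 1`. -/
def cylOfProd : Q × P →o Cyl P where
  toFun p := if p.1 < ⊤ then lo p.2 else hi p.2
  monotone' p q h := by
    dsimp only
    split_ifs with hp hq hq
    exacts [h.2, h.2, (hp (h.1.trans_lt hq)).elim, h.2]

theorem cylOfProd_le_lo_iff {p : Q × P} {z : P} :
    cylOfProd P Q p ≤ lo z ↔ p.1 < ⊤ ∧ p.2 ≤ z := by
  classical
  change ite _ _ _ ≤ _ ↔ _
  split_ifs with h <;> simp [h]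

theorem cylOfProd_le_hi_iff {p : Q × P} {z : P} : cylOfProd P Q p ≤ hi z ↔ p.2 ≤ z := by
  classical
  change ite _ _ _ ≤ _ ↔ _
  split_ifs <;> simp

variable {W : Q ⥤ P ⥤ D} {L : P ⥤ D} (c : CoconeOn W (univ ∩ Iio ⊤) L) (s : L ⟶ W.obj ⊤)

/-- The morphisms from the values of `uncurryDiagram W` to those of the diagram on the cylinder
given by `s`, where `c` is a cocone under the part of `W` below the top element. -/
def toCyl (p : Q × P) : ∀ q : Cyl P, cylOfProd P Q p ≤ q →
    ((uncurryDiagram W).obj p ⟶ (cyl s).obj q)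
  | lo z, h => (W.obj p.1).map (homOfLE (cylOfProd_le_lo_iff.1 h).2) ≫
      (c.app p.1 ⟨mem_univ p.1, (cylOfProd_le_lo_iff.1 h).1⟩).app z
  | hi z, h => (W.obj p.1).map (homOfLE (cylOfProd_le_hi_iff.1 h)) ≫
      (W.map (homOfLE le_top)).app z

variable {c s}

theorem map_toCyl {p p' : Q × P} (h : p ≤ p') : ∀ {q : Cyl P} (hp' : cylOfProd P Q p' ≤ q),
    (uncurryDiagram W).map (homOfLE h) ≫ toCyl c s p' q hp' =
      toCyl c s p q (((cylOfProd P Q).monotone h).trans hp')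
  | lo z, hp' => by
    have hy : p'.1 < ⊤ := (cylOfProd_le_lo_iff.1 hp').1
    refine (map_comp_app _ _ _ _).symm.trans (congrArg (fun α => _ ≫ NatTrans.app α z) ?_)
    exact c.map_app ⟨mem_univ _, h.1.trans_lt hy⟩ ⟨mem_univ _, hy⟩ h.1
  | hi z, _ => (map_comp_app _ _ _ _).symm.trans
      (congrArg (fun α => _ ≫ NatTrans.app α z) (map_homOfLE_comp W h.1 le_top))

theorem map_comp_app_comp_map {X Y : P ⥤ D} (α : X ⟶ Y) {x y z : P} (h : x ≤ y) (h' : y ≤ z) :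
    (X.map (homOfLE h) ≫ α.app y) ≫ Y.map (homOfLE h') =
      X.map (homOfLE (h.trans h')) ≫ α.app z := by
  rw [Category.assoc, ← α.naturality, map_homOfLE_comp_assoc]

theorem toCyl_comp_map (hs : c.comp s = southernCocone W univ ⊤) {p : Q × P} :
    ∀ {q q' : Cyl P} (hp : cylOfProd P Q p ≤ q) (h : q ≤ q'),
    toCyl c s p q hp ≫ (cyl s).map (homOfLE h) = toCyl c s p q' (hp.trans h)
  | lo _, lo _, _, _ => map_comp_app_comp_map _ _ _
  | lo z, hi z', hp, h => by
    obtain ⟨hy, hx⟩ := cylOfProd_le_lo_iff.1 hp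
    have hcs : c.app p.1 ⟨mem_univ _, hy⟩ ≫ s = W.map (homOfLE le_top) :=
      congrArg (fun d : CoconeOn W (univ ∩ Iio ⊤) (W.obj ⊤) => d.app p.1 ⟨mem_univ _, hy⟩) hs
    refine Eq.trans ?_ (map_comp_app_comp_map (W.map (homOfLE le_top)) hx h)
    rw [← hcs, NatTrans.comp_app, ← Category.assoc]
    exact (Category.assoc _ _ _).symm
  | hi _, hi _, _, _ => map_comp_app_comp_map _ _ _

/-- The comparison of `uncurryDiagram W` with the diagram on the cylinder given by `s`. -/
def homOverCyl (hs : c.comp s = southernCocone W univ ⊤) :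
    HomOver (cylOfProd P Q) (uncurryDiagram W) (cyl s) where
  app p := toCyl c s p _ le_rfl
  naturality h := (map_toCyl h _).trans (toCyl_comp_map hs _ _).symm

theorem kanCocone_homOverCyl_app (hs : c.comp s = southernCocone W univ ⊤) {T : Set (Q × P)}
    {p : Q × P} {q : Cyl P} (hpT : p ∈ T) (hp : cylOfProd P Q p ≤ q) :
    (kanCocone (homOverCyl hs) T q).app p ⟨hpT, hp⟩ = toCyl c s p q hp :=
  toCyl_comp_map hs le_rfl hp

variable {a : P}

variable (Q) in
/-- The inclusion `y ↦ (y, z)`. -/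
def prodMkRight (z : P) : Q →o Q × P := ⟨fun y => (y, z), fun _ _ h => Prod.mk_le_mk.2 ⟨h, le_rfl⟩⟩

/-- The inclusion of the diagram formed by the values of `W` at `z`. -/
def homOverEvaluation (W : Q ⥤ P ⥤ D) (z : P) :
    HomOver (prodMkRight Q z) (W ⋙ (evaluation _ _).obj z) (uncurryDiagram W) where
  app y := 𝟙 ((W.obj y).obj z)
  naturality {y _} h := (Category.comp_id _).trans
    ((Category.id_comp _).trans ((congrArg (· ≫ (W.map (homOfLE h)).app z)
      ((W.obj y).map_id z)).trans (Category.id_comp _))).symm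

instance (y : Q) (z : P) : IsIso ((homOverEvaluation W z).app y) :=
  inferInstanceAs (IsIso (𝟙 ((W.obj y).obj z)))

theorem isUniversal_kanCocone_homOverCyl_lo (hs : c.comp s = southernCocone W univ ⊤) {z : P}
    (hz : a ≤ z) (hc : (c.image ((evaluation _ _).obj z)).IsUniversal) :
    (kanCocone (homOverCyl hs) (Prod.snd ⁻¹' Ici a) (lo z)).IsUniversal := by
  have hle {y : Q} (hy : y < ⊤) : cylOfProd P Q (y, z) ≤ lo z :=
    cylOfProd_le_lo_iff.2 ⟨hy, le_rfl⟩
  have hsub : prodMkRight Q z '' (univ ∩ Iio ⊤) ⊆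
      Prod.snd ⁻¹' Ici a ∩ cylOfProd P Q ⁻¹' Iic (lo z) :=
    image_subset_iff.2 fun y hy => ⟨hz, hle hy.2⟩
  refine (CoconeOn.isUniversal_restrict_iff_of_isLeast hsub fun p hp => ?_).1 ?_
  · obtain ⟨hy, hx⟩ := cylOfProd_le_lo_iff.1 hp.2
    refine ⟨(p.1, z), ⟨⟨p.1, ⟨mem_univ _, hy⟩, rfl⟩, le_rfl, hx⟩, ?_⟩
    rintro _ ⟨⟨y, -, rfl⟩, hpy⟩
    exact ⟨hpy.1, le_rfl⟩
  · refine (isKan_of_isIso (homOverEvaluation W z) (fun _ _ h => h.1)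
      _).isUniversal_pullback_iff.1 ((congrArg CoconeOn.IsUniversal ?_).mp hc)
    ext y hy
    have happ : (kanCocone (homOverCyl hs) (Prod.snd ⁻¹' Ici a) (lo z)).app (y, z)
        ⟨hz, hle hy.2⟩ = (c.app y hy).app z :=
      (kanCocone_homOverCyl_app hs hz (hle hy.2)).trans ((congrArg (· ≫ (c.app y hy).app z)
        ((W.obj y).map_id z)).trans (Category.id_comp _))
    exact happ.symm.trans (Category.id_comp _).symm

theorem isUniversal_kanCocone_homOverCyl_hi (hs : c.comp s = southernCocone W univ ⊤) {z : P}
    (hz : a ≤ z) : (kanCocone (homOverCyl hs) (Prod.snd ⁻¹' Ici a) (hi z)).IsUniversal := by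
  have hle : cylOfProd P Q (⊤, z) ≤ hi z := cylOfProd_le_hi_iff.2 le_rfl
  refine CoconeOn.isUniversal_of_isGreatest (b := (⊤, z))
    ⟨⟨hz, hle⟩, fun p hp => ⟨le_top, cylOfProd_le_hi_iff.1 hp.2⟩⟩ ?_
  rw [kanCocone_homOverCyl_app hs hz hle]
  exact inferInstanceAs (IsIso ((W.obj ⊤).map (𝟙 z) ≫ (W.map (𝟙 ⊤)).app z))

theorem CofTrans.of_reedy_uncurryDiagram {cof weq : MorphismProperty D} [Finite P] [Finite Q]
    (hD : IsWaldhausen D cof weq)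
    (hc : ∀ x, (c.image ((evaluation _ _).obj x)).IsUniversal)
    (hs : c.comp s = southernCocone W univ ⊤)
    (hR : ∀ a, Reedy cof (uncurryDiagram W) (Prod.snd ⁻¹' Ici a)) : CofTrans cof s := by
  classical
  refine CofTrans.of_reedy hD fun a =>
    IsKan.reedy (η := homOverCyl hs) (T := Prod.snd ⁻¹' Ici a) hD ⟨fun p hp => ?_, ?_⟩ (hR a)
  · change lo a ≤ ite _ _ _
    split_ifs <;> exact hp
  · rintro (z | z) hz
    · exact isUniversal_kanCocone_homOverCyl_lo hs hz (hc z)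
    · exact isUniversal_kanCocone_homOverCyl_hi hs hz

end CylOfProd

variable {ι : Type} {C : ι → WaldCat.{u}} {D : WaldCat.{u}}

/-- The functor `F ↦ [f]_F`, where `f` is a tuple of arrows. -/
def evalCube {A B : ∀ i, C i} (f : ∀ i, A i ⟶ B i) : Multiexact C D ⥤ Vertex ι ⥤ D :=
  ObjectProperty.ι _ ⋙ (Functor.whiskeringLeft _ _ D.carrier).obj (boxCube f)

variable [Finite ι] {Q : Type} [PartialOrder Q] [Finite Q] {V : Q ⥤ Multiexact C D}

theorem cofAt_top_of_good_uncurryDiagram [BoundedOrder Q]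
    (hW : IsWaldhausen (Multiexact C D) homCof homWeq)
    (hV : ∀ {A B : ∀ i, C i} (f : ∀ i, A i ⟶ B i), (∀ i, (C i).cof (f i)) →
      Good D.cof (uncurryDiagram (V ⋙ evalCube f)))
    (hR : Reedy homCof V (univ ∩ Iio ⊤)) : CofAt homCof V univ ⊤ := by
  obtain ⟨L, c, hc⟩ := hR.exists_isUniversal hW
  refine ⟨L, c, hc, (homCof_iff _).2 fun f hf => ?_⟩
  refine CofTrans.of_reedy_uncurryDiagram (c := c.image (evalCube f)) D.isWaldhausen
    (fun x => (preservesCof_evalAt ((boxCube f).obj x)).isUniversal_image hW hR hc) ?_ fun a => ?_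
  · exact CoconeOn.ext (funext₂ fun y hy => ((evalCube f).map_comp _ _).symm.trans
      ((evalCube f).congr_map (hc.app_desc _ hy)))
  · have hset : (Ici (⊥, a) : Set (Q × Vertex ι)) = Prod.snd ⁻¹' Ici a :=
      Set.ext fun p => ⟨fun h => h.2, fun h => ⟨bot_le, h⟩⟩
    exact hset ▸ hV f hf (⊥, a)

theorem good_of_good_uncurryDiagram
    (hW : IsWaldhausen (Multiexact C D) homCof homWeq)
    (hV : ∀ {A B : ∀ i, C i} (f : ∀ i, A i ⟶ B i), (∀ i, (C i).cof (f i)) →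
      Good D.cof (uncurryDiagram (V ⋙ evalCube f))) : Good homCof V := by
  intro a b hab
  induction b using WellFoundedLT.induction with
  | ind b ih =>
  have : Fact (a ≤ b) := ⟨hab⟩
  let m : Icc a b →o Q := OrderHom.Subtype.val _
  have hm : ∀ ⦃x y⦄, m x ≤ m y → x ≤ y := fun _ _ h => h
  have himage : m '' (univ ∩ Iio ⊤) = Ici a ∩ Iio b := by
    rw [← image_inter_Iio_eq hm, image_univ]
    exact Set.ext fun x => ⟨fun ⟨⟨y, hy⟩, hx⟩ => ⟨hy ▸ y.2.1, hx⟩,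
      fun hx => ⟨⟨⟨x, hx.1, le_of_lt hx.2⟩, rfl⟩, hx.2⟩⟩
  refine (cofAt_iff_of_isIso (HomOver.precomp m V) hm hW himage.symm).2
    (cofAt_top_of_good_uncurryDiagram hW (fun f hf => ?_) ?_)
  · let m' : Icc a b × Vertex ι →o Q × Vertex ι := OrderHom.prodMap m OrderHom.id
    refine Good.of_isIso (HomOver.precomp m' (uncurryDiagram (V ⋙ evalCube f))) (fun _ _ h => h)
      D.isWaldhausen ⟨?_⟩ (hV f hf)
    rintro _ ⟨x, rfl⟩ _ ⟨y, rfl⟩ z hz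
    exact ⟨(⟨z.1, x.1.2.1.trans hz.1.1, hz.2.1.trans y.1.2.2⟩, z.2), rfl⟩
  · rw [← reedy_image_iff_of_isIso (HomOver.precomp m V) hm hW, himage]
    exact fun y hy => (ih y hy.2 hy.1).congr
      (inter_Iio_eq_of_isRelLowerSet (isRelLowerSet_inter_Iio _ b) hy)

end Currying

section MultiexactCurrying

open Set

variable {ι κ : Type} {D : WaldCat.{u}}

/-- The functor `X ↦ K (E₂ X) (E₁ X)`. -/
def evalAlong {C : ι → WaldCat.{u}} {A B : Type*} [Category* A] [Category* B]
    (E₁ : A ⥤ ∀ i, C i) (E₂ : A ⥤ B) (K : B ⥤ Multiexact C D) : A ⥤ D where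
  obj X := (K.obj (E₂.obj X)).obj.obj (E₁.obj X)
  map {X Y} f := (K.obj (E₂.obj X)).obj.map (E₁.map f) ≫ (K.map (E₂.map f)).hom.app (E₁.obj Y)
  map_id X := by simp
  map_comp f g := by
    rw [E₁.map_comp, E₂.map_comp, K.map_comp]
    exact map_comp_app _ _ _ _

variable {C : ι ⊕ κ → WaldCat.{u}}

/-- The functor of the variables in `ι ⊕ κ` given by a functor from `∏ C (inr k)` to multiexact
functors on `∏ C (inl i)`. -/
def uncurryHom (K : (∀ k, C (Sum.inr k)) ⥤ Multiexact (fun i => C (Sum.inl i)) D) :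
    (∀ s, C s) ⥤ D :=
  evalAlong (C := fun i => C (Sum.inl i)) (Pi.comap (fun s => (C s).carrier) Sum.inl)
    (Pi.comap (fun s => (C s).carrier) Sum.inr) K

/-- The concatenation of two tuples of objects. -/
def pairObj (X : ∀ i, C (Sum.inl i)) (Y : ∀ k, C (Sum.inr k)) : ∀ s, C s
  | Sum.inl i => X i
  | Sum.inr k => Y k

section PairHom

variable {X X' X'' : ∀ i, C (Sum.inl i)} {Y Y' Y'' : ∀ k, C (Sum.inr k)}

/-- The concatenation of two tuples of morphisms. -/
def pairHom (f : X ⟶ X') (g : Y ⟶ Y') : pairObj X Y ⟶ pairObj X' Y' := fun s =>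
  match s with
  | Sum.inl i => f i
  | Sum.inr k => g k

variable (X Y) in
theorem pairHom_id : pairHom (𝟙 X) (𝟙 Y) = 𝟙 (pairObj X Y) := by
  funext s
  rcases s with i | k <;> rfl

theorem pairHom_comp (f : X ⟶ X') (g : Y ⟶ Y') (f' : X' ⟶ X'') (g' : Y' ⟶ Y'') :
    pairHom f g ≫ pairHom f' g' = pairHom (f ≫ f') (g ≫ g') := by
  funext s
  rcases s with i | k <;> rfl

theorem cof_pairHom {f : X ⟶ X'} {g : Y ⟶ Y'} (hf : ∀ i, (C (Sum.inl i)).cof (f i))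
    (hg : ∀ k, (C (Sum.inr k)).cof (g k)) : ∀ s, (C s).cof (pairHom f g s)
  | Sum.inl i => hf i
  | Sum.inr k => hg k

theorem weq_pairHom {f : X ⟶ X'} {g : Y ⟶ Y'} (hf : ∀ i, (C (Sum.inl i)).weq (f i))
    (hg : ∀ k, (C (Sum.inr k)).weq (g k)) : ∀ s, (C s).weq (pairHom f g s)
  | Sum.inl i => hf i
  | Sum.inr k => hg k

end PairHom

/-- The concatenation of two vertices. -/
def pairVertex : Vertex κ × Vertex ι →o Vertex (ι ⊕ κ) where
  toFun p := Sum.elim p.2 p.1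
  monotone' _ _ h
    | Sum.inl i => h.2 i
    | Sum.inr k => h.1 k

theorem le_of_pairVertex_le {p q : Vertex κ × Vertex ι} (h : pairVertex p ≤ pairVertex q) :
    p ≤ q :=
  ⟨fun k => h (Sum.inr k), fun i => h (Sum.inl i)⟩

theorem pairVertex_surjective : Function.Surjective (pairVertex (ι := ι) (κ := κ)) := fun x =>
  ⟨(fun k => x (Sum.inr k), fun i => x (Sum.inl i)), funext fun s => by rcases s with i | k <;> rfl⟩

variable {K : (∀ k, C (Sum.inr k)) ⥤ Multiexact (fun i => C (Sum.inl i)) D}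

theorem uncurryHom_map_pairHom_id (X : ∀ i, C (Sum.inl i)) {Y Y' : ∀ k, C (Sum.inr k)}
    (g : Y ⟶ Y') : (uncurryHom K).map (pairHom (𝟙 X) g) = (K.map g).hom.app X :=
  (congrArg (· ≫ (K.map g).hom.app X) ((K.obj Y).obj.map_id X)).trans (Category.id_comp _)

variable (K) in
/-- The cube of cubes `([f]_{K y})`, where `y` runs over the vertices of `g`, compared with the cube
of the uncurried functor. -/
def homOverPairVertex {X X' : ∀ i, C (Sum.inl i)} {Y Y' : ∀ k, C (Sum.inr k)} (f : X ⟶ X')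
    (g : Y ⟶ Y') : HomOver pairVertex (uncurryDiagram ((boxCube g ⋙ K) ⋙ evalCube f))
      (boxCube (pairHom f g) ⋙ uncurryHom K) where
  app p := 𝟙 ((K.obj ((boxCube g).obj p.1)).obj.obj ((boxCube f).obj p.2))
  naturality _ := (Category.comp_id _).trans (Category.id_comp _).symm

theorem IsMultiexact.good_uncurryDiagram [Finite ι] [Finite κ] (h : IsMultiexact C D (uncurryHom K))
    {X X' : ∀ i, C (Sum.inl i)} {Y Y' : ∀ k, C (Sum.inr k)} {f : X ⟶ X'} {g : Y ⟶ Y'}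
    (hf : ∀ i, (C (Sum.inl i)).cof (f i)) (hg : ∀ k, (C (Sum.inr k)).cof (g k)) :
    Good D.cof (uncurryDiagram ((boxCube g ⋙ K) ⋙ evalCube f)) := by
  have (p : Vertex κ × Vertex ι) : IsIso ((homOverPairVertex K f g).app p) :=
    inferInstanceAs (IsIso (𝟙 ((K.obj ((boxCube g).obj p.1)).obj.obj ((boxCube f).obj p.2))))
  exact (good_iff_of_isIso (homOverPairVertex K f g) (fun _ _ h => le_of_pairVertex_le h)
    D.isWaldhausen pairVertex_surjective).1 (h.good (pairHom f g) (cof_pairHom hf hg))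

theorem isMultiexact_of_uncurryHom [Finite ι] [Finite κ]
    (hW : IsWaldhausen (Multiexact (fun i => C (Sum.inl i)) D) homCof homWeq)
    (h : IsMultiexact C D (uncurryHom K)) :
    IsMultiexact (fun k => C (Sum.inr k)) (internalHom (fun i => C (Sum.inl i)) D hW) K where
  zero Y k hY := isZero_of_app fun X => h.zero (pairObj X Y) (Sum.inr k) hY
  pushout k A₀ A₁ A₂ A₃ a b c d sq hc hiso := isPushout_of_app fun X => by
    rw [← uncurryHom_map_pairHom_id, ← uncurryHom_map_pairHom_id, ← uncurryHom_map_pairHom_id,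
      ← uncurryHom_map_pairHom_id]
    refine h.pushout (Sum.inr k) _ _ _ _ ?_ hc ?_
    · rintro (i | k)
      · exact IsPushout.of_id_fst (f := 𝟙 (X i))
      · exact sq k
    · rintro (i | k') hk
      · exact ⟨inferInstanceAs (IsIso (𝟙 (X i))), inferInstanceAs (IsIso (𝟙 (X i)))⟩
      · exact hiso k' (by simpa using hk)
  weq g hg X := by
    rw [← uncurryHom_map_pairHom_id]
    exact h.weq _ (weq_pairHom (fun i => (C (Sum.inl i)).weq_id (X i)) hg)
  cof g hg := isGood_iff.2 <|
    good_of_good_uncurryDiagram hW fun _ hf => h.good_uncurryDiagram hf hg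

/-- The functor adding a constant tuple of objects. -/
def pairLeft (A : ∀ k, C (Sum.inr k)) : (∀ i, C (Sum.inl i)) ⥤ ∀ s, C s where
  obj X := pairObj X A
  map f := pairHom f (𝟙 A)
  map_id X := pairHom_id X A
  map_comp f g := by rw [pairHom_comp, Category.comp_id]

variable (ι κ) in
/-- The inclusion of the face of the `(ι ⊕ κ)`-cube on which the coordinates in `κ` are `0`. -/
def zeroFace : Vertex ι →o Vertex (ι ⊕ κ) where
  toFun x := Sum.elim x 0
  monotone' _ _ h
    | Sum.inl i => h i
    | Sum.inr _ => le_rfl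

theorem ordConnected_range_zeroFace : (range (zeroFace ι κ)).OrdConnected := by
  refine IsLowerSet.ordConnected fun x y hyx hx => ?_
  obtain ⟨z, rfl⟩ := hx
  refine ⟨fun i => y (Sum.inl i), funext fun s => ?_⟩
  rcases s with i | k
  · rfl
  · exact (Fin.le_zero_iff.1 (hyx (Sum.inr k))).symm

/-- The cube of `f` with the constant tuple `A` added, as a face of the cube of `f` and `𝟙 A`. -/
def homOverZeroFace (A : ∀ k, C (Sum.inr k)) {X Y : ∀ i, C (Sum.inl i)} (f : X ⟶ Y) :
    HomOver (zeroFace ι κ) (boxCube f ⋙ pairLeft A) (boxCube (pairHom f (𝟙 A))) where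
  app x s := match s with
    | Sum.inl i => 𝟙 ((boxCube f).obj x i)
    | Sum.inr k => 𝟙 (A k)
  naturality h := by
    funext s
    rcases s with i | k
    · exact (Category.comp_id _).trans (Category.id_comp _).symm
    · exact (Category.comp_id _).trans (Category.id_comp _).symm

theorem isIso_homOverZeroFace_app (A : ∀ k, C (Sum.inr k)) {X Y : ∀ i, C (Sum.inl i)} (f : X ⟶ Y)
    (x : Vertex ι) : IsIso ((homOverZeroFace A f).app x) :=
  (isIso_pi_iff _).2 fun
    | Sum.inl i => inferInstanceAs (IsIso (𝟙 ((boxCube f).obj x i)))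
    | Sum.inr k => inferInstanceAs (IsIso (𝟙 (A k)))

variable {F : (∀ s, C s) ⥤ D}

theorem IsMultiexact.pairLeft [Finite ι] [Finite κ] (hF : IsMultiexact C D F)
    (A : ∀ k, C (Sum.inr k)) : IsMultiexact (fun i => C (Sum.inl i)) D (pairLeft A ⋙ F) where
  zero X i hX := hF.zero (pairObj X A) (Sum.inl i) hX
  pushout i _ _ _ _ a b c d sq hc hiso := by
    refine hF.pushout (Sum.inl i) _ _ _ _ ?_ hc ?_
    · rintro (i | k)
      · exact sq i
      · exact IsPushout.of_id_fst (f := 𝟙 (A k))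
    · rintro (i' | k) hi
      · exact hiso i' (by simpa using hi)
      · exact ⟨inferInstanceAs (IsIso (𝟙 (A k))), inferInstanceAs (IsIso (𝟙 (A k)))⟩
  weq f hf := hF.weq _ (weq_pairHom hf fun k => (C (Sum.inr k)).weq_id (A k))
  cof f hf := isGood_iff.2 <| by
    have (x : Vertex ι) : IsIso (((homOverZeroFace A f).image F).app x) :=
      have := isIso_homOverZeroFace_app A f x
      inferInstanceAs (IsIso (F.map _))
    exact Good.of_isIso ((homOverZeroFace A f).image F) (fun _ _ h i => h (Sum.inl i))
      D.isWaldhausen ordConnected_range_zeroFace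
      (hF.good (pairHom f (𝟙 A)) (cof_pairHom hf fun k => (C (Sum.inr k)).cof_id (A k)))

/-- The functor to multiexact functors given by a multiexact functor of all variables. -/
def curryHom [Finite ι] [Finite κ] (hF : IsMultiexact C D F) :
    (∀ k, C (Sum.inr k)) ⥤ Multiexact (fun i => C (Sum.inl i)) D where
  obj A := ⟨pairLeft A ⋙ F, hF.pairLeft A⟩
  map {A B} g := ObjectProperty.homMk
    { app := fun X => F.map (pairHom (𝟙 X) g)
      naturality := fun X Y f => by
        change F.map (pairHom f (𝟙 A)) ≫ F.map (pairHom (𝟙 Y) g) =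
          F.map (pairHom (𝟙 X) g) ≫ F.map (pairHom f (𝟙 B))
        rw [← F.map_comp, ← F.map_comp, pairHom_comp, pairHom_comp]
        simp }
  map_id A := ObjectProperty.hom_ext _ (NatTrans.ext (funext fun X =>
    (congrArg F.map (pairHom_id X A)).trans (F.map_id _)))
  map_comp {A B B'} g g' := ObjectProperty.hom_ext _ (NatTrans.ext (funext fun X => by
    change F.map (pairHom (𝟙 X) (g ≫ g')) = F.map (pairHom (𝟙 X) g) ≫ F.map (pairHom (𝟙 X) g')
    rw [← F.map_comp, pairHom_comp, Category.comp_id]))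

theorem uncurryHom_curryHom [Finite ι] [Finite κ] (hF : IsMultiexact C D F) :
    uncurryHom (curryHom hF) = F := by
  let J : (∀ s, C s) ⥤ ∀ s, C s :=
    { obj := fun X => pairObj (fun i => X (Sum.inl i)) fun k => X (Sum.inr k)
      map := fun f => pairHom (fun i => f (Sum.inl i)) fun k => f (Sum.inr k)
      map_id := fun X => pairHom_id _ _
      map_comp := fun f g => (pairHom_comp _ _ _ _).symm }
  have hJ : J = 𝟭 _ := Functor.pi_ext _ _ fun s => by rcases s with i | k <;> rfl
  have h : uncurryHom (curryHom hF) = J ⋙ F :=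
    Functor.hext (fun _ => rfl) fun X Y f => heq_of_eq <| by
      refine (F.map_comp _ _).symm.trans (congrArg F.map ?_)
      refine (pairHom_comp _ _ _ _).trans ?_
      exact congrArg₂ pairHom (Category.comp_id _) (Category.id_comp _)
  rw [h, hJ]
  rfl

theorem eqToHom_hom_app {C : ι → WaldCat.{u}} {F G : Multiexact C D} (h : F = G)
    (X : ∀ i, C i) : (eqToHom h).hom.app X = eqToHom (congrArg (fun F => F.obj.obj X) h) := by
  subst h
  rfl

theorem curryHom_uncurryHom [Finite ι] [Finite κ] (h : IsMultiexact C D (uncurryHom K)) :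
    curryHom h = K := by
  refine CategoryTheory.Functor.ext (fun A => ObjectProperty.FullSubcategory.ext ?_) fun A B g => ?_
  · refine Functor.hext (fun _ => rfl) fun X Y f => heq_of_eq ?_
    refine (congrArg (fun z => _ ≫ z.hom.app Y) (K.map_id A)).trans ?_
    exact Category.comp_id _
  · refine ObjectProperty.hom_ext _ (NatTrans.ext (funext fun X => ?_))
    refine (uncurryHom_map_pairHom_id X g).trans ?_
    rw [ObjectProperty.FullSubcategory.comp_hom, ObjectProperty.FullSubcategory.comp_hom,
      NatTrans.comp_app, NatTrans.comp_app, eqToHom_hom_app, eqToHom_hom_app]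
    refine Eq.trans ?_ (Category.id_comp _).symm
    exact (Category.comp_id _).symm

end MultiexactCurrying

section UncurryMultiexact

variable {ι κ : Type} {C : ι ⊕ κ → WaldCat.{u}} {D : WaldCat.{u}}

/-- The functor `ev ∘ (1, …, 1, K)` for a functor `K` with values in multiexact functors. -/
def evComp (hW : IsWaldhausen (Multiexact (fun i => C (Sum.inl i)) D) homCof homWeq)
    (K : (∀ k, C (Sum.inr k)) ⥤ internalHom (fun i => C (Sum.inl i)) D hW) :
    (∀ p, C (evInputsEquiv ι κ p)) ⥤ D :=
  compFunctor (J := EvInputs ι κ) (A := fun p => C (evInputsEquiv ι κ p))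
    (evFunctor (fun i => C (Sum.inl i)) D hW) fun s => match s with
      | Sum.inl i => idFunctor (C (Sum.inl i))
      | Sum.inr _ => K

theorem comap_evComp (hW : IsWaldhausen (Multiexact (fun i => C (Sum.inl i)) D) homCof homWeq)
    (K : (∀ k, C (Sum.inr k)) ⥤ internalHom (fun i => C (Sum.inl i)) D hW) :
    Pi.comap (fun s => (C s).carrier) (evInputsEquiv ι κ) ⋙ evComp hW K = uncurryHom K := rfl

theorem isMultiexact_uncurryHom [Finite ι] [Finite κ]
    (hW : IsWaldhausen (Multiexact (fun i => C (Sum.inl i)) D) homCof homWeq)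
    {K : (∀ k, C (Sum.inr k)) ⥤ Multiexact (fun i => C (Sum.inl i)) D}
    (hK : IsMultiexact (fun k => C (Sum.inr k)) (internalHom (fun i => C (Sum.inl i)) D hW) K) :
    IsMultiexact C D (uncurryHom K) := by
  have : Finite (Σ s, EvInputs ι κ s) := Finite.of_equiv _ (evInputsEquiv ι κ).symm
  rw [← comap_evComp hW K]
  refine IsMultiexact.comap (IsMultiexact.comp (isMultiexact_evFunctor hW) fun s => ?_)
  rcases s with i | ⟨⟩
  · exact isMultiexact_idFunctor (C (Sum.inl i))
  · exact hK

end UncurryMultiexact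

section HomAct

variable {ι ι' : Type} [Finite ι] [Finite ι'] (C : ι → WaldCat.{u}) (D : WaldCat.{u})

theorem isMultiexact_homActFunctor (h : MultiexactStable.{u})
    (hW : IsWaldhausen (Multiexact C D) homCof homWeq) (e : ι' ≃ ι)
    (hW' : IsWaldhausen (Multiexact (fun j => C (e j)) D) homCof homWeq) :
    IsMultiexact (fun _ : Unit => internalHom C D hW) (internalHom (fun j => C (e j)) D hW')
      (homActFunctor h C D e) := by
  let C' : ι ⊕ Unit → WaldCat.{u} := Sum.elim C fun _ => internalHom C D hW
  have comap_uncurryHom : Pi.comap (fun s => (C' s).carrier) (Equiv.sumCongr e (Equiv.refl Unit)) ⋙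
      uncurryHom (C := fun s => C' (Equiv.sumCongr e (Equiv.refl Unit) s))
        (homActFunctor h C D e) = evFunctor C D hW :=
    congrArg (fun E => evalAlong (C := C) (Pi.comap (fun s => (C' s).carrier) Sum.inl ⋙ E)
      (Pi.eval (fun s => (C' s).carrier) (Sum.inr ())) (𝟭 (Multiexact C D))) (comap_permute C e)
  refine isMultiexact_of_uncurryHom
    (C := fun s => C' (Equiv.sumCongr e (Equiv.refl Unit) s)) hW' (IsMultiexact.of_comap ?_)
  rw [comap_uncurryHom]
  exact isMultiexact_evFunctor hW

end HomAct

section Composition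

variable {ι : Type} {J : ι → Type}

/-- The index sets of the inputs of `ev ∘ (ev, …, ev, 1)`, where the `i`-th inner evaluation takes
the objects indexed by `J i` and a functor, and the identity takes a functor. -/
def CompInputs (J : ι → Type) : ι ⊕ Unit → Type
  | Sum.inl i => J i ⊕ Unit
  | Sum.inr _ => Unit

instance [∀ i, Finite (J i)] : ∀ s, Finite (CompInputs J s)
  | Sum.inl i => inferInstanceAs (Finite (J i ⊕ Unit))
  | Sum.inr _ => inferInstanceAs (Finite Unit)

/-- The inputs of `ev ∘ (ev, …, ev, 1)`, separated into objects and functors. -/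
def compInputsEquiv (J : ι → Type) : (Σ s, CompInputs J s) ≃ (Σ i, J i) ⊕ (Unit ⊕ ι) where
  toFun
    | ⟨Sum.inl i, Sum.inl j⟩ => Sum.inl ⟨i, j⟩
    | ⟨Sum.inl i, Sum.inr _⟩ => Sum.inr (Sum.inr i)
    | ⟨Sum.inr _, _⟩ => Sum.inr (Sum.inl ())
  invFun
    | Sum.inl p => ⟨Sum.inl p.1, Sum.inl p.2⟩
    | Sum.inr (Sum.inr i) => ⟨Sum.inl i, Sum.inr ()⟩
    | Sum.inr (Sum.inl _) => ⟨Sum.inr (), ()⟩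
  left_inv := by rintro ⟨_ | _, _ | _⟩ <;> rfl
  right_inv := by rintro (_ | _ | _) <;> rfl

variable [Finite ι] [∀ i, Finite (J i)]
  (hW : ∀ {ι : Type} [Finite ι] (C : ι → WaldCat.{u}) (D : WaldCat.{u}),
    IsWaldhausen (Multiexact C D) homCof homWeq)
  (A : (Σ i, J i) → WaldCat.{u}) (B : ι → WaldCat.{u}) (D : WaldCat.{u})

/-- The Waldhausen categories in which the inputs of `ev ∘ (ev, …, ev, 1)` live: the objects in the
`A p`, the outer functor in `WaldCat(B; D)` and the `i`-th inner functor in `WaldCat(A i; B i)`. -/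
def compSource : (Σ i, J i) ⊕ (Unit ⊕ ι) → WaldCat.{u} :=
  Sum.elim A (Sum.elim (fun _ : Unit => internalHom B D (hW B D))
    fun i => internalHom (fun j => A ⟨i, j⟩) (B i) (hW _ (B i)))

/-- The inner functors of `ev ∘ (ev, …, ev, 1)`; the evaluations are written as uncurried
identities. -/
def innerEvaluations : ∀ s : ι ⊕ Unit,
    (∀ j, compSource hW A B D (compInputsEquiv J ⟨s, j⟩)) ⥤
      (Sum.elim B (fun _ : Unit => internalHom B D (hW B D)) s : WaldCat.{u})
  | Sum.inl i => uncurryHom (ι := J i) (κ := Unit)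
      (C := fun j => compSource hW A B D (compInputsEquiv J ⟨Sum.inl i, j⟩)) (D := B i)
      (idFunctor (internalHom (fun j => A ⟨i, j⟩) (B i) (hW _ (B i))))
  | Sum.inr _ => idFunctor (internalHom B D (hW B D))

theorem isMultiexact_innerEvaluations :
    ∀ s, IsMultiexact (fun j => compSource hW A B D (compInputsEquiv J ⟨s, j⟩)) _
      (innerEvaluations hW A B D s)
  | Sum.inl i => isMultiexact_uncurryHom (ι := J i) (κ := Unit)
      (C := fun j => compSource hW A B D (compInputsEquiv J ⟨Sum.inl i, j⟩))
      (hW _ _) (isMultiexact_idFunctor _)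
  | Sum.inr _ => isMultiexact_idFunctor _

theorem uncurryHom_compositionFunctor (h : MultiexactStable.{u}) :
    uncurryHom (C := compSource hW A B D) (compositionFunctor h hW A B D) =
      Pi.comap (fun s => (compSource hW A B D s).carrier) (compInputsEquiv J) ⋙
        compFunctor (A := fun p => compSource hW A B D (compInputsEquiv J p))
          (evFunctor B D (hW B D)) (innerEvaluations hW A B D) :=
  CategoryTheory.Functor.hext (fun _ => rfl) fun X Y f => heq_of_eq <| by
    let F : Multiexact B D := X (Sum.inr (Sum.inl ()))
    let F' : Multiexact B D := Y (Sum.inr (Sum.inl ()))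
    let α : F ⟶ F' := f (Sum.inr (Sum.inl ()))
    refine Eq.trans (congrArg (F.obj.map _ ≫ ·) (α.hom.naturality _).symm) ?_
    refine (Category.assoc _ _ _).symm.trans (congrArg (· ≫ α.hom.app _) ?_)
    exact (F.obj.map_comp _ _).symm

theorem isMultiexact_compositionFunctor (h : MultiexactStable.{u}) :
    IsMultiexact (Sum.elim (fun _ : Unit => internalHom B D (hW B D))
        (fun i => internalHom (fun j => A ⟨i, j⟩) (B i) (hW _ (B i))))
      (internalHom A D (hW A D)) (compositionFunctor h hW A B D) := by
  refine isMultiexact_of_uncurryHom (C := compSource hW A B D) (hW A D) ?_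
  rw [uncurryHom_compositionFunctor]
  exact IsMultiexact.comap (IsMultiexact.comp (isMultiexact_evFunctor (hW B D))
    (isMultiexact_innerEvaluations hW A B D))

end Composition

section SymmetricMulticategory

variable {ι : Type} {D : WaldCat.{u}}

theorem actFunctor_actFunctor {ι' ι'' : Type} {C : ι → WaldCat.{u}} (e : ι' ≃ ι) (e' : ι'' ≃ ι')
    (F : (∀ i, C i) ⥤ D) : actFunctor e' (actFunctor e F) = actFunctor (e'.trans e) F :=
  eq_actFunctor (e := e'.trans e) <| by
    change Pi.comap (fun i => (C i).carrier) e ⋙ Pi.comap (fun j => (C (e j)).carrier) e' ⋙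
      actFunctor e' (actFunctor e F) = F
    rw [comap_actFunctor, comap_actFunctor]

theorem compFunctor_actFunctor_left {ι' : Type} {J : ι → Type} {A : (Σ i, J i) → WaldCat.{u}}
    {B : ι → WaldCat.{u}} (e : ι' ≃ ι) (F : (∀ i, B i) ⥤ D)
    (G : ∀ i, (∀ j, A ⟨i, j⟩) ⥤ B i) :
    compFunctor (A := fun p : (Σ i', J (e i')) => A ⟨e p.1, p.2⟩) (actFunctor e F)
      (fun i' => G (e i')) = actFunctor (Equiv.sigmaCongrLeft e) (compFunctor F G) :=
  eq_actFunctor (e := Equiv.sigmaCongrLeft e) <| by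
    change Functor.pi' (fun i => Pi.comap (fun p => (A p).carrier) (Sigma.mk i) ⋙ G i) ⋙
      Pi.comap (fun i => (B i).carrier) e ⋙ actFunctor e F = _
    rw [comap_actFunctor]
    rfl

theorem compFunctor_actFunctor_right {J J' : ι → Type} {A : (Σ i, J i) → WaldCat.{u}}
    {B : ι → WaldCat.{u}} (e : ∀ i, J' i ≃ J i) (F : (∀ i, B i) ⥤ D)
    (G : ∀ i, (∀ j, A ⟨i, j⟩) ⥤ B i) :
    compFunctor (A := fun p : (Σ i, J' i) => A ⟨p.1, e p.1 p.2⟩) F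
      (fun i => actFunctor (C := fun j => A ⟨i, j⟩) (e i) (G i)) =
      actFunctor (Equiv.sigmaCongrRight e) (compFunctor F G) :=
  eq_actFunctor (e := Equiv.sigmaCongrRight e) <| by
    have inner_eq : (fun i => Pi.comap (fun p => (A p).carrier) (Sigma.mk i) ⋙
        Pi.comap (fun j => (A ⟨i, j⟩).carrier) (e i) ⋙
          actFunctor (C := fun j => A ⟨i, j⟩) (e i) (G i)) =
        fun i => Pi.comap (fun p => (A p).carrier) (Sigma.mk i) ⋙ G i :=
      funext fun i => by rw [comap_actFunctor]
    exact congrArg (fun H => Functor.pi' H ⋙ F) inner_eq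

theorem multiexact_ext {C : ι → WaldCat.{u}} {F G : Multiexact C D} (e : F.obj = G.obj) : F = G :=
  ObjectProperty.FullSubcategory.ext e

theorem isSymmetricMulticategory_waldMulti (h : MultiexactStable.{u}) :
    IsSymmetricMulticategory (waldMulti h) where
  act_refl _ := multiexact_ext (eq_actFunctor (e := Equiv.refl _) rfl).symm
  act_act e e' f := multiexact_ext (actFunctor_actFunctor e e' f.obj)
  one_comp _ := multiexact_ext (eq_actFunctor (e := unitSigma _) rfl)
  comp_one _ := multiexact_ext (eq_actFunctor (e := sigmaUnit _) rfl)
  assoc _ _ _ := multiexact_ext (eq_actFunctor (e := Equiv.sigmaAssoc _) rfl)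
  act_comp e f g := multiexact_ext (compFunctor_actFunctor_left e f.obj fun i => (g i).obj)
  comp_act e f g := multiexact_ext (compFunctor_actFunctor_right e f.obj fun i => (g i).obj)

end SymmetricMulticategory

section ClosedMulticategory

variable {ι : Type} {D : WaldCat.{u}}

theorem permute_refl (C : ι → WaldCat.{u}) : permute C (Equiv.refl ι) = 𝟭 _ :=
  comap_permute C (Equiv.refl ι)

theorem permute_permute {ι' ι'' : Type} (C : ι → WaldCat.{u}) (e : ι' ≃ ι) (e' : ι'' ≃ ι') :
    permute (fun j => C (e j)) e' ⋙ permute C e = permute C (e'.trans e) := by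
  let E := Pi.comap (fun i => (C i).carrier) (e'.trans e)
  let E' := permute (fun j => C (e j)) e' ⋙ permute C e
  have left_inv : permute C (e'.trans e) ⋙ E = 𝟭 _ := permute_comap C (e'.trans e)
  have right_inv : E ⋙ E' = 𝟭 _ := by
    change Pi.comap (fun i => (C i).carrier) e ⋙ (Pi.comap (fun j => (C (e j)).carrier) e' ⋙
      permute (fun j => C (e j)) e') ⋙ permute C e = 𝟭 _
    rw [comap_permute]
    exact comap_permute C e
  exact (congrArg (· ⋙ E') left_inv).symm.trans
    (congrArg (permute C (e'.trans e) ⋙ ·) right_inv)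

/-- The functor `F ↦ E ⋙ F` between categories of multiexact functors, for a functor `E` such that
precomposition with `E` preserves multiexactness. -/
def precompFunctor {ι' : Type} {C : ι → WaldCat.{u}} {C' : ι' → WaldCat.{u}}
    (E : (∀ j, C' j) ⥤ (∀ i, C i))
    (hE : ∀ F : (∀ i, C i) ⥤ D, IsMultiexact C D F → IsMultiexact C' D (E ⋙ F)) :
    (∀ _ : Unit, Multiexact C D) ⥤ Multiexact C' D where
  obj F := ⟨E ⋙ (F ()).obj, hE _ (F ()).property⟩
  map α := ObjectProperty.homMk (Functor.whiskerLeft E (α ()).hom)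

theorem precompFunctor_congr {ι' : Type} {C : ι → WaldCat.{u}} {C' : ι' → WaldCat.{u}}
    {E E' : (∀ j, C' j) ⥤ (∀ i, C i)} (e : E = E')
    (hE : ∀ F : (∀ i, C i) ⥤ D, IsMultiexact C D F → IsMultiexact C' D (E ⋙ F))
    (hE' : ∀ F : (∀ i, C i) ⥤ D, IsMultiexact C D F → IsMultiexact C' D (E' ⋙ F)) :
    precompFunctor E hE = precompFunctor E' hE' := by
  subst e; rfl

section

variable [Finite ι] (h : MultiexactStable.{u})

theorem homActFunctor_refl (C : ι → WaldCat.{u})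
    (hW : IsWaldhausen (Multiexact C D) homCof homWeq) :
    homActFunctor h C D (Equiv.refl ι) = idFunctor (internalHom C D hW) :=
  precompFunctor_congr (permute_refl C) (h.act (Equiv.refl ι)) fun _ hF => hF

theorem homActFunctor_homActFunctor {ι' ι'' : Type} [Finite ι'] [Finite ι''] (C : ι → WaldCat.{u})
    (e : ι' ≃ ι) (e' : ι'' ≃ ι') :
    Functor.pi' (fun _ : Unit => homActFunctor h C D e) ⋙
      homActFunctor h (fun j => C (e j)) D e' = homActFunctor h C D (e'.trans e) :=
  precompFunctor_congr (permute_permute C e e')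
    (fun F hF => h.act e' _ (h.act e F hF)) (h.act (e'.trans e))

theorem comap_uncurryHom_homActFunctor {ι' κ κ' : Type} [Finite ι'] {C : ι ⊕ κ → WaldCat.{u}}
    (e : ι' ≃ ι) (t : κ' ≃ κ)
    (K : (∀ k, C (Sum.inr k)) ⥤ Multiexact (fun i => C (Sum.inl i)) D) :
    Pi.comap (fun s => (C s).carrier) (Equiv.sumCongr e t) ⋙
      uncurryHom (C := fun s => C (Equiv.sumCongr e t s))
        (Functor.pi' (fun _ : Unit => permute (fun k => C (Sum.inr k)) t ⋙ K) ⋙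
          homActFunctor h (fun i => C (Sum.inl i)) D e) = uncurryHom K :=
  congrArg₂ (fun E₁ E₂ => evalAlong (C := fun i => C (Sum.inl i))
      (Pi.comap (fun s => (C s).carrier) Sum.inl ⋙ E₁)
      (Pi.comap (fun s => (C s).carrier) Sum.inr ⋙ E₂) K)
    (comap_permute (fun i => C (Sum.inl i)) e) (comap_permute (fun k => C (Sum.inr k)) t)

end

/-- Currying of multiexact functors, in the direction of evaluation: `K` corresponds to the functor
`(X, Y) ↦ K Y X`. -/
def curryEquiv {κ : Type} {C : ι ⊕ κ → WaldCat.{u}} [Finite ι] [Finite κ]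
    (hW : IsWaldhausen (Multiexact (fun i => C (Sum.inl i)) D) homCof homWeq) :
    Multiexact (fun k => C (Sum.inr k)) (internalHom (fun i => C (Sum.inl i)) D hW) ≃
      Multiexact C D where
  toFun K := ⟨uncurryHom K.obj, isMultiexact_uncurryHom hW K.property⟩
  invFun F := ⟨curryHom F.property, isMultiexact_of_uncurryHom hW (by
    rw [uncurryHom_curryHom]
    exact F.property)⟩
  left_inv K := multiexact_ext (curryHom_uncurryHom (isMultiexact_uncurryHom hW K.property))
  right_inv F := multiexact_ext (uncurryHom_curryHom F.property)

variable (h : MultiexactStable.{u})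

theorem postcomp_obj [Finite ι] {B B' : WaldCat.{u}} {A : ι → WaldCat.{u}}
    (u : Multiexact (fun _ : Unit => B) B') (f : Multiexact A B) :
    ((waldMulti h).postcomp (A := A) (B := B) (B' := B') u f : Multiexact A B').obj =
      Functor.pi' (fun _ : Unit => f.obj) ⋙ u.obj :=
  (eq_actFunctor (C := fun p : (Σ _ : Unit, ι) => A p.2) (e := (unitSigma ι).symm)
    (F := compFunctor (A := fun p : (Σ _ : Unit, ι) => A p.2) u.obj fun _ => f.obj)
    (H := Functor.pi' (fun _ : Unit => f.obj) ⋙ u.obj) rfl).symm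

variable (hW : ∀ {ι : Type} [Finite ι] (C : ι → WaldCat.{u}) (D : WaldCat.{u}),
    IsWaldhausen (Multiexact C D) homCof homWeq)
  (hev : ∀ {ι : Type} [Finite ι] (C : ι → WaldCat.{u}) (D : WaldCat.{u}),
    IsMultiexact _ D (evFunctor C D (hW C D)))
  (hact : ∀ {ι ι' : Type} [Finite ι] [Finite ι'] (C : ι → WaldCat.{u}) (D : WaldCat.{u})
    (e : ι' ≃ ι), IsMultiexact (fun _ : Unit => internalHom C D (hW C D))
      (internalHom (fun j => C (e j)) D (hW _ D)) (homActFunctor h C D e))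

theorem act_curryEquiv {κ : Type} [Finite ι] [Finite κ] (C : ι ⊕ κ → WaldCat.{u})
    (K : Multiexact (fun k => C (Sum.inr k)) (internalHom (fun i => C (Sum.inl i)) D (hW _ D))) :
    (waldMulti h).act (evInputsEquiv ι κ) (curryEquiv (hW _ D) K) =
      (waldHom h hW hev hact).evComp C D K :=
  multiexact_ext (eq_actFunctor (C := C) (D := D) (e := evInputsEquiv ι κ)
    (F := uncurryHom K.obj)
    (H := ((waldHom h hW hev hact).evComp C D K : Multiexact _ _).obj) rfl).symm

theorem curryEquiv_postcomp_homAct {ι' κ κ' : Type} [Finite ι] [Finite ι'] [Finite κ] [Finite κ']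
    (C : ι ⊕ κ → WaldCat.{u}) (e : ι' ≃ ι) (t : κ' ≃ κ)
    (K : Multiexact (fun k => C (Sum.inr k)) (internalHom (fun i => C (Sum.inl i)) D (hW _ D))) :
    curryEquiv (C := fun s => C (Equiv.sumCongr e t s)) (hW _ D)
        ((waldMulti h).postcomp ((waldHom h hW hev hact).homAct (fun i => C (Sum.inl i)) D e)
          ((waldMulti h).act t K)) =
      (waldMulti h).act (Equiv.sumCongr e t) (curryEquiv (hW _ D) K) := by
  let K' := (waldMulti h).postcomp ((waldHom h hW hev hact).homAct (fun i => C (Sum.inl i)) D e)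
    ((waldMulti h).act t K)
  have hK' := postcomp_obj h ⟨_, hact (fun i => C (Sum.inl i)) D e⟩ ((waldMulti h).act t K)
  refine multiexact_ext (eq_actFunctor (C := C) (D := D) (e := Equiv.sumCongr e t)
    (F := uncurryHom K.obj)
    (H := uncurryHom (C := fun s => C (Equiv.sumCongr e t s)) K'.obj) ?_)
  refine Eq.trans ?_ (comap_uncurryHom_homActFunctor h e t K.obj)
  exact congrArg (fun L => Pi.comap (fun s => (C s).carrier) (Equiv.sumCongr e t) ⋙
    uncurryHom (C := fun s => C (Equiv.sumCongr e t s)) L) hK'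

theorem isClosedMulticategory_waldMulti :
    IsClosedMulticategory (waldMulti h) (waldHom h hW hev hact) where
  symmetric := isSymmetricMulticategory_waldMulti h
  homAct_refl C D := multiexact_ext (homActFunctor_refl h C (hW C D))
  homAct_homAct C _ e e' := multiexact_ext <|
    (postcomp_obj h _ _).trans (homActFunctor_homActFunctor h C e e')
  closed := ⟨fun _ D => curryEquiv (hW _ D), fun C _ K => act_curryEquiv h hW hev hact C K,
    fun C _ e t K => curryEquiv_postcomp_homAct h hW hev hact C e t K⟩

end ClosedMulticategory

end Waldhausen

end

theorem mainTheorem1 :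
    ∃ (h : MultiexactStable.{u})
      (hW : ∀ {ι : Type} [Finite ι] (C : ι → WaldCat.{u}) (D : WaldCat.{u}),
        IsWaldhausen (Multiexact C D) homCof homWeq)
      (hev : ∀ {ι : Type} [Finite ι] (C : ι → WaldCat.{u}) (D : WaldCat.{u}),
        IsMultiexact (Sum.elim C (fun _ : Unit => internalHom C D (hW C D))) D (evFunctor C D (hW C D)))
      (hact : ∀ {ι ι' : Type} [Finite ι] [Finite ι'] (C : ι → WaldCat.{u}) (D : WaldCat.{u})
        (e : ι' ≃ ι),
        IsMultiexact (fun _ : Unit => internalHom C D (hW C D)) (internalHom (fun j => C (e j)) D (hW _ D))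
          (homActFunctor h C D e)),
      IsClosedMulticategory (waldMulti h) (waldHom h hW hev hact) ∧
      ∀ {ι : Type} [Finite ι] {J : ι → Type} [∀ i, Finite (J i)]
        (A : (Σ i, J i) → WaldCat.{u}) (B : ι → WaldCat.{u}) (D : WaldCat.{u}),
        IsMultiexact
          (Sum.elim (fun _ : Unit => internalHom B D (hW B D))
            (fun i => internalHom (fun j => A ⟨i, j⟩) (B i) (hW _ (B i))))
          (internalHom A D (hW A D)) (compositionFunctor h hW A B D) :=
  ⟨multiexactStable,
    fun _ _ => isWaldhausen_multiexact,
    fun _ _ => isMultiexact_evFunctor _,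
    fun _ _ _ => isMultiexact_homActFunctor _ _ _ _ _ _,
    isClosedMulticategory_waldMulti _ _ _ _,
    fun A B D => isMultiexact_compositionFunctor (fun _ _ => isWaldhausen_multiexact) A B D
      multiexactStable⟩
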